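/- Let $G$ be a compact Lie group and $H$ a $G$-universe: a separable real Hilbert space with a continuous orthogonal $G$-action which contains the trivial representation and for which $\mathrm{Hom}_G(V,H)$ is zero or infinite dimensional for every finite dimensional real $G$-module $V$. Let $Y$ be a finite $G$-CW complex and $E'\to Y$ a $G$-Hilbert bundle, that is, a locally trivial bundle with fibre a separable real Hilbert space and with structure group the group of linear isometric bijections in the norm topology, together with a continuous fibrewise linear isometric action of $G$ covering the action on $Y$. Let $E=Y\times H$ with the diagonal action. A *linear Fredholm morphism* is an equivariant fibre preserving map $l:E'\to E$ which is fibrewise linear Fredholm and, in local trivializations, continuous in the operator norm. Let $f:E'\to E$ be $G$-equivariant and fibre preserving, $f=l+c$ with $l$ a linear Fredholm morphism and $c$ continuous, fibre preserving and compact (bounded disk bundles are mapped to relatively compact sets). Assume that $f$ extends continuously to the fibrewise one-point completions, where neighbourhoods of infinity are complements of bounded sets. Points of $E$ are identified with their $H$-components where convenient. Notation. For a finite dimensional $G$-invariant subspace $V\subset H$ put $F_0(V)=l^{-1}(Y\times V)\subset E'$, with Thom space $TF_0(V)$ (its one-point compactification), and say that $V$ *spans* if $\mathrm{im}(l_y)+V=H$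 for all $y\in Y$; the index bundle is then represented by $F_0(V)-Y\times V$. For $V\subset W$ and $U=W\cap V^\perp$, the suspension of $\alpha:TF_0(V)\to V^+$ is $\mathrm{id}_{U^+}\wedge\alpha: TF_0(W)\cong U^+\wedge TF_0(V)\to U^+\wedge V^+=W^+$, where $x\in F_0(W)$ corresponds to $(\mathrm{pr}_U l(x),\mathrm{pr}_{F_0(V)}x)$. The stable cohomotopy $\pi^0_{G,H}(Y;\mathrm{ind}\,l)$ is the colimit, under suspension, over all spanning $V$ of the sets $[TF_0(V),V^+]^G$ of pointed $G$-homotopy classes of pointed $G$-maps. Let $\rho_V:H^+\setminus S(V^\perp)\to V^+$ be the retraction obtained, after identifying $H^+$ with the unit sphere of $\mathbb R\oplus H$ by $h\mapsto(|h|^2+1)^{-1}(|h|^2-1,2h)$, from orthogonal projection to $\mathbb R\oplus V$ followed by normalization. Let $f(V)^+:TF_0(V)\to H^+$ be induced by $f$. Call $V$ *admissible* for $(f,l)$ if it spans and if, for every finite dimensional $G$-invariant $W\supset V$, the map $f(W)^+$ misses the unit sphere $S(W^\perp)$ and $\rho_Wf(W)^+$ is homotopic, through pointed $G$-maps, to the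 suspension of $\rho_Vf(V)^+$. Theorem. (a) $f=l+c$ defines a stable cohomotopy Euler class $[f]_l\in\pi^0_{G,H}(Y;\mathrm{ind}\,l)$: admissible subspaces are cofinal among the finite dimensional $G$-invariant subspaces of $H$, for every admissible $V$ the map $\rho_Vf(V)^+$ is a pointed $G$-map, and there is exactly one element $[f]_l$ which for every admissible $V$ is the class of $\rho_Vf(V)^+$. (b) This class is independent of the presentation of $f$ as a sum: let $f=l'+c'$ be another presentation of the same kind. Then $l_t=(1-t)l+tl'$ is a linear Fredholm morphism over $Y\times[0,1]$, the restriction maps from $\pi^0_{G,H}(Y\times[0,1];\mathrm{ind}\,l_\bullet)$ to $\pi^0_{G,H}(Y;\mathrm{ind}\,l)$ at $t=0$ and to $\pi^0_{G,H}(Y;\mathrm{ind}\,l')$ at $t=1$ are bijective, and the resulting bijection $\pi^0_{G,H}(Y;\mathrm{ind}\,l)\cong\pi^0_{G,H}(Y;\mathrm{ind}\,l')$ maps $[f]_l$ to $[f]_{l'}$. -/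

import Mathlib

open Bundle Set Filter Topology
open scoped Manifold ContDiff

noncomputable section

namespace CohomotopyEuler

/-! ### Group actions, universes, finite `G`-CW complexes -/

/-- The `G`-equivariant linear maps from the finite dimensional real representation `ρ` to `H`. -/
def equivariantHom {G H : Type*} [Group G] [AddCommGroup H] [Module ℝ H] [DistribMulAction G H]
    [SMulCommClass G ℝ H] {n : ℕ} (ρ : Representation ℝ G (Fin n → ℝ)) :
    Submodule ℝ ((Fin n → ℝ) →ₗ[ℝ] H) where
  carrier := {T | ∀ g v, T (ρ g v) = g • T v}
  add_mem' := by
    intro S T hS hT g v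
    simp [hS g v, hT g v]
  zero_mem' := by
    intro g v
    simp
  smul_mem' := by
    intro r T hT g v
    simp [hT g v, smul_comm g r]

/-- A real Hilbert space `H` with a continuous linear `G`-action is a `G`-universe if the action is
orthogonal, `H` contains the trivial representation, and for every finite dimensional real
`G`-module `V` the space `Hom_G(V, H)` is zero or infinite dimensional. -/
structure IsUniverse (G H : Type*) [Group G] [TopologicalSpace G] [NormedAddCommGroup H]
    [InnerProductSpace ℝ H] [DistribMulAction G H] [SMulCommClass G ℝ H] : Prop where
  norm_smul : ∀ (g : G) (h : H), ‖g • h‖ = ‖h‖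
  exists_fixed : ∃ h : H, h ≠ 0 ∧ ∀ g : G, g • h = h
  hom_zero_or_infinite : ∀ (n : ℕ) (ρ : Representation ℝ G (Fin n → ℝ)),
    (Continuous fun p : G × (Fin n → ℝ) => ρ p.1 p.2) →
      (equivariantHom ρ : Submodule ℝ ((Fin n → ℝ) →ₗ[ℝ] H)) = ⊥ ∨
        ¬ FiniteDimensional ℝ (equivariantHom ρ : Submodule ℝ ((Fin n → ℝ) →ₗ[ℝ] H))

/-- The structure of a finite `G`-CW complex on a Hausdorff `G`-space `Y` (`G` compact): finitely
many equivariant cells `G/K × Dⁿ`, `K` a closed subgroup, with characteristic maps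
`(g K, x) ↦ char i g x`. They are injective on the open cells `G/K × int Dⁿ`, the images of the open
cells partition `Y`, and the boundary `G/K × Sⁿ⁻¹` is mapped to open cells of smaller dimension.
The values of `char i g x` for `‖x‖ > 1` are irrelevant. -/
structure FiniteGCWComplex (G Y : Type*) [Group G] [TopologicalSpace G] [TopologicalSpace Y]
    [MulAction G Y] where
  numCells : ℕ
  dim : Fin numCells → ℕ
  stab : Fin numCells → Subgroup G
  isClosed_stab : ∀ i, IsClosed (stab i : Set G)
  char : ∀ i, G → EuclideanSpace ℝ (Fin (dim i)) → Y
  continuousOn_char : ∀ i, ContinuousOn (fun p : G × EuclideanSpace ℝ (Fin (dim i)) =>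
    char i p.1 p.2) (univ ×ˢ Metric.closedBall 0 1)
  char_mul : ∀ i g h x, ‖x‖ ≤ 1 → char i (g * h) x = g • char i h x
  char_eq_iff : ∀ i g h x y, ‖x‖ < 1 → ‖y‖ < 1 →
    (char i g x = char i h y ↔ x = y ∧ g⁻¹ * h ∈ stab i)
  disjoint : ∀ i j g h x y, i ≠ j → ‖x‖ < 1 → ‖y‖ < 1 → char i g x ≠ char j h y
  boundary : ∀ i g x, ‖x‖ = 1 → ∃ j h y, dim j < dim i ∧ ‖y‖ < 1 ∧ char i g x = char j h y
  covers : ∀ z, ∃ i g x, ‖x‖ < 1 ∧ char i g x = z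

/-- A finite dimensional `G`-invariant linear subspace of `H`. -/
structure FinGSubspace (G H : Type*) [Group G] [NormedAddCommGroup H] [InnerProductSpace ℝ H]
    [DistribMulAction G H] where
  space : Submodule ℝ H
  finite : FiniteDimensional ℝ space
  smul_mem : ∀ (g : G) (v : H), v ∈ space → g • v ∈ space

instance {G H : Type*} [Group G] [NormedAddCommGroup H] [InnerProductSpace ℝ H]
    [DistribMulAction G H] (V : FinGSubspace G H) : FiniteDimensional ℝ V.space := V.finite

/-- The action of `G` on an invariant subspace. -/
def FinGSubspace.act {G H : Type*} [Group G] [NormedAddCommGroup H] [InnerProductSpace ℝ H]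
    [DistribMulAction G H] (V : FinGSubspace G H) (g : G) (v : V.space) : V.space :=
  ⟨g • (v : H), V.smul_mem g v v.2⟩

/-! ### `G`-Hilbert bundles -/

/-- A vector bundle with Hilbert space fibers is a Hilbert bundle if the local trivializations of
its atlas are fiberwise isometric. (Coordinate changes of a `VectorBundle` are continuous in the
operator norm, so the structure group is the orthogonal group with the norm topology.) -/
def IsHilbertBundle {B : Type*} [TopologicalSpace B] (F : Type*) [NormedAddCommGroup F]
    (E : B → Type*) [∀ b, NormedAddCommGroup (E b)]
    [TopologicalSpace (TotalSpace F E)] [FiberBundle F E] : Prop :=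
  ∀ (e : Trivialization F (π F E)) [MemTrivializationAtlas e], ∀ b ∈ e.baseSet, ∀ v : E b,
    ‖(e (TotalSpace.mk' F b v)).2‖ = ‖v‖

/-- A continuous action of `G` on the total space of `E`, which covers the action on the base and is
fiberwise linear and isometric. -/
structure GAction (G : Type*) [Group G] [TopologicalSpace G] {B : Type*} [MulAction G B]
    (F : Type*) (E : B → Type*) [∀ b, NormedAddCommGroup (E b)]
    [∀ b, InnerProductSpace ℝ (E b)] [TopologicalSpace (TotalSpace F E)] where
  act : ∀ (g : G) (b : B), E b →ₗᵢ[ℝ] E (g • b)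
  one_act : ∀ x : TotalSpace F E, TotalSpace.mk' F ((1 : G) • x.proj) (act 1 x.proj x.2) = x
  mul_act : ∀ (g h : G) (x : TotalSpace F E),
    TotalSpace.mk' F ((g * h) • x.proj) (act (g * h) x.proj x.2) =
      TotalSpace.mk' F (g • h • x.proj) (act g (h • x.proj) (act h x.proj x.2))
  continuous_act : Continuous fun p : G × TotalSpace F E =>
    TotalSpace.mk' F (p.1 • p.2.proj) (act p.1 p.2.proj p.2.2)

section Bundles

variable {G : Type*} [Group G] [TopologicalSpace G] {B : Type*} [MulAction G B]
  {F : Type*} {E : B → Type*} [∀ b, NormedAddCommGroup (E b)] [∀ b, InnerProductSpace ℝ (E b)]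
  [TopologicalSpace (TotalSpace F E)]
  {H : Type*} [NormedAddCommGroup H] [InnerProductSpace ℝ H] [DistribMulAction G H]

/-- The action on the total space. -/
def GAction.tot (A : GAction G F E) (g : G) (x : TotalSpace F E) : TotalSpace F E :=
  TotalSpace.mk' F (g • x.proj) (A.act g x.proj x.2)

variable (H) in
/-- An equivariant family of bounded linear maps from the fibers of `E` to `H`, i.e. a
fiberwise linear equivariant map over `B` from `E` to the product bundle `B × H` (with the
diagonal `G`-action). -/
structure Morphism (A : GAction G F E) where
  toFun : ∀ b : B, E b →L[ℝ] H
  equivariant : ∀ (g : G) (b : B) (v : E b), toFun (g • b) (A.act g b v) = g • toFun b v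

variable {A : GAction G F E}

/-- The map from the total space to `H` given by a morphism to the product bundle. -/
def Morphism.tot (l : Morphism H A) (x : TotalSpace F E) : H := l.toFun x.proj x.2

/-- The morphism is a linear Fredholm morphism: fiberwise it is a Fredholm operator, and
in local trivializations it depends continuously on the base point in the operator norm. -/
structure Morphism.IsFredholm [TopologicalSpace B] [NormedAddCommGroup F] [InnerProductSpace ℝ F]
    [FiberBundle F E] [VectorBundle ℝ F E] (l : Morphism H A) : Prop where
  fredholm : ∀ b, (l.toFun b).IsFredholm
  continuousOn : ∀ (e : Trivialization F (π F E)) [MemTrivializationAtlas e],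
    ContinuousOn (fun b => (l.toFun b).comp (e.symmL ℝ b)) e.baseSet

/-- `f = l + c` is a presentation of the fiber preserving map `x ↦ (proj x, f x)` from `E` to the
product bundle `B × H` as the sum of a linear Fredholm morphism `l` and a continuous
map `c` which is compact, i.e. maps bounded disk bundles to relatively compact sets. -/
structure IsPresentation [TopologicalSpace B] [NormedAddCommGroup F] [InnerProductSpace ℝ F]
    [FiberBundle F E] [VectorBundle ℝ F E]
    (f : TotalSpace F E → H) (l : Morphism H A) (c : TotalSpace F E → H) : Prop where
  isFredholm : l.IsFredholm
  continuous : Continuous c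
  compact : ∀ R : ℝ, IsCompact (closure (c '' {x | ‖x.2‖ ≤ R}))
  eq_add : ∀ x, f x = l.tot x + c x

end Bundles

/-! ### Fiberwise one-point completions -/

/-- The fiberwise one-point completion of a bundle of normed spaces: one point at infinity
`Sum.inr b` is added to each fiber. -/
def FiberwiseCompletion {B : Type*} (F : Type*) (E : B → Type*) := TotalSpace F E ⊕ B

/-- The total space is open in the completion, and neighborhoods of the point at infinity over `b`
contain all points, finite and infinite, over a neighborhood of `b`, except for those in a
bounded disk bundle. For a one-point base this is the sphere `H⁺ ≅ S(ℝ ⊕ H)`. -/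
instance {B : Type*} [TopologicalSpace B] (F : Type*) (E : B → Type*)
    [∀ b, NormedAddCommGroup (E b)] [TopologicalSpace (TotalSpace F E)] :
    TopologicalSpace (FiberwiseCompletion F E) where
  IsOpen U := IsOpen {x : TotalSpace F E | (Sum.inl x : TotalSpace F E ⊕ B) ∈ U} ∧
    ∀ b : B, (Sum.inr b : TotalSpace F E ⊕ B) ∈ U → ∃ N ∈ 𝓝 b, ∃ r : ℝ,
      (∀ b' ∈ N, (Sum.inr b' : TotalSpace F E ⊕ B) ∈ U) ∧
      ∀ x : TotalSpace F E, x.proj ∈ N → r < ‖x.2‖ → (Sum.inl x : TotalSpace F E ⊕ B) ∈ U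
  isOpen_univ := ⟨isOpen_univ, fun b _ => ⟨univ, univ_mem, 0, fun _ _ => mem_univ _,
    fun _ _ _ => mem_univ _⟩⟩
  isOpen_inter := by
    rintro U V ⟨hU, hU'⟩ ⟨hV, hV'⟩
    refine ⟨hU.inter hV, fun b hb => ?_⟩
    obtain ⟨N, hN, r, h1, h2⟩ := hU' b hb.1
    obtain ⟨M, hM, s, h3, h4⟩ := hV' b hb.2
    refine ⟨N ∩ M, inter_mem hN hM, max r s, fun b' hb' => ⟨h1 b' hb'.1, h3 b' hb'.2⟩,
      fun x hx hr => ⟨h2 x hx.1 ((le_max_left _ _).trans_lt hr),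
        h4 x hx.2 ((le_max_right _ _).trans_lt hr)⟩⟩
  isOpen_sUnion := by
    intro S hS
    refine ⟨?_, ?_⟩
    · have : {x : TotalSpace F E | (Sum.inl x : TotalSpace F E ⊕ B) ∈ ⋃₀ S} =
          ⋃ U ∈ S, {x : TotalSpace F E | (Sum.inl x : TotalSpace F E ⊕ B) ∈ U} := by
        ext x
        constructor
        · rintro ⟨U, hU, hx⟩
          exact mem_biUnion hU hx
        · intro hx
          obtain ⟨U, hU, hx⟩ := mem_iUnion₂.1 hx
          exact ⟨U, hU, hx⟩
      rw [this]
      exact isOpen_biUnion fun U hU => (hS U hU).1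
    · rintro b ⟨U, hU, hb⟩
      obtain ⟨N, hN, r, h1, h2⟩ := (hS U hU).2 b hb
      exact ⟨N, hN, r, fun b' hb' => ⟨U, hU, h1 b' hb'⟩, fun x hx hr => ⟨U, hU, h2 x hx hr⟩⟩

/-- The map between fiberwise one-point completions induced by the fiber preserving map
`x ↦ (proj x, f x)` from `E` to the product bundle `B × H`. -/
def fiberwiseExtension {B : Type*} {F : Type*} {E : B → Type*} {H : Type*}
    (f : TotalSpace F E → H) :
    FiberwiseCompletion F E → FiberwiseCompletion H (Bundle.Trivial B H) :=
  Sum.map (fun x => TotalSpace.mk' H x.proj (f x)) id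

/-! ### Index bundles, Thom spaces and stable cohomotopy -/

section Cohomotopy

variable {G : Type*} [Group G] [TopologicalSpace G] {B : Type*} [MulAction G B]
  {F : Type*} {E : B → Type*} [∀ b, NormedAddCommGroup (E b)] [∀ b, InnerProductSpace ℝ (E b)]
  [TopologicalSpace (TotalSpace F E)]
  {H : Type*} [NormedAddCommGroup H] [InnerProductSpace ℝ H] [DistribMulAction G H]
  {A : GAction G F E}

/-- `V` is mapped onto the cokernel of `l` in each fiber. For such `V` the index bundle
of `l` is represented as `F₀(V) - B × V`. -/
def Spans (l : Morphism H A) (V : FinGSubspace G H) : Prop :=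
  ∀ b, LinearMap.range (l.toFun b).toLinearMap ⊔ V.space = ⊤

/-- The total space of the bundle `F₀(V) = l⁻¹(V)`, a subspace of `E`. Over a compact base,
its Thom space is the one-point compactification `OnePoint (F₀ l V)`. -/
def F₀ (l : Morphism H A) (V : FinGSubspace G H) : Type _ :=
  {x : TotalSpace F E // l.tot x ∈ V.space}

instance (l : Morphism H A) (V : FinGSubspace G H) : TopologicalSpace (F₀ l V) :=
  inferInstanceAs (TopologicalSpace {x : TotalSpace F E // l.tot x ∈ V.space})

/-- The action of `G` on `F₀(V)`. -/
def F₀.act (l : Morphism H A) (V : FinGSubspace G H) (g : G) (x : F₀ l V) : F₀ l V :=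
  ⟨A.tot g x.1, by
    have h : l.tot (A.tot g x.1) = g • l.tot x.1 := l.equivariant g x.1.proj x.1.2
    rw [h]
    exact V.smul_mem g _ x.2⟩

/-- A pointed `G`-map from the Thom space of `F₀(V)` to the sphere `V⁺`. -/
structure IsPointedGMap (l : Morphism H A) (V : FinGSubspace G H)
    (α : OnePoint (F₀ l V) → OnePoint V.space) : Prop where
  continuous : Continuous α
  map_infty : α OnePoint.infty = OnePoint.infty
  equivariant : ∀ (g : G) (x : OnePoint (F₀ l V)),
    α (OnePoint.map (F₀.act l V g) x) = OnePoint.map (V.act g) (α x)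

/-- There is a homotopy through pointed `G`-maps from `α` to `β`. -/
def GHomotopic (l : Morphism H A) (V : FinGSubspace G H)
    (α β : OnePoint (F₀ l V) → OnePoint V.space) : Prop :=
  ∃ h : unitInterval × OnePoint (F₀ l V) → OnePoint V.space, Continuous h ∧
    (∀ t, IsPointedGMap l V fun x => h (t, x)) ∧
    (∀ x, h (0, x) = α x) ∧ (∀ x, h (1, x) = β x)

variable [∀ b, CompleteSpace (E b)]

instance fiber_hasOrthogonalProjection (l : Morphism H A) (V : FinGSubspace G H) (b : B) :
    (V.space.comap (l.toFun b).toLinearMap).HasOrthogonalProjection := by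
  have h : IsClosed ((V.space.comap (l.toFun b).toLinearMap : Submodule ℝ (E b)) : Set (E b)) :=
    V.space.closed_of_finiteDimensional.preimage (l.toFun b).continuous
  have : CompleteSpace (V.space.comap (l.toFun b).toLinearMap : Submodule ℝ (E b)) :=
    h.completeSpace_coe
  infer_instance

/-- The fiberwise orthogonal projection of `E` onto `F₀(V)`. -/
def F₀.proj (l : Morphism H A) (V : FinGSubspace G H) (x : TotalSpace F E) : F₀ l V :=
  ⟨TotalSpace.mk' F x.proj ((V.space.comap (l.toFun x.proj).toLinearMap).starProjection x.2),
    Submodule.starProjection_apply_mem (V.space.comap (l.toFun x.proj).toLinearMap) x.2⟩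

/-- For `V ⊆ W` and `U = W ∩ Vᗮ`, the suspension `id ∧ α : U⁺ ∧ TF₀(V) → U⁺ ∧ V⁺ = W⁺` of
`α : TF₀(V) → V⁺`, as a map on `TF₀(W)`, which is identified with `U⁺ ∧ TF₀(V)` by
`x ↦ (pr_U (l x), pr_{F₀(V)} x)`. -/
def suspend (l : Morphism H A) {V W : FinGSubspace G H} (hVW : V.space ≤ W.space)
    (α : OnePoint (F₀ l V) → OnePoint V.space) (x : OnePoint (F₀ l W)) : OnePoint W.space :=
  x.elim OnePoint.infty fun x =>
    OnePoint.map
      (fun v : V.space => ⟨(l.tot x.1 - V.space.starProjection (l.tot x.1)) + (v : H),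
        W.space.add_mem (W.space.sub_mem x.2
          (hVW (V.space.starProjection_apply_mem _))) (hVW v.2)⟩)
      (α (F₀.proj l V x.1 : F₀ l V))

/-- Representatives of stable cohomotopy classes: pointed `G`-maps `TF₀(V) → V⁺`, for some `V`
for which `F₀(V) - B × V` represents the index bundle. -/
structure Rep (l : Morphism H A) where
  V : FinGSubspace G H
  spans : Spans l V
  map : OnePoint (F₀ l V) → OnePoint V.space
  isPointedGMap : IsPointedGMap l V map

/-- `b` is `G`-homotopic to a suspension of `a`. -/
def Rep.Rel (l : Morphism H A) (a b : Rep l) : Prop :=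
  ∃ h : a.V.space ≤ b.V.space, GHomotopic l b.V b.map (suspend l h a.map)

/-- The stable equivariant cohomotopy `π⁰_{G,H}(B; ind l)`, the colimit of the sets
`[TF₀(V), V⁺]^G` of pointed equivariant homotopy classes, over the finite dimensional
`G`-invariant subspaces `V` of `H` which span the cokernels of `l`, with suspensions as
connecting maps. (In the notation of spectra, `TF₀(V) = V⁺ ∧ Tλ` for `λ = ind l`.) -/
def StableCohomotopy (l : Morphism H A) : Type _ := Quot (Rep.Rel l)

/-- The class of a representative. -/
def StableCohomotopy.mk {l : Morphism H A} (a : Rep l) : StableCohomotopy l := Quot.mk _ a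

/-! ### The Euler class -/

/-- The retraction `ρ_V : H⁺ ∖ S(Vᗮ) → V⁺`, on points of `H`. The sphere `H⁺` is identified with the
unit sphere of `ℝ ⊕ H` by `h ↦ (|h|² + 1)⁻¹ (|h|² - 1, 2h)`, so that `h` has components `s ∈ ℝ`
and `a ∈ V` (and a third one in `Vᗮ`). The point `(s, a)` is nonzero for `h ∉ S(Vᗮ)`, it is
normalized to a point of the unit sphere of `ℝ ⊕ V` by its norm `N`, and mapped back to `V⁺`
by `(s', a') ↦ (1 - s')⁻¹ a'`, the pole `(1, 0)` being mapped to infinity. -/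
def retraction (V : Submodule ℝ H) [FiniteDimensional ℝ V] (h : H) : OnePoint V :=
  let s : ℝ := (‖h‖ ^ 2 - 1) / (‖h‖ ^ 2 + 1)
  let a : V := (2 / (‖h‖ ^ 2 + 1)) • V.orthogonalProjectionOnto h
  let N : ℝ := √(s ^ 2 + ‖a‖ ^ 2)
  open scoped Classical in
  if s / N = 1 ∨ N = 0 then OnePoint.infty else (((1 - s / N)⁻¹ • N⁻¹ • a : V) : OnePoint V)

/-- The map `ρ_V ∘ f(V)⁺ : TF₀(V) → V⁺`, where `f(V)` is the restriction of `f` to `F₀(V)`. -/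
def finiteApprox (f : TotalSpace F E → H) (l : Morphism H A) (V : FinGSubspace G H)
    (x : OnePoint (F₀ l V)) : OnePoint V.space :=
  x.elim OnePoint.infty fun x => retraction V.space (f x.1)

/-- `V` is admissible for `f` and `l`: it spans the cokernels of `l`, and for all larger `W`
the restriction of `f` to `F₀(W)` misses the unit sphere `S(Wᗮ)`, and `ρ_W ∘ f(W)⁺` is
`G`-homotopic to the suspension of `ρ_V ∘ f(V)⁺`. -/
structure IsAdmissible (f : TotalSpace F E → H) (l : Morphism H A) (V : FinGSubspace G H) :
    Prop where
  spans : Spans l V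
  misses : ∀ W : FinGSubspace G H, V.space ≤ W.space → ∀ x : TotalSpace F E,
    l.tot x ∈ W.space → ¬ (f x ∈ W.spaceᗮ ∧ ‖f x‖ = 1)
  homotopic : ∀ (W : FinGSubspace G H) (h : V.space ≤ W.space),
    GHomotopic l W (finiteApprox f l W) (suspend l h (finiteApprox f l V))

/-- `f` defines the stable cohomotopy class `e` by means of `l`: admissible subspaces are cofinal
among the finite dimensional invariant subspaces, and for each of them, `ρ_V ∘ f(V)⁺` is a
pointed `G`-map with stable class `e`. -/
structure IsEulerClass (f : TotalSpace F E → H) (l : Morphism H A) (e : StableCohomotopy l) :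
    Prop where
  cofinal : ∀ V₀ : FinGSubspace G H, ∃ V : FinGSubspace G H,
    V₀.space ≤ V.space ∧ IsAdmissible f l V
  eq : ∀ (V : FinGSubspace G H) (hV : IsAdmissible f l V),
    ∃ h : IsPointedGMap l V (finiteApprox f l V),
      StableCohomotopy.mk ⟨V, hV.spans, finiteApprox f l V, h⟩ = e

end Cohomotopy

/-! ### Homotopies of cocycles -/

/-- The cylinder `Y × [0,1]`. -/
@[ext]
structure Cyl (Y : Type*) where
  base : Y
  time : unitInterval

/-- The product topology. -/
instance {Y : Type*} [TopologicalSpace Y] : TopologicalSpace (Cyl Y) :=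
  TopologicalSpace.induced (fun p => (p.base, p.time)) inferInstance

theorem Cyl.isInducing {Y : Type*} [TopologicalSpace Y] :
    IsInducing fun p : Cyl Y => (p.base, p.time) := ⟨rfl⟩

/-- The action on the cylinder which is trivial on the unit interval. -/
instance {G Y : Type*} [Group G] [MulAction G Y] : MulAction G (Cyl Y) where
  smul g p := ⟨g • p.base, p.time⟩
  one_smul p := Cyl.ext (one_smul G p.base) rfl
  mul_smul g h p := Cyl.ext (mul_smul g h p.base) rfl

/-- The projection of the cylinder to `Y`. -/
def Cyl.toBase (Y : Type*) [TopologicalSpace Y] : C(Cyl Y, Y) :=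
  ⟨fun p => p.base, continuous_fst.comp Cyl.isInducing.continuous⟩

/-- The pullback of a bundle to the cylinder. -/
def CylBundle {Y : Type*} [TopologicalSpace Y] (E : Y → Type*) : Cyl Y → Type _ :=
  (Cyl.toBase Y : Cyl Y → Y) *ᵖ E

instance {Y : Type*} [TopologicalSpace Y] (E : Y → Type*) [i : ∀ y, NormedAddCommGroup (E y)]
    (p : Cyl Y) : NormedAddCommGroup (CylBundle E p) := i p.base

instance {Y : Type*} [TopologicalSpace Y] (E : Y → Type*) [∀ y, NormedAddCommGroup (E y)]
    [i : ∀ y, InnerProductSpace ℝ (E y)] (p : Cyl Y) : InnerProductSpace ℝ (CylBundle E p) := i p.base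

instance {Y : Type*} [TopologicalSpace Y] (E : Y → Type*) [∀ y, NormedAddCommGroup (E y)]
    [i : ∀ y, CompleteSpace (E y)] (p : Cyl Y) : CompleteSpace (CylBundle E p) := i p.base

instance {Y : Type*} [TopologicalSpace Y] (F : Type*) (E : Y → Type*)
    [TopologicalSpace (TotalSpace F E)] : TopologicalSpace (TotalSpace F (CylBundle E)) :=
  Pullback.TotalSpace.topologicalSpace F E (Cyl.toBase Y)

instance {Y : Type*} [TopologicalSpace Y] (F : Type*) [NormedAddCommGroup F] (E : Y → Type*)
    [∀ y, NormedAddCommGroup (E y)] [TopologicalSpace (TotalSpace F E)] [FiberBundle F E] :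
    FiberBundle F (CylBundle E) :=
  FiberBundle.pullback (F := F) (E := E) (Cyl.toBase Y)

instance {Y : Type*} [TopologicalSpace Y] (F : Type*) [NormedAddCommGroup F]
    [InnerProductSpace ℝ F] (E : Y → Type*) [∀ y, NormedAddCommGroup (E y)]
    [∀ y, InnerProductSpace ℝ (E y)] [TopologicalSpace (TotalSpace F E)] [FiberBundle F E]
    [VectorBundle ℝ F E] : VectorBundle ℝ F (CylBundle E) :=
  VectorBundle.pullback ℝ (F := F) (E := E) (Cyl.toBase Y)

theorem isInducing_cyl {Y : Type*} [TopologicalSpace Y] {F : Type*} {E : Y → Type*}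
    [TopologicalSpace (TotalSpace F E)] : IsInducing fun x : TotalSpace F (CylBundle E) =>
      (x.proj, Pullback.lift (Cyl.toBase Y : Cyl Y → Y) x) :=
  inducing_pullbackTotalSpaceEmbedding F E (Cyl.toBase Y)

section Cylinder

variable {G : Type*} [Group G] [TopologicalSpace G]
  {Y : Type*} [TopologicalSpace Y] [MulAction G Y]
  {F : Type*} {E : Y → Type*} [∀ y, NormedAddCommGroup (E y)] [∀ y, InnerProductSpace ℝ (E y)]
  [TopologicalSpace (TotalSpace F E)]
  {H : Type*} [NormedAddCommGroup H] [InnerProductSpace ℝ H] [DistribMulAction G H]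

/-- The point of the pullback bundle over `Y × [0,1]` given by a point of `E` and a time. -/
def cylMk (t : unitInterval) (x : TotalSpace F E) : TotalSpace F (CylBundle E) :=
  TotalSpace.mk' F (⟨x.proj, t⟩ : Cyl Y) x.2

variable [NormedAddCommGroup F] [FiberBundle F E]

/-- The action on the pullback bundle. -/
def GAction.cyl (A : GAction G F E) : GAction G F (CylBundle E) where
  act g p := A.act g p.base
  one_act x := congrArg (cylMk x.proj.time) (A.one_act (Pullback.lift (Cyl.toBase Y) x))
  mul_act g h x := congrArg (cylMk x.proj.time) (A.mul_act g h (Pullback.lift (Cyl.toBase Y) x))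
  continuous_act := by
    have h1 : Continuous fun q : G × TotalSpace F (CylBundle E) =>
        (q.1, Pullback.lift (Cyl.toBase Y) q.2) :=
      continuous_fst.prodMk ((Pullback.continuous_lift F E (Cyl.toBase Y)).comp continuous_snd)
    have h2 := A.continuous_act.comp h1
    rw [isInducing_cyl.continuous_iff]
    refine Continuous.prodMk ?_ h2
    have h3 : Continuous fun q : G × TotalSpace F (CylBundle E) => q.2.proj.time :=
      continuous_snd.comp (Cyl.isInducing.continuous.comp
        ((Pullback.continuous_proj F E (Cyl.toBase Y)).comp continuous_snd))
    rw [Cyl.isInducing.continuous_iff]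
    exact ((FiberBundle.continuous_proj F E).comp h2).prodMk h3

/-- The straight line homotopy `(1 - t) l + t l'` from `l` to `l'`, over `Y × [0,1]`. -/
def Morphism.line [SMulCommClass G ℝ H] {A : GAction G F E} (l l' : Morphism H A) :
    Morphism H A.cyl where
  toFun p := ((1 - (p.time : ℝ)) • l.toFun p.base + (p.time : ℝ) • l'.toFun p.base :
    E p.base →L[ℝ] H)
  equivariant g p v := by
    have h1 := l.equivariant g p.base v
    have h2 := l'.equivariant g p.base v
    change (1 - (p.time : ℝ)) • l.toFun (g • p.base) (A.act g p.base v) +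
      (p.time : ℝ) • l'.toFun (g • p.base) (A.act g p.base v) =
        g • ((1 - (p.time : ℝ)) • l.toFun p.base v + (p.time : ℝ) • l'.toFun p.base v)
    rw [smul_add, smul_comm g, smul_comm g]
    exact congrArg₂ (fun a b => (1 - (p.time : ℝ)) • a + (p.time : ℝ) • b) h1 h2

theorem Morphism.line_zero [SMulCommClass G ℝ H] {A : GAction G F E} (l l' : Morphism H A)
    (x : TotalSpace F E) : (l.line l').tot (cylMk 0 x) = l.tot x := by
  change (1 - ((0 : unitInterval) : ℝ)) • l.tot x + ((0 : unitInterval) : ℝ) • l'.tot x = l.tot x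
  simp

theorem Morphism.line_one [SMulCommClass G ℝ H] {A : GAction G F E} (l l' : Morphism H A)
    (x : TotalSpace F E) : (l.line l').tot (cylMk 1 x) = l'.tot x := by
  change (1 - ((1 : unitInterval) : ℝ)) • l.tot x + ((1 : unitInterval) : ℝ) • l'.tot x = l'.tot x
  simp

variable {A : GAction G F E} {L : Morphism H A.cyl} {l : Morphism H A} {t : unitInterval}

/-- If `L` over `Y × [0,1]` restricts to `l` over `Y × {t}`, this is the inclusion of the bundle
`F₀(V)` of `l` in the bundle `F₀(V)` of `L`. -/
def F₀.incl (h : ∀ x, L.tot (cylMk t x) = l.tot x) (V : FinGSubspace G H) (x : F₀ l V) : F₀ L V :=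
  ⟨cylMk t x.1, by
    rw [h]
    exact x.2⟩

theorem F₀.isClosedEmbedding_incl (h : ∀ x, L.tot (cylMk t x) = l.tot x)
    (V : FinGSubspace G H) : IsClosedEmbedding (F₀.incl h V) := by
  have hproj : Continuous fun x : F₀ L V => x.1.proj :=
    (Pullback.continuous_proj F E (Cyl.toBase Y)).comp continuous_subtype_val
  have htime : Continuous fun x : F₀ L V => x.1.proj.time :=
    continuous_snd.comp (Cyl.isInducing.continuous.comp hproj)
  have hlift : Continuous fun x : F₀ L V => Pullback.lift (Cyl.toBase Y) x.1 :=
    (Pullback.continuous_lift F E (Cyl.toBase Y)).comp continuous_subtype_val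
  have hval : Continuous fun x : F₀ l V => x.1 := continuous_subtype_val
  have hcont : Continuous (F₀.incl h V) := by
    refine Continuous.subtype_mk ?_ _
    rw [isInducing_cyl.continuous_iff]
    refine Continuous.prodMk ?_ hval
    rw [Cyl.isInducing.continuous_iff]
    exact ((FiberBundle.continuous_proj F E).comp hval).prodMk continuous_const
  refine ⟨⟨⟨?_⟩, ?_⟩, ?_⟩
  · refine le_antisymm hcont.le_induced ?_
    have h1 : IsInducing fun x : F₀ l V => x.1 := IsInducing.subtypeVal
    rw [h1.eq_induced]
    intro U hU
    obtain ⟨W, hW, rfl⟩ := isOpen_induced_iff.1 hU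
    exact isOpen_induced_iff.2 ⟨_, hW.preimage hlift, rfl⟩
  · intro x y hxy
    exact Subtype.ext (congrArg (fun z : F₀ L V => Pullback.lift (Cyl.toBase Y) z.1) hxy)
  · have hr : range (F₀.incl h V) = (fun x : F₀ L V => x.1.proj.time) ⁻¹' {t} := by
      ext x
      constructor
      · rintro ⟨y, rfl⟩
        rfl
      · rintro (hx : x.1.proj.time = t)
        subst hx
        refine ⟨⟨Pullback.lift (Cyl.toBase Y) x.1, ?_⟩, rfl⟩
        rw [← h]
        exact x.2
    rw [hr]
    exact isClosed_singleton.preimage htime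

theorem F₀.continuous_map_incl (h : ∀ x, L.tot (cylMk t x) = l.tot x)
    (V : FinGSubspace G H) : Continuous (OnePoint.map (F₀.incl h V)) := by
  have hc := F₀.isClosedEmbedding_incl h V
  refine OnePoint.continuous_map hc.continuous ?_
  rw [hasBasis_coclosedCompact.tendsto_iff hasBasis_coclosedCompact]
  rintro K ⟨hK, hK'⟩
  exact ⟨F₀.incl h V ⁻¹' K, ⟨hK.preimage hc.continuous, hc.isCompact_preimage hK'⟩,
    fun x hx => hx⟩

theorem F₀.map_incl_act (h : ∀ x, L.tot (cylMk t x) = l.tot x) (V : FinGSubspace G H) (g : G)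
    (x : OnePoint (F₀ l V)) : OnePoint.map (F₀.incl h V) (OnePoint.map (F₀.act l V g) x) =
      OnePoint.map (F₀.act L V g) (OnePoint.map (F₀.incl h V) x) := by
  induction x using OnePoint.rec with
  | infty => rfl
  | coe x => rfl

theorem IsPointedGMap.restrict (h : ∀ x, L.tot (cylMk t x) = l.tot x) {V : FinGSubspace G H}
    {α : OnePoint (F₀ L V) → OnePoint V.space} (hα : IsPointedGMap L V α) :
    IsPointedGMap l V fun x => α (OnePoint.map (F₀.incl h V) x) where
  continuous := hα.continuous.comp (F₀.continuous_map_incl h V)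
  map_infty := hα.map_infty
  equivariant g x := by
    rw [F₀.map_incl_act, hα.equivariant]

theorem Spans.restrict (h : ∀ x, L.tot (cylMk t x) = l.tot x) {V : FinGSubspace G H}
    (hV : Spans L V) : Spans l V := by
  intro y
  have h1 := hV (⟨y, t⟩ : Cyl Y)
  have h2 : LinearMap.range (L.toFun (⟨y, t⟩ : Cyl Y)).toLinearMap =
      LinearMap.range (l.toFun y).toLinearMap := by
    ext z
    constructor
    · rintro ⟨v, rfl⟩
      exact ⟨v, (h (TotalSpace.mk' F y v)).symm⟩
    · rintro ⟨v, rfl⟩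
      exact ⟨v, h (TotalSpace.mk' F y v)⟩
  rwa [h2] at h1

variable [∀ y, CompleteSpace (E y)]

theorem F₀.proj_incl (h : ∀ x, L.tot (cylMk t x) = l.tot x) (V : FinGSubspace G H)
    (x : TotalSpace F E) : F₀.proj L V (cylMk t x) = F₀.incl h V (F₀.proj l V x) := by
  have key : ∀ (K K' : Submodule ℝ (E x.proj)) [K.HasOrthogonalProjection]
      [K'.HasOrthogonalProjection], K = K' → K.starProjection x.2 = K'.starProjection x.2 := by
    rintro K K' _ _ rfl
    rfl
  refine Subtype.ext (congrArg (TotalSpace.mk' F (⟨x.proj, t⟩ : Cyl Y)) ?_)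
  have := fiber_hasOrthogonalProjection L V (⟨x.proj, t⟩ : Cyl Y)
  refine @key _ _ this _ (Submodule.ext fun v => ?_)
  exact iff_of_eq (congrArg (· ∈ V.space) (h (TotalSpace.mk' F x.proj v)))

theorem suspend_restrict (h : ∀ x, L.tot (cylMk t x) = l.tot x) {V W : FinGSubspace G H}
    (hVW : V.space ≤ W.space) (α : OnePoint (F₀ L V) → OnePoint V.space) (x : OnePoint (F₀ l W)) :
    suspend L hVW α (OnePoint.map (F₀.incl h W) x) =
      suspend l hVW (fun y => α (OnePoint.map (F₀.incl h V) y)) x := by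
  induction x using OnePoint.rec with
  | infty => rfl
  | coe x =>
    have h1 : L.tot (F₀.incl h W x).1 = l.tot x.1 := h x.1
    have h2 : F₀.proj L V (F₀.incl h W x).1 = F₀.incl h V (F₀.proj l V x.1) := F₀.proj_incl h V x.1
    change OnePoint.map _ (α (F₀.proj L V (F₀.incl h W x).1 : F₀ L V)) =
      OnePoint.map _ (α (F₀.incl h V (F₀.proj l V x.1) : F₀ L V))
    rw [h2]
    simp only [h1]

/-- If `L` over `Y × [0,1]` restricts to `l` over `Y × {t}`, this is the restriction map
`π⁰_{G,H}(Y × [0,1]; ind L) → π⁰_{G,H}(Y; ind l)`. -/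
def restrict (h : ∀ x, L.tot (cylMk t x) = l.tot x) : StableCohomotopy L → StableCohomotopy l :=
  Quot.map
    (fun a => ⟨a.V, a.spans.restrict h, fun x => a.map (OnePoint.map (F₀.incl h a.V) x),
      a.isPointedGMap.restrict h⟩)
    (by
      rintro a b ⟨hab, k, hk, hk', hk0, hk1⟩
      refine ⟨hab, fun p => k (p.1, OnePoint.map (F₀.incl h b.V) p.2), ?_, ?_, ?_, ?_⟩
      · exact hk.comp (continuous_fst.prodMk ((F₀.continuous_map_incl h b.V).comp continuous_snd))
      · exact fun s => (hk' s).restrict h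
      · exact fun x => hk0 _
      · exact fun x => (hk1 _).trans (suspend_restrict h hab a.map x))

end Cylinder

end CohomotopyEuler

end

/-! Two approximation principles carry the theorem. In `H`, finite dimensional invariant subspaces
approximate every compact set (`exists_finGSubspace_approx`): averaging the rank one operators along
the orbit of h over Haar measure gives a compact symmetric equivariant operator whose kernel is
orthogonal to h, so h is a limit of sums of vectors from the nonzero eigenspaces, which are finite
dimensional and invariant. For operators, surjectivity of T modulo V is measured by a lower bound
for the adjoint on Vᗮ (`AdjointBoundedBelow`). This bound survives perturbations which are small
only modulo V, it controls the distance to T⁻¹(V), and it makes the projection to T⁻¹(V) norm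
continuous in T. Over a compact base one V and one bound serve all fibres (`exists_spansWith`). This
yields continuous projections to F₀(V) and compact disk bundles, without local trivializations of
F₀(V).

For (a), continuity at infinity makes |f| large outside large disk bundles. Fix r with |f| > 1
outside the disk bundle of radius r, and let V span and approximate the values of c on that disk
bundle up to 1/4. Points of V⁺ are treated as rays in ℝ ⊕ V (`dirPoint`); then ρ_V f is the ray of
(|f|² - 1, 2 P_V f), and pointed G-maps which are nowhere antipodal are homotopic along chords
(`GHomotopic.of_not_antipodal`). For V ≤ W, let q be the projection to F₀(V) and u the component of
l(x) in Vᗮ. The suspension of ρ_V f(V)⁺ and the map ρ_W f(W)⁺ are connected through the rays of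
(|f(x_t)|² - 1 + |u|², 2(u + P_V f(x_t))), where x_t moves from qx to x (`gHomotopic_approx`). At t
= 0 this is nowhere antipodal to the suspension, at t = 1 nowhere antipodal to ρ_W f(W)⁺. Hence V is
admissible, and two admissible subspaces are compared on their sum.

For (b), l' - l = c - c' is compact, hence small modulo a large V. So the l_t are Fredholm, with
bounds that are uniform in time (`exists_spansUniformly`). The projections between the fibres of
F₀(V) at different times are injective with inverses bounded by 2, and sliding all points to the
time t shows that restriction is bijective (`restrict_bijective`). The pullback of f to the cylinder
is presented with linear part l_t (`IsPresentation.line`), and its Euler class restricts to the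
Euler classes at both ends (`IsEulerClass.restrict_eq`). -/

noncomputable section

set_option linter.unusedSectionVars false

namespace CohomotopyEuler

/-! ### Finite dimensional invariant subspaces -/

section PeterWeyl

variable {G H : Type*} [Group G] [NormedAddCommGroup H] [InnerProductSpace ℝ H]
  [DistribMulAction G H]

/-- The sum of two finite dimensional invariant subspaces. -/
def FinGSubspace.sup (V W : FinGSubspace G H) : FinGSubspace G H where
  space := V.space ⊔ W.space
  finite := inferInstance
  smul_mem g x hx := by
    obtain ⟨v, hv, w, hw, rfl⟩ := Submodule.mem_sup.1 hx
    rw [smul_add]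
    exact Submodule.add_mem_sup (V.smul_mem g v hv) (W.smul_mem g w hw)

theorem FinGSubspace.le_sup_left (V W : FinGSubspace G H) : V.space ≤ (V.sup W).space :=
  _root_.le_sup_left

theorem FinGSubspace.le_sup_right (V W : FinGSubspace G H) : W.space ≤ (V.sup W).space :=
  _root_.le_sup_right

instance : Nonempty (FinGSubspace G H) :=
  ⟨⟨⊥, inferInstance, fun g v hv => by
    rw [(Submodule.mem_bot ℝ).1 hv, smul_zero]
    exact Submodule.zero_mem _⟩⟩

theorem exists_finGSubspace_ge {ι : Type*} (s : Finset ι) (V : ι → FinGSubspace G H)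
    (V₀ : FinGSubspace G H) :
    ∃ W : FinGSubspace G H, V₀.space ≤ W.space ∧ ∀ i ∈ s, (V i).space ≤ W.space := by
  classical
  induction s using Finset.induction_on with
  | empty => exact ⟨V₀, le_rfl, by simp⟩
  | insert i s _ ih =>
    obtain ⟨W, h0, hW⟩ := ih
    refine ⟨W.sup (V i), h0.trans (W.le_sup_left _), fun j hj => ?_⟩
    rcases Finset.mem_insert.1 hj with rfl | hj
    · exact W.le_sup_right _
    · exact (hW j hj).trans (W.le_sup_left _)

theorem norm_sub_starProjection_le {V : Submodule ℝ H} [V.HasOrthogonalProjection] (h : H)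
    {v : H} (hv : v ∈ V) : ‖h - V.starProjection h‖ ≤ ‖h - v‖ := by
  rw [Submodule.starProjection_minimal]
  exact ciInf_le ⟨0, by rintro _ ⟨_, rfl⟩; positivity⟩ (⟨v, hv⟩ : V)

theorem norm_sub_starProjection_mono {V W : Submodule ℝ H} [V.HasOrthogonalProjection]
    [W.HasOrthogonalProjection] (hVW : V ≤ W) (h : H) :
    ‖h - W.starProjection h‖ ≤ ‖h - V.starProjection h‖ :=
  norm_sub_starProjection_le h (hVW (V.starProjection_apply_mem h))

theorem inner_smul_smul_of_norm [SMulCommClass G ℝ H] (hG : ∀ (g : G) (h : H), ‖g • h‖ = ‖h‖)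
    (g : G) (x y : H) : inner ℝ (g • x) (g • y) = inner ℝ x y := by
  let T : H →ₗᵢ[ℝ] H := ⟨DistribSMul.toLinearMap ℝ H g, hG g⟩
  exact T.inner_map_map x y

/-! ### Density of vectors with finite dimensional orbit span -/

variable [SMulCommClass G ℝ H] [CompleteSpace H] [TopologicalSpace G] [CompactSpace G]
  [IsTopologicalGroup G] [ContinuousSMul G H]

open MeasureTheory InnerProductSpace in
/-- The average of the projections to the lines spanned by the points of an orbit. -/
theorem exists_equivariant_compact_operator (hG : ∀ (g : G) (h : H), ‖g • h‖ = ‖h‖) (h : H) :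
    ∃ T : H →L[ℝ] H, IsCompactOperator T ∧ (T : H →ₗ[ℝ] H).IsSymmetric ∧
      (∀ (g : G) x, T (g • x) = g • T x) ∧ ∀ x, T x = 0 → inner ℝ h x = (0 : ℝ) := by
  let _ : MeasurableSpace G := borel G
  have : BorelSpace G := ⟨rfl⟩
  let μ : Measure G := Measure.haar
  have hgh : Continuous fun g : G => g • h := continuous_id.smul continuous_const
  have hc : Continuous fun g : G => rankOne ℝ (g • h) (g • h) := by
    have h1 : Continuous fun g : G => (rankOne ℝ (g • h) : H →L⋆[ℝ] H →L[ℝ] H) :=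
      (rankOne ℝ : H →L[ℝ] H →L⋆[ℝ] H →L[ℝ] H).continuous.comp hgh
    exact h1.clm_apply hgh
  have hi : Integrable (fun g : G => rankOne ℝ (g • h) (g • h)) μ :=
    hc.integrable_of_hasCompactSupport (HasCompactSupport.of_compactSpace _)
  let T : H →L[ℝ] H := ∫ g, rankOne ℝ (g • h) (g • h) ∂μ
  have hTx : ∀ x, T x = ∫ g, (inner ℝ (g • h) x : ℝ) • g • h ∂μ := fun x => by
    rw [ContinuousLinearMap.integral_apply hi]
    rfl
  have hix : ∀ x, Integrable (fun g : G => (inner ℝ (g • h) x : ℝ) • g • h) μ := fun x =>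
    hi.apply_continuousLinearMap x
  have hin : ∀ x y, inner ℝ (T x) y = ∫ g, (inner ℝ (g • h) x : ℝ) * inner ℝ (g • h) y ∂μ := by
    intro x y
    rw [hTx, real_inner_comm, ← integral_inner (hix x)]
    refine integral_congr_ae (Eventually.of_forall fun g => ?_)
    simp only [inner_smul_right, real_inner_comm]
  refine ⟨T, ?_, ?_, ?_, ?_⟩
  -- The compact operators form a closed subspace, so they contain the mean value of the family;
  -- multiplying by the total mass turns the mean value into the integral.
  · have hcl : IsClosed (compactOperator (RingHom.id ℝ) H H : Set (H →L[ℝ] H)) :=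
      isClosed_setOfPred_isCompactOperator
    have hne : IsFiniteMeasure μ := inferInstance
    have hne' : NeZero μ := inferInstance
    have := Convex.average_mem (μ := μ) (s := (compactOperator (RingHom.id ℝ) H H :
      Set (H →L[ℝ] H))) (Submodule.convex _) hcl (f := fun g : G => rankOne ℝ (g • h) (g • h))
      (Eventually.of_forall fun g => ?_) hi
    · rw [average_eq] at this
      have h2 := (compactOperator (RingHom.id ℝ) H H).smul_mem (μ.real univ) this
      have h3 : μ.real univ ≠ 0 := by 
        simp [measureReal_def, ENNReal.toReal_eq_zero_iff, NeZero.ne μ]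
      rwa [smul_smul, mul_inv_cancel₀ h3, one_smul] at h2
    · change IsCompactOperator (rankOne ℝ (g • h) (g • h))
      rw [rankOne_def']
      have : IsCompactOperator (id : ℝ → ℝ) := isCompactOperator_id
      exact (this.comp_clm (innerSL ℝ (g • h))).clm_comp (.toSpanSingleton ℝ (g • h))
  · intro x y
    change inner ℝ (T x) y = inner ℝ x (T y)
    rw [hin, real_inner_comm, hin]
    simp only [mul_comm]
  · intro a x
    have h1 : a • T x = ∫ g, a • ((inner ℝ (g • h) x : ℝ) • g • h) ∂μ := by
      let L : H →L[ℝ] H := ⟨DistribSMul.toLinearMap ℝ H a, continuous_const_smul a⟩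
      rw [hTx]
      exact (L.integral_comp_comm (hix x)).symm
    -- Left invariance of Haar measure: substitute `a * g` for `g` in the integral for `T (a • x)`.
    rw [h1, hTx, ← integral_mul_left_eq_self _ a]
    refine integral_congr_ae (Eventually.of_forall fun g => ?_)
    simp only [mul_smul, inner_smul_smul_of_norm hG]
    exact (smul_comm a _ _).symm
  -- ⟨T x, x⟩ is the integral of the continuous function ⟨g • h, x⟩² ≥ 0. If it vanishes, the
  -- function vanishes everywhere, in particular at g = 1.
  · intro x hx
    have h0 := hin x x
    rw [hx, inner_zero_left] at h0
    have hcont : Continuous fun g : G => (inner ℝ (g • h) x : ℝ) * inner ℝ (g • h) x :=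
      (hgh.inner continuous_const).mul (hgh.inner continuous_const)
    have h2 := (integral_eq_zero_iff_of_nonneg (fun g => mul_self_nonneg _)
      (hcont.integrable_of_hasCompactSupport (μ := μ) (HasCompactSupport.of_compactSpace _))).1
      h0.symm
    have h3 := hcont.ae_eq_iff_eq μ continuous_zero |>.1 h2
    have h4 := congrFun h3 1
    simpa using h4

/-- By the spectral theorem all eigenspaces together have trivial orthogonal complement. If v is
orthogonal to the nonzero ones, then v minus its projection to the kernel is orthogonal to all of
them, so v lies in the kernel and is orthogonal to h. Thus h lies in the double complement of the
sum of the nonzero eigenspaces, which is its closure. -/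
theorem mem_closure_iSup_eigenspace {T : H →L[ℝ] H} (hT : IsCompactOperator T)
    (hs : (T : H →ₗ[ℝ] H).IsSymmetric) {h : H} (hh : ∀ x, T x = 0 → inner ℝ h x = (0 : ℝ)) :
    h ∈ (⨆ μ : {μ : ℝ // μ ≠ 0},
      Module.End.eigenspace (T : H →ₗ[ℝ] H) μ.1).topologicalClosure := by
  set Z : Submodule ℝ H := ⨆ μ : {μ : ℝ // μ ≠ 0}, Module.End.eigenspace (T : H →ₗ[ℝ] H) μ.1
  rw [← Submodule.orthogonal_orthogonal_eq_closure]
  intro v hv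
  have hbot := ContinuousLinearMap.orthogonalComplement_iSup_eigenspaces_eq_bot hT hs
  let K : Submodule ℝ H := LinearMap.ker (T : H →ₗ[ℝ] H)
  have hKc : IsClosed (K : Set H) := isClosed_singleton.preimage T.continuous
  have : CompleteSpace K := hKc.completeSpace_coe
  have hK0 : Module.End.eigenspace (T : H →ₗ[ℝ] H) 0 = K := Module.End.eigenspace_zero _
  have hKZ : ∀ k ∈ K, k ∈ Zᗮ := by
    intro k hk
    rw [Submodule.mem_orthogonal]
    intro z hz
    induction hz using Submodule.iSup_induction' with
    | mem μ z hz =>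
      have := hs.orthogonalFamily_eigenspaces μ.2 (⟨z, hz⟩ : Module.End.eigenspace _ _)
        (⟨k, hK0 ▸ hk⟩ : Module.End.eigenspace _ _)
      exact this
    | zero => simp
    | add x y _ _ hx hy => rw [inner_add_left, hx, hy, add_zero]
  have hv' : v - K.starProjection v = 0 := by
    rw [← Submodule.mem_bot ℝ, ← hbot, Submodule.mem_orthogonal]
    intro z hz
    induction hz using Submodule.iSup_induction' with
    | mem μ z hz =>
      by_cases hμ : μ = 0
      · subst hμ
        rw [hK0] at hz
        rw [real_inner_comm]
        exact K.starProjection_inner_eq_zero v z hz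
      · have hzZ : z ∈ Z := Submodule.mem_iSup_of_mem (⟨μ, hμ⟩ : {μ : ℝ // μ ≠ 0}) hz
        rw [inner_sub_right, (Submodule.mem_orthogonal _ _).1 hv z hzZ,
          (Submodule.mem_orthogonal _ _).1 (hKZ _ (K.starProjection_apply_mem v)) z hzZ, sub_zero]
    | zero => simp
    | add x y _ _ hx hy => rw [inner_add_left, hx, hy, add_zero]
  rw [real_inner_comm]
  refine hh v ?_
  rw [sub_eq_zero.1 hv']
  exact K.starProjection_apply_mem v

/-- Vectors with finite dimensional orbit span are dense. -/
theorem exists_finGSubspace_near (hG : ∀ (g : G) (h : H), ‖g • h‖ = ‖h‖) (h : H) {ε : ℝ}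
    (hε : 0 < ε) : ∃ V : FinGSubspace G H, ∃ v ∈ V.space, ‖h - v‖ < ε := by
  obtain ⟨T, hT, hs, hTG, hh⟩ := exists_equivariant_compact_operator hG h
  obtain ⟨z, hz, hhz⟩ := Metric.mem_closure_iff.1 (mem_closure_iSup_eigenspace hT hs hh) ε hε
  obtain ⟨s, hs'⟩ := Submodule.mem_iSup_iff_exists_finset.1 hz
  let V : {μ : ℝ // μ ≠ 0} → FinGSubspace G H := fun μ =>
    { space := Module.End.eigenspace (T : H →ₗ[ℝ] H) μ.1
      finite := ContinuousLinearMap.finite_dimensional_eigenspace hT μ.1 μ.2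
      smul_mem := fun g v hv => by
        rw [Module.End.mem_eigenspace_iff] at hv ⊢
        change T (g • v) = _
        have hv' : T v = μ.1 • v := hv
        rw [hTG, hv', smul_comm] }
  obtain ⟨W, -, hW⟩ := exists_finGSubspace_ge s V (Classical.arbitrary _)
  exact ⟨W, z, iSup₂_le (fun μ hμ => hW μ hμ) hs', by rwa [← dist_eq_norm]⟩

theorem exists_finGSubspace_approx (hG : ∀ (g : G) (h : H), ‖g • h‖ = ‖h‖) {K : Set H}
    (hK : IsCompact K) {ε : ℝ} (hε : 0 < ε) (V₀ : FinGSubspace G H) :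
    ∃ V : FinGSubspace G H, V₀.space ≤ V.space ∧
      ∀ h ∈ K, ‖h - V.space.starProjection h‖ ≤ ε := by
  obtain ⟨s, -, hs, hKs⟩ := hK.finite_cover_balls (half_pos hε)
  choose V v hv hvh using fun h : H => exists_finGSubspace_near hG h (half_pos hε)
  obtain ⟨W, h0, hW⟩ := exists_finGSubspace_ge hs.toFinset V V₀
  refine ⟨W, h0, fun h hh => ?_⟩
  obtain ⟨i, hi, hih⟩ := mem_iUnion₂.1 (hKs hh)
  refine (norm_sub_starProjection_le h (hW i (hs.mem_toFinset.2 hi) (hv i))).trans ?_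
  calc ‖h - v i‖ ≤ ‖h - i‖ + ‖i - v i‖ := norm_sub_le_norm_sub_add_norm_sub _ _ _
    _ ≤ ε / 2 + ε / 2 := add_le_add (by rw [← dist_eq_norm]; exact (Metric.mem_ball.1 hih).le)
        (hvh i).le
    _ = ε := add_halves ε

end PeterWeyl

/-! ### Operators which are surjective modulo a subspace -/

section Operators

variable {X H : Type*} [NormedAddCommGroup X] [InnerProductSpace ℝ X] [CompleteSpace X]
  [NormedAddCommGroup H] [InnerProductSpace ℝ H] [CompleteSpace H]

/-- The adjoint of `T` is bounded below by `δ` on `Vᗮ`. -/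
def AdjointBoundedBelow (T : X →L[ℝ] H) (V : Submodule ℝ H) (δ : ℝ) : Prop :=
  ∀ h ∈ Vᗮ, δ * ‖h‖ ≤ ‖T.adjoint h‖

theorem AdjointBoundedBelow.mono {T : X →L[ℝ] H} {V W : Submodule ℝ H} {δ ε : ℝ}
    (h : AdjointBoundedBelow T V δ) (hVW : V ≤ W) (hε : ε ≤ δ) : AdjointBoundedBelow T W ε :=
  fun x hx => (mul_le_mul_of_nonneg_right hε (norm_nonneg x)).trans
    (h x (Submodule.orthogonal_le hVW hx))

/-- The composition of `T` with the projection to `Vᗮ`. -/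
def modulo (T : X →L[ℝ] H) (V : Submodule ℝ H) [V.HasOrthogonalProjection] : X →L[ℝ] H :=
  T - V.starProjection ∘L T

section

variable {T : X →L[ℝ] H} {V : Submodule ℝ H} [V.HasOrthogonalProjection] {δ : ℝ}

theorem modulo_apply (x : X) : modulo T V x = T x - V.starProjection (T x) := rfl

theorem norm_sub_starProjection_le_self (h : H) : ‖h - V.starProjection h‖ ≤ ‖h‖ := by
  simpa using norm_sub_starProjection_le h V.zero_mem

theorem modulo_eq_zero_iff {x : X} : modulo T V x = 0 ↔ x ∈ V.comap T.toLinearMap := by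
  rw [modulo_apply, sub_eq_zero, eq_comm, Submodule.starProjection_eq_self_iff]
  rfl

theorem inner_modulo_of_mem {h : H} (hh : h ∈ Vᗮ) (x : X) :
    inner ℝ h (modulo T V x) = (inner ℝ h (T x) : ℝ) := by
  rw [modulo_apply, inner_sub_right, (Submodule.mem_orthogonal' _ _).1 hh _
    (V.starProjection_apply_mem _), sub_zero]

theorem adjoint_modulo (h : H) :
    (modulo T V).adjoint h = T.adjoint (h - V.starProjection h) := by
  refine ext_inner_right ℝ fun x => ?_
  rw [ContinuousLinearMap.adjoint_inner_left, ContinuousLinearMap.adjoint_inner_left, modulo_apply,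
    inner_sub_right, inner_sub_left, V.inner_starProjection_left_eq_right]

/-- With S = (1 - P_V)T, the complement of ker S is the closure of the range of S*, so it suffices
to consider u = T*k with k ∈ Vᗮ. There |u|² = ⟨k, Su⟩ ≤ |k||Su|, and δ|k| ≤ |u|. -/
theorem AdjointBoundedBelow.le_norm_modulo (h : AdjointBoundedBelow T V δ) (hδ : 0 < δ) {u : X}
    (hu : u ∈ (V.comap T.toLinearMap)ᗮ) : δ * ‖u‖ ≤ ‖modulo T V u‖ := by
  have hker : V.comap T.toLinearMap = (modulo T V).ker := by
    ext x
    exact modulo_eq_zero_iff.symm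
  rw [hker, ContinuousLinearMap.orthogonal_ker] at hu
  have hcl : IsClosed {u : X | δ * ‖u‖ ≤ ‖modulo T V u‖} :=
    isClosed_le (by fun_prop) (by fun_prop)
  refine closure_minimal ?_ hcl hu
  rintro _ ⟨k, rfl⟩
  set k' := k - V.starProjection k
  have hk : k' ∈ Vᗮ := V.sub_starProjection_mem_orthogonal k
  have he : (modulo T V).adjoint k = T.adjoint k' := adjoint_modulo k
  change δ * ‖(modulo T V).adjoint k‖ ≤ ‖modulo T V ((modulo T V).adjoint k)‖
  rw [he]
  set u := T.adjoint k'
  have h1 : ‖u‖ * ‖u‖ ≤ ‖k'‖ * ‖modulo T V u‖ := by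
    rw [← real_inner_self_eq_norm_mul_norm]
    calc inner ℝ u u = (inner ℝ k' (modulo T V u) : ℝ) := by
          rw [inner_modulo_of_mem hk]
          exact ContinuousLinearMap.adjoint_inner_left _ _ _
      _ ≤ _ := real_inner_le_norm _ _
  have h2 := h k' hk
  change δ * ‖k'‖ ≤ ‖u‖ at h2
  rcases (norm_nonneg u).eq_or_lt with h0 | h0
  · rw [← h0]
    simp
  · refine le_of_mul_le_mul_right ?_ h0
    nlinarith [norm_nonneg (modulo T V u)]

theorem AdjointBoundedBelow.norm_sub_starProjection_le (h : AdjointBoundedBelow T V δ) (hδ : 0 < δ)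
    [(V.comap T.toLinearMap).HasOrthogonalProjection] (x : X) :
    δ * ‖x - (V.comap T.toLinearMap).starProjection x‖ ≤ ‖modulo T V x‖ := by
  have h1 := h.le_norm_modulo hδ ((V.comap T.toLinearMap).sub_starProjection_mem_orthogonal x)
  rwa [map_sub, modulo_eq_zero_iff.2 ((V.comap T.toLinearMap).starProjection_apply_mem x),
    sub_zero] at h1

/-- (1 - P_V)T is bounded below on the complement of its kernel, so its range is closed and equals
the complement of the kernel of its adjoint. The bound on the adjoint puts that kernel inside V, so
the range contains Vᗮ. -/
theorem AdjointBoundedBelow.range_sup_eq_top (h : AdjointBoundedBelow T V δ) (hδ : 0 < δ) :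
    LinearMap.range T.toLinearMap ⊔ V = ⊤ := by
  set S := modulo T V
  have hker : V.comap T.toLinearMap = S.ker := by
    ext x
    exact modulo_eq_zero_iff.symm
  have hcl : IsClosed (S.ker : Set X) := isClosed_singleton.preimage S.continuous
  have hcK : CompleteSpace S.ker := hcl.completeSpace_coe
  let S' : (S.kerᗮ : Submodule ℝ X) →L[ℝ] H := S ∘L (S.kerᗮ).subtypeL
  have hS' : IsClosed (range S') := by
    refine AntilipschitzWith.isClosed_range (K := (Real.toNNReal δ)⁻¹)
      (AddMonoidHomClass.antilipschitz_of_bound S' fun u => ?_) S'.uniformContinuous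
    have := h.le_norm_modulo hδ (u := u) (by rw [hker]; exact u.2)
    rw [NNReal.coe_inv, Real.coe_toNNReal _ hδ.le, inv_mul_eq_div, le_div_iff₀ hδ, mul_comm]
    exact this
  have hr : range S' = (S.range : Set H) := by
    ext y
    constructor
    · rintro ⟨x, rfl⟩
      exact ⟨x, rfl⟩
    · rintro ⟨x, rfl⟩
      refine ⟨⟨x - S.ker.starProjection x, S.ker.sub_starProjection_mem_orthogonal x⟩, ?_⟩
      change S (x - S.ker.starProjection x) = S x
      rw [map_sub, show S (S.ker.starProjection x) = 0 from S.ker.starProjection_apply_mem x,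
        sub_zero]
  rw [hr] at hS'
  have hcR : CompleteSpace S.range := hS'.completeSpace_coe
  have hV : Vᗮ ≤ S.range := by
    rw [← S.range.orthogonal_orthogonal, ContinuousLinearMap.orthogonal_range]
    refine Submodule.orthogonal_le fun k hk => ?_
    have h1 : T.adjoint (k - V.starProjection k) = 0 := by
      rw [← adjoint_modulo]
      exact hk
    have h2 := h _ (V.sub_starProjection_mem_orthogonal k)
    rw [h1, norm_zero] at h2
    have h3 : ‖k - V.starProjection k‖ = 0 :=
      le_antisymm (nonpos_of_mul_nonpos_right h2 hδ) (norm_nonneg _)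
    rw [sub_eq_zero.1 (norm_eq_zero.1 h3)]
    exact V.starProjection_apply_mem k
  refine eq_top_iff.2 fun k _ => ?_
  obtain ⟨x, hx⟩ := hV (V.sub_starProjection_mem_orthogonal k)
  have hx' : T x - V.starProjection (T x) = k - V.starProjection k := hx
  have : k = T x + (V.starProjection k - V.starProjection (T x)) := by
    rw [← sub_eq_zero] at hx' ⊢
    rw [← neg_eq_zero, ← hx']
    abel
  rw [this]
  exact Submodule.add_mem_sup ⟨x, rfl⟩
    (V.sub_mem (V.starProjection_apply_mem _) (V.starProjection_apply_mem _))

/-- Vectors of Vᗮ only see the perturbation modulo V, so `T' - T` need not be small in norm. This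
makes the lemma applicable to compact perturbations once V is large. -/
theorem AdjointBoundedBelow.of_modulo_sub_le (h : AdjointBoundedBelow T V δ) {T' : X →L[ℝ] H}
    {η : ℝ} (hη0 : 0 ≤ η) (hη : ∀ x, ‖modulo (T' - T) V x‖ ≤ η * ‖x‖) : AdjointBoundedBelow T' V (δ - η) := by
  intro k hk
  set z := (T' - T).adjoint k with hz
  have h1 : ‖z‖ ≤ η * ‖k‖ := by
    have h2 : ‖z‖ * ‖z‖ ≤ ‖k‖ * (η * ‖z‖) := by
      rw [← real_inner_self_eq_norm_mul_norm]
      calc inner ℝ z z = (inner ℝ k (modulo (T' - T) V z) : ℝ) := by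
            rw [inner_modulo_of_mem hk]
            exact ContinuousLinearMap.adjoint_inner_left _ _ _
        _ ≤ ‖k‖ * ‖modulo (T' - T) V z‖ := real_inner_le_norm _ _
        _ ≤ _ := mul_le_mul_of_nonneg_left (hη z) (norm_nonneg k)
    rcases (norm_nonneg z).eq_or_lt with h0 | h0
    · rw [← h0]
      positivity
    · nlinarith
  have h2 : T'.adjoint k = T.adjoint k + z := by simp [hz]
  have h3 := h k hk
  have h4 : ‖T.adjoint k‖ ≤ ‖T'.adjoint k‖ + ‖z‖ := by
    rw [h2]
    simpa using norm_sub_le (T.adjoint k + z) z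
  linarith

theorem norm_modulo_apply_le (T : X →L[ℝ] H) (x : X) : ‖modulo T V x‖ ≤ ‖T‖ * ‖x‖ :=
  (norm_sub_starProjection_le_self _).trans (T.le_opNorm x)

theorem AdjointBoundedBelow.of_norm_sub_le (h : AdjointBoundedBelow T V δ) {T' : X →L[ℝ] H}
    {η : ℝ} (hη : ‖T' - T‖ ≤ η) : AdjointBoundedBelow T' V (δ - η) :=
  h.of_modulo_sub_le ((norm_nonneg _).trans hη) fun x =>
    (norm_modulo_apply_le _ x).trans (mul_le_mul_of_nonneg_right hη (norm_nonneg x))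

/-- The map (x, v) ↦ T x + v from X × V is onto, so the open mapping theorem gives preimages of norm
at most C|k|. Pairing k ∈ Vᗮ with such a preimage of itself gives the bound C⁻¹. -/
theorem exists_adjointBoundedBelow (hV : IsClosed (V : Set H))
    (h : LinearMap.range T.toLinearMap ⊔ V = ⊤) : ∃ δ > 0, AdjointBoundedBelow T V δ := by
  have : CompleteSpace V := hV.completeSpace_coe
  let Φ : X × V →L[ℝ] H := T.coprod V.subtypeL
  have hΦ : Function.Surjective Φ := by
    intro k
    have hk : k ∈ LinearMap.range T.toLinearMap ⊔ V := h ▸ Submodule.mem_top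
    obtain ⟨_, ⟨x, rfl⟩, v, hv, rfl⟩ := Submodule.mem_sup.1 hk
    exact ⟨(x, ⟨v, hv⟩), rfl⟩
  obtain ⟨C, hC, hC'⟩ := Φ.exists_preimage_norm_le hΦ
  refine ⟨C⁻¹, inv_pos.2 hC, fun k hk => ?_⟩
  obtain ⟨⟨x, v⟩, hx, hxk⟩ := hC' k
  have hx' : ‖x‖ ≤ C * ‖k‖ := (le_max_left _ _).trans hxk
  have hxv : T x + v = k := hx
  rw [inv_mul_le_iff₀ hC]
  have h1 : ‖k‖ * ‖k‖ ≤ ‖T.adjoint k‖ * (C * ‖k‖) := by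
    rw [← real_inner_self_eq_norm_mul_norm]
    calc inner ℝ k k = (inner ℝ k (T x + v) : ℝ) := by rw [hxv]
      _ = inner ℝ (T.adjoint k) x := by
          rw [inner_add_right, (Submodule.mem_orthogonal' _ _).1 hk _ v.2, add_zero,
            ContinuousLinearMap.adjoint_inner_left]
      _ ≤ ‖T.adjoint k‖ * ‖x‖ := real_inner_le_norm _ _
      _ ≤ _ := mul_le_mul_of_nonneg_left hx' (norm_nonneg _)
  rcases (norm_nonneg k).eq_or_lt with h0 | h0
  · rw [← h0]
    positivity
  · nlinarith

/-- The orthogonal projection to the preimage of `V` depends continuously on the operator. -/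
theorem norm_starProjection_comap_sub_le {T' : X →L[ℝ] H} (hδ : 0 < δ)
    (h : AdjointBoundedBelow T V δ) (h' : AdjointBoundedBelow T' V δ)
    [(V.comap T.toLinearMap).HasOrthogonalProjection]
    [(V.comap T'.toLinearMap).HasOrthogonalProjection] (x : X) :
    ‖(V.comap T'.toLinearMap).starProjection x - (V.comap T.toLinearMap).starProjection x‖ ≤
      2 / δ * ‖T' - T‖ * ‖x‖ := by
  set K := V.comap T.toLinearMap
  set K' := V.comap T'.toLinearMap
  set p := K.starProjection x
  set u := x - p
  have hp : ‖p‖ ≤ ‖x‖ := K.norm_starProjection_apply_le x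
  have hu : ‖u‖ ≤ ‖x‖ := norm_sub_starProjection_le_self x
  -- Split x = p + u along K and Kᗮ. Here p is almost in K', because T p ∈ V makes the two operators
  -- differ on p, modulo V, by T' - T only.
  have h1 : δ * ‖p - K'.starProjection p‖ ≤ ‖T' - T‖ * ‖p‖ := by
    refine (h'.norm_sub_starProjection_le hδ p).trans ?_
    have : modulo T' V p = modulo (T' - T) V p := by
      have h0 : modulo T V p = 0 := modulo_eq_zero_iff.2 (K.starProjection_apply_mem x)
      rw [← sub_zero (modulo T' V p), ← h0]
      simp only [modulo_apply, _root_.sub_apply, map_sub]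
      abel
    rw [this]
    exact norm_modulo_apply_le _ p
  -- Conversely, the projection w of u to K' is almost in K, while u is orthogonal to K; so |w|² =
  -- ⟨w, u⟩ is bounded by the distance of w from K.
  have h2 : δ * ‖K'.starProjection u‖ ≤ ‖T' - T‖ * ‖u‖ := by
    set w := K'.starProjection u
    have hw : w ∈ K' := K'.starProjection_apply_mem u
    have hw1 : δ * ‖w - K.starProjection w‖ ≤ ‖T' - T‖ * ‖w‖ := by
      refine (h.norm_sub_starProjection_le hδ w).trans ?_
      have : modulo T V w = -modulo (T' - T) V w := by
        have h0 : modulo T' V w = 0 := modulo_eq_zero_iff.2 hw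
        rw [← sub_zero (modulo T V w), ← h0]
        simp only [modulo_apply, _root_.sub_apply, map_sub]
        abel
      rw [this, norm_neg]
      exact norm_modulo_apply_le _ w
    have hw2 : ‖w‖ * ‖w‖ ≤ ‖w - K.starProjection w‖ * ‖u‖ := by
      rw [← real_inner_self_eq_norm_mul_norm]
      have hu0 : inner ℝ (K.starProjection w) u = (0 : ℝ) :=
        (Submodule.mem_orthogonal _ _).1 (K.sub_starProjection_mem_orthogonal x) _
          (K.starProjection_apply_mem w)
      calc (inner ℝ w w : ℝ) = inner ℝ w u := by
            have := (Submodule.mem_orthogonal _ _).1 (K'.sub_starProjection_mem_orthogonal u) w hw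
            rw [inner_sub_right] at this
            linarith
        _ = inner ℝ (w - K.starProjection w) u := by rw [inner_sub_left, hu0, sub_zero]
        _ ≤ _ := real_inner_le_norm _ _
    rcases (norm_nonneg w).eq_or_lt with h0 | h0
    · rw [← h0]
      simp only [mul_zero]
      positivity
    · refine le_of_mul_le_mul_right ?_ h0
      calc δ * ‖w‖ * ‖w‖ = δ * (‖w‖ * ‖w‖) := by ring
        _ ≤ δ * (‖w - K.starProjection w‖ * ‖u‖) := mul_le_mul_of_nonneg_left hw2 hδ.le
        _ = δ * ‖w - K.starProjection w‖ * ‖u‖ := by ring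
        _ ≤ ‖T' - T‖ * ‖w‖ * ‖u‖ := mul_le_mul_of_nonneg_right hw1 (norm_nonneg u)
        _ = _ := by ring
  have h3 : K'.starProjection x - p = K'.starProjection u - (p - K'.starProjection p) := by
    have : x = p + u := by simp [u]
    conv_lhs => rw [this, map_add]
    abel
  rw [h3]
  have h4 := norm_sub_le (K'.starProjection u) (p - K'.starProjection p)
  have h5 : ‖T' - T‖ * ‖p‖ ≤ ‖T' - T‖ * ‖x‖ := mul_le_mul_of_nonneg_left hp (norm_nonneg _)
  have h6 : ‖T' - T‖ * ‖u‖ ≤ ‖T' - T‖ * ‖x‖ := mul_le_mul_of_nonneg_left hu (norm_nonneg _)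
  refine h4.trans ?_
  rw [div_mul_eq_mul_div, div_mul_eq_mul_div, le_div_iff₀ hδ]
  nlinarith

end

/-- A Fredholm operator is surjective modulo every subspace which approximates a suitable
compact set. -/
theorem exists_isCompact_adjointBoundedBelow {T : X →L[ℝ] H} (hT : T.IsFredholm) :
    ∃ K : Set H, IsCompact K ∧ ∃ δ > 0, ∀ (V : Submodule ℝ H) [V.HasOrthogonalProjection],
      (∀ k ∈ K, ‖k - V.starProjection k‖ ≤ 1 / 2) → AdjointBoundedBelow T V δ := by
  let R : Submodule ℝ H := LinearMap.range T.toLinearMap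
  have hR : IsClosed (R : Set H) := hT.isClosed_range
  have hRc : CompleteSpace R := hR.completeSpace_coe
  have hC : FiniteDimensional ℝ (Rᗮ : Submodule ℝ H) :=
    Module.Finite.iff_fg.2 (hT.finite_coker.fg_of_disjoint R.orthogonal_disjoint.symm)
  obtain ⟨δ, hδ, hTδ⟩ := exists_adjointBoundedBelow (T := T) (V := Rᗮ)
    R.isClosed_orthogonal Submodule.sup_orthogonal_of_hasOrthogonalProjection
  -- The unit ball of the cokernel. If V approximates it up to 1/2, then the cokernel component c of
  -- any h ∈ Vᗮ satisfies |c| ≤ |h|/2. As T*c = 0, half of the lower bound on the range of T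
  -- survives.
  let K : Set H := (Rᗮ).subtypeL '' Metric.closedBall 0 1
  refine ⟨K, (isCompact_closedBall _ _).image (Rᗮ).subtypeL.continuous, δ / 2, half_pos hδ,
    fun V _ hV h hh => ?_⟩
  set c := (Rᗮ).starProjection h
  have hcR : c ∈ Rᗮ := (Rᗮ).starProjection_apply_mem h
  have hh' : h - c ∈ Rᗮᗮ := (Rᗮ).sub_starProjection_mem_orthogonal h
  have h1 : ‖c - V.starProjection c‖ ≤ 1 / 2 * ‖c‖ := by
    rcases (norm_nonneg c).eq_or_lt with h0 | h0
    · rw [norm_eq_zero.1 h0.symm]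
      simp
    · have := hV (‖c‖⁻¹ • c) ⟨⟨‖c‖⁻¹ • c, Submodule.smul_mem _ _ hcR⟩, by
        rw [mem_closedBall_zero_iff, Submodule.coe_norm, norm_smul, norm_inv, norm_norm,
          inv_mul_cancel₀ h0.ne'], rfl⟩
      rwa [map_smul, ← smul_sub, norm_smul, norm_inv, norm_norm, inv_mul_le_iff₀ h0,
        mul_comm ‖c‖] at this
  have h2 : ‖c‖ * ‖c‖ ≤ 1 / 2 * ‖c‖ * ‖h‖ := by
    rw [← real_inner_self_eq_norm_mul_norm]
    calc (inner ℝ c c : ℝ) = inner ℝ c h := by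
          have := (Submodule.mem_orthogonal _ _).1 hh' c hcR
          rw [inner_sub_right] at this
          linarith
      _ = inner ℝ (c - V.starProjection c) h := by
          rw [inner_sub_left, (Submodule.mem_orthogonal _ _).1 hh _ (V.starProjection_apply_mem c),
            sub_zero]
      _ ≤ _ := real_inner_le_norm _ _
      _ ≤ _ := mul_le_mul_of_nonneg_right h1 (norm_nonneg h)
  have h3 : ‖c‖ ≤ 1 / 2 * ‖h‖ := by
    rcases (norm_nonneg c).eq_or_lt with h0 | h0
    · rw [← h0]
      positivity
    · nlinarith
  have h4 : T.adjoint h = T.adjoint (h - c) := by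
    have : c ∈ T.adjoint.ker := by
      rw [← ContinuousLinearMap.orthogonal_range]
      exact hcR
    rw [map_sub, show T.adjoint c = 0 from this, sub_zero]
  have h5 := hTδ _ hh'
  have h6 : ‖h‖ ≤ ‖h - c‖ + ‖c‖ := by simpa using norm_add_le (h - c) c
  rw [h4]
  nlinarith

/-- The preimage is an extension of a subspace of V by a subspace of the finite dimensional kernel.
-/
theorem finiteDimensional_comap {T : X →L[ℝ] H} (hT : T.IsFredholm) (V : Submodule ℝ H)
    [FiniteDimensional ℝ V] : FiniteDimensional ℝ (V.comap T.toLinearMap) := by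
  refine Module.Finite.iff_fg.2 (Submodule.fg_of_fg_map_of_fg_inf_ker T.toLinearMap ?_ ?_)
  · have := Submodule.finiteDimensional_of_le (Submodule.map_comap_le T.toLinearMap V)
    exact Module.Finite.iff_fg.1 this
  · have := hT.finite_ker
    have := Submodule.finiteDimensional_of_le
      (inf_le_right : V.comap T.toLinearMap ⊓ LinearMap.ker T.toLinearMap ≤ _)
    exact Module.Finite.iff_fg.1 this

/-- An operator which is surjective modulo `V`, and such that the preimage of `V` has finite
dimension, is Fredholm. -/
theorem AdjointBoundedBelow.isFredholm {T : X →L[ℝ] H} {V : Submodule ℝ H}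
    [FiniteDimensional ℝ V] {δ : ℝ} (hδ : 0 < δ) (h : AdjointBoundedBelow T V δ)
    (hf : FiniteDimensional ℝ (V.comap T.toLinearMap)) : T.IsFredholm := by
  let K := V.comap T.toLinearMap
  have hK : IsClosed (Kᗮ : Set X) := K.isClosed_orthogonal
  have hKc : Kᗮ.CoFG := (Module.Finite.iff_fg.1 hf).cofg_of_isCompl K.isCompl_orthogonal
  have hb : ∀ u : Kᗮ, ‖u‖ ≤ ((Real.toNNReal δ)⁻¹ : NNReal) * ‖T.domRestrict Kᗮ u‖ := fun u => by
    rw [NNReal.coe_inv, Real.coe_toNNReal _ hδ.le, inv_mul_eq_div, le_div_iff₀ hδ, mul_comm]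
    exact (h.le_norm_modulo hδ u.2).trans (norm_sub_starProjection_le_self _)
  have hanti := AddMonoidHomClass.antilipschitz_of_bound (T.domRestrict Kᗮ) hb
  have hemb := hanti.isClosedEmbedding (T.domRestrict Kᗮ).uniformContinuous
  -- T is bounded below on Kᗮ, which has finite codimension, so its restriction there is a closed
  -- embedding; strictness and closed range then pass to T.
  have h1 : IsStrictMap T ∧ IsClosed (T.range : Set H) := by
    rw [T.isStrictMap_isClosed_range_iff_restrict Kᗮ hK]
    exact ⟨hemb.isEmbedding.isStrictMap, hemb.isClosed_range⟩
  have hle : T.ker ≤ K := fun x hx => by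
    change T x ∈ V
    rw [show T x = 0 from hx]
    exact V.zero_mem
  have hker : FiniteDimensional ℝ T.ker := Submodule.finiteDimensional_of_le hle
  refine ⟨h1.1, h1.2, hker, ?_, ?_⟩
  · exact (Module.Finite.iff_fg.1 ‹FiniteDimensional ℝ V›).cofg_of_codisjoint
      (codisjoint_iff.2 ((sup_comm _ _).trans (h.range_sup_eq_top hδ)))
  · exact Submodule.ClosedComplemented.of_finiteDimensional _

end Operators

/-! ### Hilbert bundles and the bundles `F₀(V)` -/

section HilbertBundles

variable {B : Type*} [TopologicalSpace B]
  {F : Type*} [NormedAddCommGroup F] [InnerProductSpace ℝ F]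
  {E : B → Type*} [∀ b, NormedAddCommGroup (E b)] [∀ b, InnerProductSpace ℝ (E b)]
  [TopologicalSpace (TotalSpace F E)] [FiberBundle F E] [VectorBundle ℝ F E]

/-- The fiberwise isometry given by a trivialization of a Hilbert bundle. -/
def IsHilbertBundle.equivAt (hE : IsHilbertBundle F E) (e : Trivialization F (π F E))
    [MemTrivializationAtlas e] {b : B} (hb : b ∈ e.baseSet) : E b ≃ₗᵢ[ℝ] F where
  toLinearEquiv := (e.continuousLinearEquivAt ℝ b hb).toLinearEquiv
  norm_map' v := by
    have := hE e b hb v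
    rwa [e.apply_eq_prod_continuousLinearEquivAt ℝ b hb] at this

theorem IsHilbertBundle.symmL_apply (hE : IsHilbertBundle F E) (e : Trivialization F (π F E))
    [MemTrivializationAtlas e] {b : B} (hb : b ∈ e.baseSet) (w : F) :
    e.symmL ℝ b w = (hE.equivAt e hb).symm w :=
  (congrFun (e.symm_continuousLinearEquivAt_eq (R := ℝ) hb) w).symm

theorem IsHilbertBundle.eventually_norm_eq (hE : IsHilbertBundle F E)
    (e : Trivialization F (π F E)) [MemTrivializationAtlas e] (x : TotalSpace F E)
    (hx : x.proj ∈ e.baseSet) : ‖(e x).2‖ = ‖x.2‖ := hE e x.proj hx x.2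

theorem eventually_proj_mem {e : Trivialization F (π F E)} {x : TotalSpace F E}
    (hx : x.proj ∈ e.baseSet) : ∀ᶠ y in 𝓝 x, y.proj ∈ e.baseSet :=
  (FiberBundle.continuous_proj F E).continuousAt.eventually (e.open_baseSet.mem_nhds hx)

theorem continuousAt_trivialization_snd {e : Trivialization F (π F E)} {x : TotalSpace F E}
    (hx : x.proj ∈ e.baseSet) : ContinuousAt (fun y => (e y).2) x :=
  continuousAt_snd.comp (e.continuousAt (e.mem_source.2 hx))

theorem IsHilbertBundle.continuous_norm (hE : IsHilbertBundle F E) :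
    Continuous fun x : TotalSpace F E => ‖x.2‖ := by
  refine continuous_iff_continuousAt.2 fun x => ?_
  let e := trivializationAt F E x.proj
  have hx : x.proj ∈ e.baseSet := FiberBundle.mem_baseSet_trivializationAt' x.proj
  refine ContinuousAt.congr (continuousAt_trivialization_snd hx).norm ?_
  filter_upwards [eventually_proj_mem hx] with y hy
  exact hE.eventually_norm_eq e y hy

/-- Fiberwise linear combinations of continuous maps to a vector bundle are continuous. -/
theorem continuous_mk_add_smul {Z : Type*} [TopologicalSpace Z] {p : Z → B} {v w : ∀ z, E (p z)}
    {r : Z → ℝ} (hv : Continuous fun z => TotalSpace.mk' F (p z) (v z))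
    (hw : Continuous fun z => TotalSpace.mk' F (p z) (w z)) (hr : Continuous r) :
    Continuous fun z => TotalSpace.mk' F (p z) (v z + r z • w z) := by
  refine continuous_iff_continuousAt.2 fun z => ?_
  have hv' := (FiberBundle.continuousAt_totalSpace F _).1 (hv.continuousAt (x := z))
  have hw' := (FiberBundle.continuousAt_totalSpace F _).1 (hw.continuousAt (x := z))
  rw [FiberBundle.continuousAt_totalSpace]
  refine ⟨hv'.1, ?_⟩
  refine (hv'.2.add (hr.continuousAt.smul hw'.2)).congr ?_
  have hz : p z ∈ (trivializationAt F E (p z)).baseSet :=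
    FiberBundle.mem_baseSet_trivializationAt' (p z)
  filter_upwards [hv'.1.eventually ((trivializationAt F E (p z)).open_baseSet.mem_nhds hz)] with y hy
  have hlin := (trivializationAt F E (p z)).linear ℝ hy
  exact ((hlin.map_add _ _).trans (congrArg _ (hlin.map_smul _ _))).symm

end HilbertBundles

instance comap_hasOrthogonalProjection {X H : Type*} [NormedAddCommGroup X]
    [InnerProductSpace ℝ X] [CompleteSpace X] [NormedAddCommGroup H] [InnerProductSpace ℝ H]
    (T : X →L[ℝ] H) (V : Submodule ℝ H) [FiniteDimensional ℝ V] :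
    (V.comap T.toLinearMap).HasOrthogonalProjection := by
  have h : IsClosed ((V.comap T.toLinearMap : Submodule ℝ X) : Set X) :=
    V.closed_of_finiteDimensional.preimage T.continuous
  have : CompleteSpace (V.comap T.toLinearMap : Submodule ℝ X) := h.completeSpace_coe
  infer_instance

section IndexBundles

variable {G : Type*} [Group G] [TopologicalSpace G] {B : Type*} [TopologicalSpace B]
  [MulAction G B]
  {F : Type*} [NormedAddCommGroup F] [InnerProductSpace ℝ F]
  {E : B → Type*} [∀ b, NormedAddCommGroup (E b)] [∀ b, InnerProductSpace ℝ (E b)]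
  [TopologicalSpace (TotalSpace F E)] [FiberBundle F E] [VectorBundle ℝ F E]
  {H : Type*} [NormedAddCommGroup H] [InnerProductSpace ℝ H] [DistribMulAction G H]
  {A : GAction G F E} {l : Morphism H A}

/-- A morphism in a local trivialization. -/
def Morphism.inTriv (l : Morphism H A) (e : Trivialization F (π F E)) [MemTrivializationAtlas e]
    (b : B) : F →L[ℝ] H :=
  (l.toFun b).comp (e.symmL ℝ b)

theorem Morphism.inTriv_apply (l : Morphism H A) (e : Trivialization F (π F E))
    [MemTrivializationAtlas e] {x : TotalSpace F E} (hx : x.proj ∈ e.baseSet) :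
    l.inTriv e x.proj (e x).2 = l.tot x := by
  have h := e.symmL_continuousLinearMapAt (R := ℝ) hx x.2
  rw [e.continuousLinearMapAt_apply_of_mem ℝ hx] at h
  exact congrArg (l.toFun x.proj) h

theorem Morphism.IsFredholm.continuousAt_inTriv (hl : l.IsFredholm) (e : Trivialization F (π F E))
    [MemTrivializationAtlas e] {b : B} (hb : b ∈ e.baseSet) : ContinuousAt (l.inTriv e) b :=
  (hl.continuousOn e).continuousAt (e.open_baseSet.mem_nhds hb)

theorem Morphism.IsFredholm.continuous_tot (hl : l.IsFredholm) : Continuous l.tot := by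
  refine continuous_iff_continuousAt.2 fun x => ?_
  let e := trivializationAt F E x.proj
  have hx : x.proj ∈ e.baseSet := FiberBundle.mem_baseSet_trivializationAt' x.proj
  have h1 : ContinuousAt (fun y : TotalSpace F E => l.inTriv e y.proj (e y).2) x :=
    ((hl.continuousAt_inTriv e hx).comp (FiberBundle.continuous_proj F E).continuousAt).clm_apply
      (continuousAt_trivialization_snd hx)
  refine h1.congr ?_
  filter_upwards [eventually_proj_mem hx] with y hy
  exact l.inTriv_apply e hy

/-! ### Uniform surjectivity modulo V, and the projection to F₀(V) -/

section Complete

variable [CompleteSpace F] [∀ b, CompleteSpace (E b)] [CompleteSpace H]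

/-- The trivializations are fibrewise isometric, so they preserve norms of adjoints. The same
constant δ can therefore be used in every trivialization. -/
theorem adjointBoundedBelow_inTriv_iff (hE : IsHilbertBundle F E) (e : Trivialization F (π F E))
    [MemTrivializationAtlas e] {b : B} (hb : b ∈ e.baseSet) {V : Submodule ℝ H} {δ : ℝ} :
    AdjointBoundedBelow (l.inTriv e b) V δ ↔ AdjointBoundedBelow (l.toFun b) V δ := by
  have h : ∀ h : H, ‖(l.inTriv e b).adjoint h‖ = ‖(l.toFun b).adjoint h‖ := by
    intro h
    rw [← (hE.equivAt e hb).norm_map ((l.toFun b).adjoint h)]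
    congr 1
    refine ext_inner_right ℝ fun x => ?_
    rw [ContinuousLinearMap.adjoint_inner_left, (hE.equivAt e hb).inner_map_eq_flip,
      ContinuousLinearMap.adjoint_inner_left, ← hE.symmL_apply]
    rfl
  unfold AdjointBoundedBelow
  simp only [h]

theorem eventually_adjointBoundedBelow (hE : IsHilbertBundle F E) (hl : l.IsFredholm) {b : B}
    {V : Submodule ℝ H} [V.HasOrthogonalProjection] {δ : ℝ} (hδ : 0 < δ) (h : AdjointBoundedBelow (l.toFun b) V δ) :
    ∀ᶠ b' in 𝓝 b, AdjointBoundedBelow (l.toFun b') V (δ / 2) := by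
  let e := trivializationAt F E b
  have hb : b ∈ e.baseSet := FiberBundle.mem_baseSet_trivializationAt' b
  have h1 := (hl.continuousAt_inTriv e hb).eventually (Metric.closedBall_mem_nhds _ (half_pos hδ))
  filter_upwards [h1, e.open_baseSet.mem_nhds hb] with b' hb' hb''
  rw [← adjointBoundedBelow_inTriv_iff hE e hb'']
  rw [← adjointBoundedBelow_inTriv_iff hE e hb] at h
  rw [dist_eq_norm] at hb'
  have := h.of_norm_sub_le hb'
  rwa [sub_half] at this

/-- The adjoints of `l` are uniformly bounded below on `Vᗮ`. Over a compact base, this means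
that `V` spans. -/
def SpansWith (l : Morphism H A) (V : Submodule ℝ H) (δ : ℝ) : Prop :=
  0 < δ ∧ ∀ b, AdjointBoundedBelow (l.toFun b) V δ

theorem SpansWith.mono {V W : Submodule ℝ H} {δ : ℝ} (h : SpansWith l V δ) (hVW : V ≤ W) :
    SpansWith l W δ :=
  ⟨h.1, fun b => (h.2 b).mono hVW le_rfl⟩

theorem SpansWith.spans {V : FinGSubspace G H} {δ : ℝ} (h : SpansWith l V.space δ) : Spans l V :=
  fun b => (h.2 b).range_sup_eq_top h.1

theorem Spans.spansWith [CompactSpace B] (hE : IsHilbertBundle F E) (hl : l.IsFredholm)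
    {V : FinGSubspace G H} (h : Spans l V) : ∃ δ, SpansWith l V.space δ := by
  have h1 : ∃ δ > 0, ∀ b ∈ (univ : Set B), AdjointBoundedBelow (l.toFun b) V.space δ := by
    refine isCompact_univ.induction_on
      (p := fun s => ∃ δ > 0, ∀ b ∈ s, AdjointBoundedBelow (l.toFun b) V.space δ) ?_ ?_ ?_ ?_
    · exact ⟨1, one_pos, by simp⟩
    · rintro s t hst ⟨δ, hδ, h⟩
      exact ⟨δ, hδ, fun b hb => h b (hst hb)⟩
    · rintro s t ⟨δ, hδ, h⟩ ⟨ε, hε, h'⟩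
      refine ⟨min δ ε, lt_min hδ hε, fun b hb => ?_⟩
      rcases hb with hb | hb
      · exact (h b hb).mono le_rfl (min_le_left _ _)
      · exact (h' b hb).mono le_rfl (min_le_right _ _)
    · intro b _
      obtain ⟨δ, hδ, hb⟩ := exists_adjointBoundedBelow V.space.closed_of_finiteDimensional (h b)
      exact ⟨_, mem_nhdsWithin_of_mem_nhds (eventually_adjointBoundedBelow hE hl hδ hb), δ / 2,
        half_pos hδ, fun b' hb' => hb'⟩
  obtain ⟨δ, hδ, h⟩ := h1
  exact ⟨δ, hδ, fun b => h b (mem_univ b)⟩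

theorem Spans.mono {V W : FinGSubspace G H} (h : Spans l V) (hVW : V.space ≤ W.space) :
    Spans l W :=
  fun b => eq_top_iff.2 ((h b).symm.le.trans (sup_le_sup_left hVW _))

/-- Finite dimensional invariant subspaces approximate compact subsets. -/
def HasApproximation (G H : Type*) [Group G] [NormedAddCommGroup H] [InnerProductSpace ℝ H]
    [DistribMulAction G H] : Prop :=
  ∀ K : Set H, IsCompact K → ∀ ε > 0, ∀ V₀ : FinGSubspace G H, ∃ V : FinGSubspace G H,
    V₀.space ≤ V.space ∧ ∀ h ∈ K, ‖h - V.space.starProjection h‖ ≤ ε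

/-- At each point the Fredholm property asks V only to approximate a compact set, and the resulting
bound persists nearby with half the constant. Compactness of the base leaves finitely many
subspaces, and their sum works everywhere. -/
theorem exists_spansWith [CompactSpace B] (hE : IsHilbertBundle F E) (hl : l.IsFredholm)
    (hH : HasApproximation G H) (V₀ : FinGSubspace G H) :
    ∃ (V : FinGSubspace G H) (δ : ℝ), V₀.space ≤ V.space ∧ SpansWith l V.space δ := by
  have h1 : ∃ V : FinGSubspace G H, V₀.space ≤ V.space ∧ ∃ δ > 0, ∀ b ∈ (univ : Set B),
      AdjointBoundedBelow (l.toFun b) V.space δ := by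
    refine isCompact_univ.induction_on (p := fun s => ∃ V : FinGSubspace G H,
      V₀.space ≤ V.space ∧ ∃ δ > 0, ∀ b ∈ s, AdjointBoundedBelow (l.toFun b) V.space δ) ?_ ?_ ?_ ?_
    · exact ⟨V₀, le_rfl, 1, one_pos, by simp⟩
    · rintro s t hst ⟨V, hV, δ, hδ, h⟩
      exact ⟨V, hV, δ, hδ, fun b hb => h b (hst hb)⟩
    · rintro s t ⟨V, hV, δ, hδ, h⟩ ⟨W, hW, ε, hε, h'⟩
      refine ⟨V.sup W, hV.trans (V.le_sup_left W), min δ ε, lt_min hδ hε, fun b hb => ?_⟩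
      rcases hb with hb | hb
      · exact (h b hb).mono (V.le_sup_left W) (min_le_left _ _)
      · exact (h' b hb).mono (V.le_sup_right W) (min_le_right _ _)
    · intro b _
      obtain ⟨K, hK, δ, hδ, hb⟩ := exists_isCompact_adjointBoundedBelow (hl.fredholm b)
      obtain ⟨V, hV, hVK⟩ := hH K hK (1 / 2) (by norm_num) V₀
      exact ⟨_, mem_nhdsWithin_of_mem_nhds
        (eventually_adjointBoundedBelow hE hl hδ (hb V.space hVK)), V, hV, δ / 2, half_pos hδ,
        fun b' hb' => hb'⟩
  obtain ⟨V, hV, δ, hδ, h⟩ := h1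
  exact ⟨V, δ, hV, hδ, fun b => h b (mem_univ b)⟩

/-! #### The orthogonal projection to `F₀(V)` -/

/-- The component of the orthogonal projection to `F₀(V)` in the fiber. -/
def projVec (l : Morphism H A) (V : FinGSubspace G H) (x : TotalSpace F E) : E x.proj :=
  (V.space.comap (l.toFun x.proj).toLinearMap).starProjection x.2

theorem proj_val (l : Morphism H A) (V : FinGSubspace G H) (x : TotalSpace F E) :
    (F₀.proj l V x).1 = TotalSpace.mk' F x.proj (projVec l V x) := rfl

theorem SpansWith.norm_sub_projVec_le {V : FinGSubspace G H} {δ : ℝ} (h : SpansWith l V.space δ)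
    (x : TotalSpace F E) :
    δ * ‖x.2 - projVec l V x‖ ≤ ‖l.tot x - V.space.starProjection (l.tot x)‖ :=
  (h.2 x.proj).norm_sub_starProjection_le h.1 x.2

theorem proj_of_mem {V : FinGSubspace G H} {x : TotalSpace F E} (hx : l.tot x ∈ V.space) :
    F₀.proj l V x = ⟨x, hx⟩ := by
  refine Subtype.ext ?_
  rw [proj_val]
  have : projVec l V x = x.2 := Submodule.starProjection_eq_self_iff.2 hx
  rw [this]

theorem projVec_of_mem {V : FinGSubspace G H} {x : TotalSpace F E} (hx : l.tot x ∈ V.space) :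
    projVec l V x = x.2 := Submodule.starProjection_eq_self_iff.2 hx

theorem proj_proj {V W : FinGSubspace G H} (hVW : V.space ≤ W.space) (x : TotalSpace F E) :
    F₀.proj l V (F₀.proj l W x).1 = F₀.proj l V x := by
  refine Subtype.ext (congrArg (TotalSpace.mk' F x.proj) ?_)
  have h : V.space.comap (l.toFun x.proj).toLinearMap ≤ W.space.comap (l.toFun x.proj).toLinearMap :=
    Submodule.comap_mono hVW
  exact congrArg (fun T => T x.2) (Submodule.starProjection_comp_starProjection_of_le h)

theorem equivAt_projVec (hE : IsHilbertBundle F E) (e : Trivialization F (π F E))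
    [MemTrivializationAtlas e] {x : TotalSpace F E} (hx : x.proj ∈ e.baseSet)
    (V : FinGSubspace G H) : (e (F₀.proj l V x).1).2 =
      (V.space.comap (l.inTriv e x.proj).toLinearMap).starProjection (e x).2 := by
  let K := V.space.comap (l.toFun x.proj).toLinearMap
  let f := hE.equivAt e hx
  change f (K.starProjection x.2) = _
  refine (Submodule.eq_starProjection_of_mem_of_inner_eq_zero ?_ fun w hw => ?_).symm
  · change l.toFun x.proj (e.symmL ℝ x.proj _) ∈ V.space
    rw [hE.symmL_apply e hx, f.symm_apply_apply]
    exact K.starProjection_apply_mem x.2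
  · have hw' : f.symm w ∈ K := by
      change l.toFun x.proj (f.symm w) ∈ V.space
      rw [← hE.symmL_apply e hx]
      exact hw
    change inner ℝ (f x.2 - f (K.starProjection x.2)) w = (0 : ℝ)
    rw [← map_sub, f.inner_map_eq_flip]
    exact K.starProjection_inner_eq_zero x.2 _ hw'

/-- In a trivialization the projection is the orthogonal projection to the preimage of V. By
`norm_starProjection_comap_sub_le` it is norm continuous in the base point, because δ is uniform. -/
theorem continuous_proj (hE : IsHilbertBundle F E) (hl : l.IsFredholm) {V : FinGSubspace G H}
    {δ : ℝ} (h : SpansWith l V.space δ) : Continuous (F₀.proj l V : TotalSpace F E → F₀ l V) := by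
  refine Continuous.subtype_mk ?_ _
  refine continuous_iff_continuousAt.2 fun x => ?_
  rw [FiberBundle.continuousAt_totalSpace]
  refine ⟨(FiberBundle.continuous_proj F E).continuousAt, ?_⟩
  let e := trivializationAt F E x.proj
  have hx : x.proj ∈ e.baseSet := FiberBundle.mem_baseSet_trivializationAt' x.proj
  let Q : TotalSpace F E → F →L[ℝ] F := fun y =>
    (V.space.comap (l.inTriv e y.proj).toLinearMap).starProjection
  have hev := eventually_proj_mem hx
  have hT : ContinuousAt (fun y : TotalSpace F E => l.inTriv e y.proj) x :=
    (hl.continuousAt_inTriv e hx).comp (FiberBundle.continuous_proj F E).continuousAt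
  have hQ : ContinuousAt Q x := by
    rw [ContinuousAt, tendsto_iff_norm_sub_tendsto_zero]
    have h0 : Tendsto (fun y : TotalSpace F E => 2 / δ * ‖l.inTriv e y.proj - l.inTriv e x.proj‖)
        (𝓝 x) (𝓝 0) := by
      simpa using (tendsto_iff_norm_sub_tendsto_zero.1 hT.tendsto).const_mul (2 / δ)
    refine squeeze_zero' (Eventually.of_forall fun y => norm_nonneg _) ?_ h0
    filter_upwards [hev] with y hy
    have hδ := h.1
    refine ContinuousLinearMap.opNorm_le_bound _ (by positivity) fun z => ?_
    exact norm_starProjection_comap_sub_le h.1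
      ((adjointBoundedBelow_inTriv_iff hE e hx).2 (h.2 _))
      ((adjointBoundedBelow_inTriv_iff hE e hy).2 (h.2 _)) z
  refine (hQ.clm_apply (continuousAt_trivialization_snd hx)).congr ?_
  filter_upwards [hev] with y hy
  exact (equivAt_projVec hE e hy V).symm

/-- Disk bundles in `F₀(V)` are compact. -/
theorem isCompact_disk [CompactSpace B] (hE : IsHilbertBundle F E) (hl : l.IsFredholm)
    {V : FinGSubspace G H} {δ : ℝ} (h : SpansWith l V.space δ) (R : ℝ) :
    IsCompact {x : F₀ l V | ‖x.1.2‖ ≤ R} := by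
  rw [isCompact_iff_ultrafilter_le_nhds']
  intro 𝓤 hR
  have hproj : Continuous fun x : F₀ l V => x.1.proj :=
    (FiberBundle.continuous_proj F E).comp continuous_subtype_val
  obtain ⟨b, -, hb⟩ := isCompact_iff_ultrafilter_le_nhds'.1 (isCompact_univ (X := B))
    (𝓤.map fun x => x.1.proj) univ_mem
  have hb' : Tendsto (fun x : F₀ l V => x.1.proj) 𝓤 (𝓝 b) := hb
  let e := trivializationAt F E b
  have heb : b ∈ e.baseSet := FiberBundle.mem_baseSet_trivializationAt' b
  have hev : ∀ᶠ x : F₀ l V in 𝓤, x.1.proj ∈ e.baseSet :=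
    hb'.eventually (e.open_baseSet.mem_nhds heb)
  let T := l.inTriv e b
  have hbb := (adjointBoundedBelow_inTriv_iff hE e heb).2 (h.2 b)
  let K := V.space.comap T.toLinearMap
  have hK : FiniteDimensional ℝ K := by
    have := finiteDimensional_comap (hl.fredholm b) V.space
    let f := (hE.equivAt e heb).symm.toLinearEquiv.toLinearMap
    have hf : ∀ x ∈ K, f x ∈ V.space.comap (l.toFun b).toLinearMap := fun x hx => by
      change l.toFun b ((hE.equivAt e heb).symm x) ∈ V.space
      rw [← hE.symmL_apply e heb]
      exact hx
    exact Module.Finite.of_injective (f.restrict hf) fun x y hxy =>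
      Subtype.ext ((hE.equivAt e heb).symm.injective (congrArg Subtype.val hxy))
  have hnorm : ∀ᶠ x : F₀ l V in 𝓤, ‖(e x.1).2‖ ≤ R := by
    filter_upwards [hev, hR] with x hx hxR
    rw [hE.eventually_norm_eq e x.1 hx]
    exact hxR
  let k : F₀ l V → K := fun x => K.orthogonalProjectionOnto (e x.1).2
  have hk : ∀ᶠ x in 𝓤, k x ∈ Metric.closedBall (0 : K) R := by
    filter_upwards [hnorm] with x hx
    rw [mem_closedBall_zero_iff]
    exact (K.norm_orthogonalProjectionOnto_apply_le _).trans hx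
  -- K is the fibre of F₀(V) over the limit b of the base points. Projections of the points to the
  -- finite dimensional K stay in a compact ball, so they converge along the ultrafilter.
  obtain ⟨k₀, -, hk₀⟩ := isCompact_iff_ultrafilter_le_nhds'.1
    (isCompact_closedBall (0 : K) R) (𝓤.map k) hk
  have hk₀' : Tendsto (fun x : F₀ l V => K.starProjection (e x.1).2) 𝓤 (𝓝 (k₀ : F)) :=
    (continuous_subtype_val.tendsto k₀).comp (show Tendsto k 𝓤 (𝓝 k₀) from hk₀)
  -- The points approach K: they are mapped to V by the operator over their own base point, which
  -- differs little from T, and their norms are bounded by R.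
  have hdiff : Tendsto (fun x : F₀ l V => (e x.1).2 - K.starProjection (e x.1).2) 𝓤 (𝓝 0) := by
    have hT : Tendsto (fun x : F₀ l V => l.inTriv e x.1.proj) 𝓤 (𝓝 T) :=
      (hl.continuousAt_inTriv e heb).tendsto.comp hb'
    have h0 : Tendsto (fun x : F₀ l V => δ⁻¹ * (‖l.inTriv e x.1.proj - T‖ * R)) 𝓤 (𝓝 0) := by
      simpa using ((tendsto_iff_norm_sub_tendsto_zero.1 hT).mul_const R).const_mul δ⁻¹
    refine squeeze_zero_norm' ?_ h0
    filter_upwards [hev, hnorm] with x hx hxR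
    rw [← div_eq_inv_mul, le_div_iff₀ h.1, mul_comm]
    refine (hbb.norm_sub_starProjection_le h.1 _).trans ?_
    have h1 : modulo (l.inTriv e x.1.proj) V.space (e x.1).2 = 0 := by
      rw [modulo_eq_zero_iff]
      change l.inTriv e x.1.proj (e x.1).2 ∈ V.space
      rw [l.inTriv_apply e hx]
      exact x.2
    have h2 : modulo T V.space (e x.1).2 =
        -modulo (l.inTriv e x.1.proj - T) V.space (e x.1).2 := by
      rw [← sub_zero (modulo T V.space (e x.1).2), ← h1]
      simp only [modulo_apply, _root_.sub_apply, map_sub]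
      abel
    rw [h2, norm_neg]
    exact (norm_modulo_apply_le _ _).trans (mul_le_mul_of_nonneg_left hxR (norm_nonneg _))
  have hlim : Tendsto (fun x : F₀ l V => (e x.1).2) 𝓤 (𝓝 (k₀ : F)) := by
    simpa using hdiff.add hk₀'
  let x₀ : TotalSpace F E := TotalSpace.mk' F b ((hE.equivAt e heb).symm k₀)
  have hx₀ : (e x₀).2 = k₀ := (hE.equivAt e heb).apply_symm_apply k₀
  have htend : Tendsto (fun x : F₀ l V => x.1) 𝓤 (𝓝 x₀) := by
    rw [e.tendsto_nhds_iff (e.mem_source.2 heb), hx₀]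
    exact ⟨hb', hlim⟩
  have hmem : l.tot x₀ ∈ V.space :=
    V.space.closed_of_finiteDimensional.mem_of_tendsto ((hl.continuous_tot.tendsto x₀).comp htend)
      (Eventually.of_forall fun x => x.2)
  refine ⟨⟨x₀, hmem⟩, ?_, ?_⟩
  · exact le_of_tendsto ((hE.continuous_norm.tendsto x₀).comp htend) hR
  · exact tendsto_subtype_rng.2 htend

end Complete

/-! #### Equivariance -/

theorem starProjection_smul [SMulCommClass G ℝ H] (hG : ∀ (g : G) (h : H), ‖g • h‖ = ‖h‖)
    (V : FinGSubspace G H) (g : G) (h : H) :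
    V.space.starProjection (g • h) = g • V.space.starProjection h := by
  refine Submodule.eq_starProjection_of_mem_of_inner_eq_zero
    (V.smul_mem g _ (V.space.starProjection_apply_mem h)) fun w hw => ?_
  rw [← smul_sub, ← smul_inv_smul g w, inner_smul_smul_of_norm hG]
  exact V.space.starProjection_inner_eq_zero h _ (V.smul_mem g⁻¹ w hw)

/-- The candidate preimage, obtained from g⁻¹, lies over g⁻¹ • g • b and not literally over b. So it
is found in the total space and only then moved to the fibre over b. -/
theorem GAction.act_surjective (A : GAction G F E) (g : G) (b : B) :
    Function.Surjective (A.act g b) := by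
  intro w
  obtain ⟨x, hx⟩ : ∃ x : TotalSpace F E, A.tot g x = TotalSpace.mk' F (g • b) w := by
    refine ⟨A.tot g⁻¹ (TotalSpace.mk' F (g • b) w), ?_⟩
    have h1 := A.mul_act g g⁻¹ (TotalSpace.mk' F (g • b) w)
    rw [mul_inv_cancel] at h1
    exact h1.symm.trans (A.one_act _)
  obtain ⟨b', v⟩ := x
  have hb : g • b' = g • b := congrArg TotalSpace.proj hx
  obtain rfl : b' = b := smul_left_cancel g hb
  exact ⟨v, eq_of_heq (TotalSpace.mk.inj hx).2⟩

theorem Morphism.tot_tot (l : Morphism H A) (g : G) (x : TotalSpace F E) :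
    l.tot (A.tot g x) = g • l.tot x := l.equivariant g x.proj x.2

theorem projVec_tot [∀ b, CompleteSpace (E b)] (V : FinGSubspace G H) (g : G)
    (x : TotalSpace F E) : projVec l V (A.tot g x) = A.act g x.proj (projVec l V x) := by
  let K := V.space.comap (l.toFun x.proj).toLinearMap
  refine Submodule.eq_starProjection_of_mem_of_inner_eq_zero ?_ fun w hw => ?_
  · change l.toFun (g • x.proj) (A.act g x.proj _) ∈ V.space
    rw [l.equivariant]
    exact V.smul_mem g _ (K.starProjection_apply_mem x.2)
  · obtain ⟨v, rfl⟩ := A.act_surjective g x.proj w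
    have hv : v ∈ K := by
      change l.toFun (g • x.proj) (A.act g x.proj v) ∈ V.space at hw
      rw [l.equivariant] at hw
      have := V.smul_mem g⁻¹ _ hw
      rwa [inv_smul_smul] at this
    change inner ℝ (A.act g x.proj x.2 - A.act g x.proj (projVec l V x)) _ = (0 : ℝ)
    rw [← map_sub, LinearIsometry.inner_map_map]
    exact K.starProjection_inner_eq_zero x.2 v hv

theorem proj_tot [∀ b, CompleteSpace (E b)] (V : FinGSubspace G H) (g : G)
    (x : TotalSpace F E) : F₀.proj l V (A.tot g x) = F₀.act l V g (F₀.proj l V x) :=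
  Subtype.ext (congrArg (TotalSpace.mk' F (g • x.proj)) (projVec_tot V g x))

end IndexBundles

/-! ### Maps to spheres `N⁺` -/

section OnePointMaps

variable {N : Type*} [NormedAddCommGroup N] [InnerProductSpace ℝ N] [FiniteDimensional ℝ N]

theorem tendsto_nhds_infty_of_norm {α : Type*} {f : α → OnePoint N} {L : Filter α}
    (h : ∀ R : ℝ, ∀ᶠ x in L, ∀ v : N, f x = v → R < ‖v‖) :
    Tendsto f L (𝓝 OnePoint.infty) := by
  rw [OnePoint.hasBasis_nhds_infty.tendsto_right_iff]
  rintro s ⟨-, hs⟩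
  obtain ⟨R, hR⟩ := hs.isBounded.exists_norm_le
  filter_upwards [h R] with x hx
  rcases hfx : f x with _ | v
  · exact Or.inr rfl
  · refine Or.inl ⟨v, fun hv => ?_, rfl⟩
    exact absurd (hx v hfx) (not_lt.2 (hR v hv))

theorem isOpen_setOf_lt_norm (R : ℝ) : IsOpen {z : OnePoint N | ∀ v : N, z = v → R < ‖v‖} := by
  have h1 : IsClosed ((↑) '' Metric.closedBall (0 : N) R : Set (OnePoint N)) :=
    OnePoint.isClosed_image_coe.2 ⟨Metric.isClosed_closedBall, isCompact_closedBall _ _⟩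
  convert h1.isOpen_compl using 1
  ext z
  constructor
  · rintro h ⟨v, hv, rfl⟩
    exact absurd (h v rfl) (not_lt.2 (mem_closedBall_zero_iff.1 hv))
  · rintro h v rfl
    by_contra! hv
    exact h ⟨v, mem_closedBall_zero_iff.2 hv, rfl⟩

/-- A family of pointed maps from the one-point compactification of a space with compact disks
is continuous if it is continuous at the finite points and points outside of large disks have
large images. -/
theorem continuous_family {T X : Type*} [TopologicalSpace T] [TopologicalSpace X] {ρ : X → ℝ}
    (hρ : Continuous ρ) (hc : ∀ R, IsCompact {x | ρ x ≤ R}) {g : T × OnePoint X → OnePoint N}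
    (h0 : ∀ t, g (t, OnePoint.infty) = OnePoint.infty)
    (h1 : Continuous fun p : T × X => g (p.1, p.2))
    (h2 : ∀ t₀ R, ∃ r, ∀ᶠ t in 𝓝 t₀, ∀ x : X, r < ρ x → ∀ v : N, g (t, x) = v → R < ‖v‖) :
    Continuous g := by
  refine continuous_iff_continuousAt.2 ?_
  rintro ⟨t, x⟩
  induction x using OnePoint.rec with
  | infty =>
    rw [ContinuousAt, h0]
    refine tendsto_nhds_infty_of_norm fun R => ?_
    obtain ⟨r, hr⟩ := h2 t R
    have hU : {z : OnePoint X | ∀ x : X, z = x → r < ρ x} ∈ 𝓝 (OnePoint.infty : OnePoint X) := by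
      refine OnePoint.hasBasis_nhds_infty.mem_iff.2
        ⟨{x | ρ x ≤ r}, ⟨isClosed_le hρ continuous_const, hc r⟩, ?_⟩
      rintro _ (⟨x, hx, rfl⟩ | rfl) y hy
      · rw [OnePoint.coe_injective hy] at hx
        exact not_le.1 hx
      · exact absurd hy (OnePoint.infty_ne_coe y)
    rw [nhds_prod_eq]
    filter_upwards [hr.prod_mk hU]
    rintro ⟨t', z⟩ ⟨ht, hz⟩ v hv
    induction z using OnePoint.rec with
    | infty =>
      rw [h0] at hv
      exact absurd hv (OnePoint.infty_ne_coe v)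
    | coe x => exact ht x (hz x rfl) v hv
  | coe x =>
    have he : IsOpenEmbedding (Prod.map id (↑) : T × X → T × OnePoint X) :=
      IsOpenEmbedding.id.prodMap OnePoint.isOpenEmbedding_coe
    exact (he.continuousAt_iff (x := (t, x))).1 h1.continuousAt

/-- A converse to `continuous_family`: by the tube lemma one neighbourhood of infinity works for all
parameters in the compact space T. Its complement is compact, so ρ is bounded there. -/
theorem exists_radius {T X : Type*} [TopologicalSpace T] [CompactSpace T] [TopologicalSpace X]
    {ρ : X → ℝ} (hρ : Continuous ρ) {g : T × OnePoint X → OnePoint N} (hg : Continuous g)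
    (h0 : ∀ t, g (t, OnePoint.infty) = OnePoint.infty) (R : ℝ) :
    ∃ r, ∀ t (x : X), r < ρ x → ∀ v : N, g (t, x) = v → R < ‖v‖ := by
  have hU := (isOpen_setOf_lt_norm (N := N) R).preimage hg
  obtain ⟨U, V, -, hV, hTU, hV', hUV⟩ := generalized_tube_lemma (isCompact_univ (X := T))
    (isCompact_singleton (x := (OnePoint.infty : OnePoint X))) hU (by
      rintro ⟨t, z⟩ ⟨-, rfl⟩ v hv
      change g (t, OnePoint.infty) = v at hv
      rw [h0] at hv
      exact absurd hv (OnePoint.infty_ne_coe v))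
  obtain ⟨s, ⟨-, hs⟩, hsV⟩ := OnePoint.hasBasis_nhds_infty.mem_iff.1
    (hV.mem_nhds (hV' rfl : OnePoint.infty ∈ V))
  obtain ⟨r, hr⟩ := (hs.image hρ).bddAbove
  refine ⟨r, fun t x hx v hv => ?_⟩
  refine hUV (mk_mem_prod (hTU (mem_univ t)) (hsV (Or.inl ⟨x, fun hxs => ?_, rfl⟩))) v hv
  exact absurd (hr ⟨x, hxs, rfl⟩) (not_le.2 hx)

/-! #### Stereographic projection -/

/-- The norm of the Hilbert sum `ℝ ⊕ N`. -/
def dirNorm (p : ℝ × N) : ℝ := √(p.1 ^ 2 + ‖p.2‖ ^ 2)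

/-- The point of `N⁺` which corresponds under stereographic projection to the direction of a
nonzero vector of `ℝ ⊕ N`. -/
def dirPoint (p : ℝ × N) : OnePoint N :=
  open scoped Classical in
  if p.2 = 0 ∧ 0 ≤ p.1 then OnePoint.infty else (((dirNorm p - p.1)⁻¹ • p.2 : N) : OnePoint N)

/-- A vector of `ℝ ⊕ N` whose direction corresponds to the given point of `N⁺`. -/
def dirVec (z : OnePoint N) : ℝ × N := z.elim (1, 0) fun v => (‖v‖ ^ 2 - 1, (2 : ℝ) • v)

theorem dirNorm_sq (p : ℝ × N) : dirNorm p ^ 2 = p.1 ^ 2 + ‖p.2‖ ^ 2 :=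
  Real.sq_sqrt (by positivity)

theorem dirNorm_nonneg (p : ℝ × N) : 0 ≤ dirNorm p := Real.sqrt_nonneg _

theorem dirNorm_pos {p : ℝ × N} (hp : p ≠ 0) : 0 < dirNorm p := by
  refine Real.sqrt_pos.2 ?_
  by_contra! h
  refine hp (Prod.ext ?_ ?_)
  · have : p.1 ^ 2 = 0 := le_antisymm (by nlinarith [sq_nonneg ‖p.2‖]) (sq_nonneg _)
    exact pow_eq_zero_iff two_ne_zero |>.1 this
  · have : ‖p.2‖ ^ 2 = 0 := le_antisymm (by nlinarith [sq_nonneg p.1]) (sq_nonneg _)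
    exact norm_eq_zero.1 (pow_eq_zero_iff two_ne_zero |>.1 this)

theorem le_dirNorm (p : ℝ × N) : p.1 ≤ dirNorm p :=
  (le_abs_self _).trans (Real.abs_le_sqrt (by nlinarith [sq_nonneg ‖p.2‖]))

theorem dirNorm_sub_pos {p : ℝ × N} (hp : ¬ (p.2 = 0 ∧ 0 ≤ p.1)) : 0 < dirNorm p - p.1 := by
  rw [sub_pos]
  refine lt_of_le_of_ne (le_dirNorm p) fun h => hp ?_
  have h1 := dirNorm_sq p
  rw [← h] at h1
  have h2 : ‖p.2‖ ^ 2 = 0 := by linarith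
  exact ⟨norm_eq_zero.1 (pow_eq_zero_iff two_ne_zero |>.1 h2), h ▸ dirNorm_nonneg p⟩

theorem dirPoint_of_infty {p : ℝ × N} (h : p.2 = 0 ∧ 0 ≤ p.1) : dirPoint p = OnePoint.infty :=
  if_pos h

theorem dirPoint_of_finite {p : ℝ × N} (h : ¬ (p.2 = 0 ∧ 0 ≤ p.1)) :
    dirPoint p = (((dirNorm p - p.1)⁻¹ • p.2 : N) : OnePoint N) :=
  if_neg h

theorem dirPoint_dirVec (z : OnePoint N) : dirPoint (dirVec z) = z := by
  induction z using OnePoint.rec with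
  | infty => exact dirPoint_of_infty ⟨rfl, zero_le_one⟩
  | coe v =>
    change dirPoint (‖v‖ ^ 2 - 1, (2 : ℝ) • v) = v
    rw [dirPoint_of_finite]
    · have h1 : dirNorm (‖v‖ ^ 2 - 1, (2 : ℝ) • v) = ‖v‖ ^ 2 + 1 := by
        rw [dirNorm, Real.sqrt_eq_iff_mul_self_eq (by positivity) (by positivity)]
        simp only [norm_smul, Real.norm_ofNat]
        ring
      rw [h1]
      have h2 : ‖v‖ ^ 2 + 1 - (‖v‖ ^ 2 - 1) = 2 := by ring
      rw [h2, smul_smul]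
      norm_num
    · rintro ⟨h1, h2⟩
      change (2 : ℝ) • v = 0 at h1
      rw [smul_eq_zero_iff_right two_ne_zero] at h1
      subst h1
      norm_num at h2

theorem dirVec_dirPoint {p : ℝ × N} (hp : p ≠ 0) : ∃ c : ℝ, c > 0 ∧ dirVec (dirPoint p) = c • p := by
  by_cases h : p.2 = 0 ∧ 0 ≤ p.1
  · have h1 : 0 < p.1 := lt_of_le_of_ne h.2 fun h0 => hp (Prod.ext h0.symm h.1)
    refine ⟨p.1⁻¹, inv_pos.2 h1, ?_⟩
    rw [dirPoint_of_infty h]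
    refine Prod.ext ?_ ?_
    · exact (inv_mul_cancel₀ h1.ne').symm
    · change (0 : N) = _ • p.2
      rw [h.1, smul_zero]
  · have h1 := dirNorm_sub_pos h
    have h2 := dirNorm_sq p
    refine ⟨2 * (dirNorm p - p.1)⁻¹, by positivity, ?_⟩
    rw [dirPoint_of_finite h]
    refine Prod.ext ?_ ?_
    · change ‖(dirNorm p - p.1)⁻¹ • p.2‖ ^ 2 - 1 = 2 * (dirNorm p - p.1)⁻¹ * p.1
      rw [norm_smul, mul_pow, norm_inv, Real.norm_eq_abs, abs_of_pos h1]
      field_simp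
      nlinarith
    · change (2 : ℝ) • (dirNorm p - p.1)⁻¹ • p.2 = _
      rw [smul_smul]
      rfl

theorem dirPoint_smul {p : ℝ × N} {c : ℝ} (hc : 0 < c) : dirPoint (c • p) = dirPoint p := by
  have hn : dirNorm (c • p) = c * dirNorm p := by
    rw [dirNorm, Real.sqrt_eq_iff_mul_self_eq (by positivity)
      (mul_nonneg hc.le (dirNorm_nonneg p))]
    have := dirNorm_sq p
    simp only [Prod.smul_fst, Prod.smul_snd, norm_smul, Real.norm_eq_abs, abs_of_pos hc,
      smul_eq_mul]
    linear_combination -c ^ 2 * this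
  by_cases h : p.2 = 0 ∧ 0 ≤ p.1
  · rw [dirPoint_of_infty h, dirPoint_of_infty]
    refine ⟨?_, mul_nonneg hc.le h.2⟩
    change c • p.2 = 0
    rw [h.1, smul_zero]
  · rw [dirPoint_of_finite h, dirPoint_of_finite, hn]
    · congr 1
      change (c * dirNorm p - c * p.1)⁻¹ • c • p.2 = _
      rw [← mul_sub, mul_inv, smul_smul, mul_right_comm, inv_mul_cancel₀ hc.ne', one_mul]
    · rintro ⟨h1, h2⟩
      refine h ⟨(smul_eq_zero_iff_right hc.ne').1 h1, ?_⟩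
      exact (mul_nonneg_iff_of_pos_left hc).1 h2

/-- With n the norm of p, the stereographic image has norm |p.2|/(n - p.1) = (n + p.1)/|p.2|. So a
dominating positive real component means closeness to infinity, which is how all properness
conditions below are verified. -/
theorem le_norm_of_dirPoint_eq {p : ℝ × N} {M : ℝ} (hs : 0 ≤ p.1)
    (h : M * ‖p.2‖ ≤ p.1) {v : N} (hv : dirPoint p = v) : M ≤ ‖v‖ := by
  by_cases h0 : p.2 = 0 ∧ 0 ≤ p.1
  · rw [dirPoint_of_infty h0] at hv
    exact absurd hv (OnePoint.infty_ne_coe v)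
  · rw [dirPoint_of_finite h0] at hv
    rw [← OnePoint.coe_injective hv]
    have h1 := dirNorm_sub_pos h0
    rw [norm_smul, norm_inv, Real.norm_eq_abs, abs_of_pos h1, ← div_eq_inv_mul, le_div_iff₀ h1]
    have h2 := dirNorm_sq p
    have h3 : 0 < ‖p.2‖ := norm_pos_iff.2 fun h3 => h0 ⟨h3, hs⟩
    refine le_of_mul_le_mul_right ?_ h3
    have h4 : M * ‖p.2‖ ≤ dirNorm p + p.1 := by linarith [dirNorm_nonneg p]
    calc M * (dirNorm p - p.1) * ‖p.2‖ = M * ‖p.2‖ * (dirNorm p - p.1) := by ring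
      _ ≤ (dirNorm p + p.1) * (dirNorm p - p.1) := mul_le_mul_of_nonneg_right h4 h1.le
      _ = ‖p.2‖ * ‖p.2‖ := by linear_combination h2

theorem continuous_dirNorm : Continuous (dirNorm : ℝ × N → ℝ) := by
  unfold dirNorm
  fun_prop

theorem continuousAt_dirPoint {p : ℝ × N} (hp : p ≠ 0) : ContinuousAt dirPoint p := by
  by_cases h : p.2 = 0 ∧ 0 ≤ p.1
  · have h1 : 0 < p.1 := lt_of_le_of_ne h.2 fun h0 => hp (Prod.ext h0.symm h.1)
    rw [ContinuousAt, dirPoint_of_infty h]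
    refine tendsto_nhds_infty_of_norm fun R => ?_
    have h2 : ContinuousAt (fun q : ℝ × N => (|R| + 1) * ‖q.2‖ - q.1) p := by fun_prop
    have h3 : (|R| + 1) * ‖p.2‖ - p.1 < 0 := by
      rw [h.1, norm_zero]
      linarith
    filter_upwards [h2.eventually (gt_mem_nhds h3),
      continuousAt_fst.eventually (lt_mem_nhds h1)] with q hq hq' v hv
    have := le_norm_of_dirPoint_eq hq'.le (sub_neg.1 hq).le hv
    linarith [le_abs_self R]
  · have ho : IsOpen {q : ℝ × N | ¬ (q.2 = 0 ∧ 0 ≤ q.1)} :=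
      ((isClosed_eq continuous_snd continuous_const).inter
        (isClosed_le continuous_const continuous_fst)).isOpen_compl
    have h1 : ContinuousAt (fun q : ℝ × N =>
        (((dirNorm q - q.1)⁻¹ • q.2 : N) : OnePoint N)) p := by
      refine OnePoint.continuous_coe.continuousAt.comp ?_
      exact ((continuous_dirNorm.sub continuous_fst).continuousAt.inv₀
        (dirNorm_sub_pos h).ne').smul continuousAt_snd
    refine h1.congr ?_
    filter_upwards [ho.mem_nhds h] with q hq
    exact (dirPoint_of_finite hq).symm

theorem dirVec_ne_zero (z : OnePoint N) : dirVec z ≠ 0 := by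
  induction z using OnePoint.rec with
  | infty => exact fun h => one_ne_zero (congrArg Prod.fst h)
  | coe v =>
    intro h
    have h1 : (2 : ℝ) • v = 0 := congrArg Prod.snd h
    have h2 : ‖v‖ ^ 2 - 1 = 0 := congrArg Prod.fst h
    rw [smul_eq_zero_iff_right two_ne_zero] at h1
    subst h1
    norm_num at h2

/-- The normalized direction corresponding to a point of `N⁺`. -/
def unitDir (z : OnePoint N) : ℝ × N := (dirNorm (dirVec z))⁻¹ • dirVec z

theorem dirNorm_dirVec_coe (v : N) : dirNorm (dirVec (v : OnePoint N)) = ‖v‖ ^ 2 + 1 := by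
  change dirNorm (‖v‖ ^ 2 - 1, (2 : ℝ) • v) = ‖v‖ ^ 2 + 1
  rw [dirNorm, Real.sqrt_eq_iff_mul_self_eq (by positivity) (by positivity)]
  simp only [norm_smul, Real.norm_ofNat]
  ring

theorem continuous_unitDir : Continuous (unitDir : OnePoint N → ℝ × N) := by
  have hc : ∀ v : N, unitDir (v : OnePoint N) =
      ((‖v‖ ^ 2 - 1) / (‖v‖ ^ 2 + 1), (2 / (‖v‖ ^ 2 + 1)) • v) := by
    intro v
    rw [unitDir, dirNorm_dirVec_coe]
    refine Prod.ext ?_ ?_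
    · exact (div_eq_inv_mul _ _).symm
    · change (‖v‖ ^ 2 + 1)⁻¹ • (2 : ℝ) • v = _
      rw [smul_smul, ← div_eq_inv_mul]
  have hi : unitDir (OnePoint.infty : OnePoint N) = (1, 0) := by
    have : dirNorm (dirVec (OnePoint.infty : OnePoint N)) = 1 := by
      change dirNorm ((1 : ℝ), (0 : N)) = 1
      simp [dirNorm]
    rw [unitDir, this, inv_one, one_smul]
    rfl
  rw [OnePoint.continuous_iff]
  constructor
  · rw [hi, coclosedCompact_eq_cocompact]
    have hn : Tendsto (fun v : N => ‖v‖) (cocompact N) atTop := tendsto_norm_cocompact_atTop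
    have h1 : Tendsto (fun v : N => (‖v‖ ^ 2 + 1)⁻¹) (cocompact N) (𝓝 0) :=
      (tendsto_atTop_add_const_right _ _
        ((tendsto_pow_atTop two_ne_zero).comp hn)).inv_tendsto_atTop
    simp only [hc]
    refine Tendsto.prodMk_nhds ?_ ?_
    · have h2 : Tendsto (fun v : N => 1 - 2 * (‖v‖ ^ 2 + 1)⁻¹) (cocompact N) (𝓝 1) := by
        simpa using (h1.const_mul 2).const_sub 1
      refine h2.congr fun v => ?_
      field_simp
      ring
    · have h2 : Tendsto (fun v : N => 2 * ‖v‖⁻¹) (cocompact N) (𝓝 0) := by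
        simpa using hn.inv_tendsto_atTop.const_mul 2
      refine squeeze_zero_norm (fun v => ?_) h2
      rw [norm_smul, Real.norm_eq_abs, abs_of_pos (by positivity)]
      rcases (norm_nonneg v).eq_or_lt with h0 | h0
      · rw [← h0]
        simp
      · rw [div_mul_eq_mul_div, div_le_iff₀ (by positivity)]
        field_simp
        nlinarith
  · simp only [hc]
    refine Continuous.prodMk ?_ ?_
    · exact Continuous.div (by fun_prop) (by fun_prop) fun v => by positivity
    · exact Continuous.smul (Continuous.div (by fun_prop) (by fun_prop) fun v => by positivity)
        continuous_id

theorem dirPoint_unitDir (z : OnePoint N) : dirPoint (unitDir z) = z := by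
  rw [unitDir, dirPoint_smul (inv_pos.2 (dirNorm_pos (dirVec_ne_zero z))), dirPoint_dirVec]

theorem unitDir_dirPoint {p : ℝ × N} (hp : p ≠ 0) : ∃ c : ℝ, c > 0 ∧ unitDir (dirPoint p) = c • p := by
  obtain ⟨c, hc, h⟩ := dirVec_dirPoint hp
  refine ⟨(dirNorm (dirVec (dirPoint p)))⁻¹ * c,
    mul_pos (inv_pos.2 (dirNorm_pos (dirVec_ne_zero _))) hc, ?_⟩
  rw [unitDir, mul_smul, ← h]

/-- The retraction `ρ_V`, in terms of directions. -/
theorem retraction_eq {H : Type*} [NormedAddCommGroup H] [InnerProductSpace ℝ H]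
    (V : Submodule ℝ H) [FiniteDimensional ℝ V] (h : H) :
    retraction V h = dirPoint (‖h‖ ^ 2 - 1, (2 : ℝ) • V.orthogonalProjectionOnto h) := by
  set w : V := (2 : ℝ) • V.orthogonalProjectionOnto h
  set D : ℝ := ‖h‖ ^ 2 + 1
  have hD : 0 < D := by positivity
  set p : ℝ × V := (‖h‖ ^ 2 - 1, w)
  have hp : dirPoint (D⁻¹ • p) = dirPoint p := dirPoint_smul (inv_pos.2 hD)
  rw [← hp]
  set s : ℝ := (‖h‖ ^ 2 - 1) / D with hs
  set a : V := (2 / D) • V.orthogonalProjectionOnto h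
  have hpa : D⁻¹ • p = (s, a) := by
    refine Prod.ext ?_ ?_
    · exact (div_eq_inv_mul _ _).symm
    · change D⁻¹ • (2 : ℝ) • V.orthogonalProjectionOnto h = _
      rw [smul_smul, ← div_eq_inv_mul]
  rw [hpa]
  set n : ℝ := √(s ^ 2 + ‖a‖ ^ 2) with hn
  have hn' : dirNorm (s, a) = n := rfl
  have hns : n ^ 2 = s ^ 2 + ‖a‖ ^ 2 := dirNorm_sq (s, a)
  have hn0 : 0 ≤ n := Real.sqrt_nonneg _
  -- Both definitions send the zero vector to infinity, so the formulas agree even on S(Vᗮ), where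
  -- the retraction is not meaningful.
  have hcond : (s / n = 1 ∨ n = 0) ↔ ((s, a) : ℝ × V).2 = 0 ∧ 0 ≤ ((s, a) : ℝ × V).1 := by
    change _ ↔ a = 0 ∧ 0 ≤ s
    constructor
    · rintro (h1 | h1)
      · have hne : n ≠ 0 := by
          rintro h0
          rw [h0, div_zero] at h1
          exact zero_ne_one h1
        rw [div_eq_one_iff_eq hne] at h1
        have : ‖a‖ ^ 2 = 0 := by rw [← h1] at hns; linarith
        exact ⟨norm_eq_zero.1 (pow_eq_zero_iff two_ne_zero |>.1 this), h1 ▸ hn0⟩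
      · rw [h1] at hns
        have h2 : ‖a‖ ^ 2 = 0 := by nlinarith [sq_nonneg s, sq_nonneg ‖a‖]
        have h3 : s ^ 2 = 0 := by nlinarith [sq_nonneg s, sq_nonneg ‖a‖]
        exact ⟨norm_eq_zero.1 (pow_eq_zero_iff two_ne_zero |>.1 h2),
          (pow_eq_zero_iff two_ne_zero |>.1 h3).ge⟩
    · rintro ⟨h1, h2⟩
      have h3 : n = s := by rw [hn, h1, norm_zero]; simp [Real.sqrt_sq h2]
      by_cases h4 : n = 0
      · exact Or.inr h4
      · exact Or.inl (by rw [← h3, div_self h4])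
  change (open scoped Classical in
    if s / n = 1 ∨ n = 0 then OnePoint.infty else (((1 - s / n)⁻¹ • n⁻¹ • a : V) : OnePoint V)) = _
  by_cases hc : s / n = 1 ∨ n = 0
  · rw [if_pos hc, dirPoint_of_infty (hcond.1 hc)]
  · rw [if_neg hc, dirPoint_of_finite fun h => hc (hcond.2 h), hn']
    push Not at hc
    congr 1
    rw [smul_smul, ← mul_inv, sub_mul, one_mul, div_mul_cancel₀ _ hc.2]

end OnePointMaps

/-! ### Homotopies of pointed `G`-maps on Thom spaces -/

section AddPoint

variable {H : Type*} [NormedAddCommGroup H] [InnerProductSpace ℝ H]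

/-- The sum of a vector of `W` and a point of `V⁺`, for `V ⊆ W`. -/
def addPoint {V W : Submodule ℝ H} (h : V ≤ W) (u : W) (z : OnePoint V) : OnePoint W :=
  OnePoint.map (fun v => u + Submodule.inclusion h v) z

theorem addPoint_add {V W U : Submodule ℝ H} (h : V ≤ W) (h' : W ≤ U) (a : U) (b : W)
    (z : OnePoint V) : addPoint h' a (addPoint h b z) =
      addPoint (h.trans h') (a + Submodule.inclusion h' b) z := by
  induction z using OnePoint.rec with
  | infty => rfl
  | coe v =>
    change ((a + Submodule.inclusion h' (b + Submodule.inclusion h v) : U) : OnePoint U) =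
      ((a + Submodule.inclusion h' b + Submodule.inclusion (h.trans h') v : U) : OnePoint U)
    rw [map_add, add_assoc]
    rfl

/-- Joint continuity at infinity holds because u is locally bounded, and a bounded translation keeps
large vectors large. -/
theorem continuous_addPoint {V W : Submodule ℝ H} [FiniteDimensional ℝ V] [FiniteDimensional ℝ W]
    (h : V ≤ W) : Continuous fun p : W × OnePoint V => addPoint h p.1 p.2 := by
  refine continuous_family (ρ := fun v : V => ‖v‖) continuous_norm ?_ (fun _ => rfl) ?_ ?_
  · intro R
    convert isCompact_closedBall (0 : V) R using 1
    ext v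
    exact mem_closedBall_zero_iff.symm
  · have : Continuous fun v : V => Submodule.inclusion h v :=
      (Submodule.inclusion h).continuous_of_finiteDimensional
    exact OnePoint.continuous_coe.comp (continuous_fst.add (this.comp continuous_snd))
  · intro u₀ R
    refine ⟨R + (‖u₀‖ + 1), ?_⟩
    have : ∀ᶠ u in 𝓝 u₀, ‖u‖ < ‖u₀‖ + 1 :=
      continuous_norm.continuousAt.eventually (gt_mem_nhds (lt_add_one _))
    filter_upwards [this] with u hu v hv w hw
    rw [← OnePoint.coe_injective hw]
    have h1 : ‖Submodule.inclusion h v‖ ≤ ‖u + Submodule.inclusion h v‖ + ‖u‖ := by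
      simpa using norm_sub_le (u + Submodule.inclusion h v) u
    have h2 : ‖Submodule.inclusion h v‖ = ‖v‖ := rfl
    linarith

theorem norm_le_norm_add_of_inner_eq_zero {u v : H} (h : inner ℝ u v = (0 : ℝ)) :
    ‖u‖ ≤ ‖u + v‖ ∧ ‖v‖ ≤ ‖u + v‖ := by
  have h1 := norm_add_sq_eq_norm_sq_add_norm_sq_of_inner_eq_zero u v h
  constructor
  · exact abs_le_of_sq_le_sq' (by nlinarith [norm_nonneg v]) (norm_nonneg _) |>.2
  · exact abs_le_of_sq_le_sq' (by nlinarith [norm_nonneg u]) (norm_nonneg _) |>.2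

end AddPoint

section Equivariance

variable {G H : Type*} [Group G] [NormedAddCommGroup H] [InnerProductSpace ℝ H]
  [DistribMulAction G H]

theorem dirPoint_act [SMulCommClass G ℝ H] (hG : ∀ (g : G) (h : H), ‖g • h‖ = ‖h‖)
    (V : FinGSubspace G H) (g : G) (p : ℝ × V.space) :
    dirPoint (p.1, V.act g p.2) = OnePoint.map (V.act g) (dirPoint p) := by
  have hn : ‖V.act g p.2‖ = ‖p.2‖ := hG g p.2
  have hN : dirNorm (p.1, V.act g p.2) = dirNorm p := by
    unfold dirNorm
    rw [hn]
  by_cases h : p.2 = 0 ∧ 0 ≤ p.1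
  · rw [dirPoint_of_infty h, dirPoint_of_infty]
    · rfl
    · refine ⟨norm_eq_zero.1 ?_, h.2⟩
      change ‖V.act g p.2‖ = 0
      rw [hn, h.1, norm_zero]
  · rw [dirPoint_of_finite h, dirPoint_of_finite, hN]
    · change _ = ((V.act g _ : V.space) : OnePoint V.space)
      congr 1
      exact Subtype.ext (smul_comm g ((dirNorm p - p.1)⁻¹) (p.2 : H)).symm
    · rintro ⟨h1, h2⟩
      refine h ⟨norm_eq_zero.1 ?_, h2⟩
      rw [← hn]
      exact norm_eq_zero.2 h1

theorem unitDir_map [SMulCommClass G ℝ H] (hG : ∀ (g : G) (h : H), ‖g • h‖ = ‖h‖)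
    (V : FinGSubspace G H) (g : G) (z : OnePoint V.space) :
    unitDir (OnePoint.map (V.act g) z) = ((unitDir z).1, V.act g (unitDir z).2) := by
  have hlin : ∀ (c : ℝ) (v : V.space), V.act g (c • v) = c • V.act g v := fun c v =>
    Subtype.ext (smul_comm g c (v : H))
  have h0 : V.act g 0 = 0 := Subtype.ext (smul_zero g)
  have hn : ∀ v : V.space, ‖V.act g v‖ = ‖v‖ := fun v => hG g v
  have hv : dirVec (OnePoint.map (V.act g) z) = ((dirVec z).1, V.act g (dirVec z).2) := by
    induction z using OnePoint.rec with
    | infty =>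
      change ((1 : ℝ), (0 : V.space)) = (1, V.act g 0)
      rw [h0]
    | coe v =>
      change (‖V.act g v‖ ^ 2 - 1, (2 : ℝ) • V.act g v) = (‖v‖ ^ 2 - 1, V.act g ((2 : ℝ) • v))
      rw [hn, hlin]
  have hN : dirNorm (dirVec (OnePoint.map (V.act g) z)) = dirNorm (dirVec z) := by
    rw [hv]
    unfold dirNorm
    rw [hn]
  rw [unitDir, hN, hv]
  exact Prod.ext rfl (hlin _ _).symm

end Equivariance

section Homotopies

variable {G : Type*} [Group G] [TopologicalSpace G] {B : Type*} [MulAction G B]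
  {F : Type*} {E : B → Type*} [∀ b, NormedAddCommGroup (E b)] [∀ b, InnerProductSpace ℝ (E b)]
  [TopologicalSpace (TotalSpace F E)]
  {H : Type*} [NormedAddCommGroup H] [InnerProductSpace ℝ H] [DistribMulAction G H]
  {A : GAction G F E} {l : Morphism H A} {V : FinGSubspace G H}
  {α β γ : OnePoint (F₀ l V) → OnePoint V.space}

theorem GHomotopic.left (h : GHomotopic l V α β) : IsPointedGMap l V α := by
  obtain ⟨k, -, hk, h0, -⟩ := h
  rw [← funext h0]
  exact hk 0

theorem GHomotopic.right (h : GHomotopic l V α β) : IsPointedGMap l V β := by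
  obtain ⟨k, -, hk, -, h1⟩ := h
  rw [← funext h1]
  exact hk 1

theorem GHomotopic.refl (h : IsPointedGMap l V α) : GHomotopic l V α α :=
  ⟨fun p => α p.2, h.continuous.comp continuous_snd, fun _ => h, fun _ => rfl, fun _ => rfl⟩

theorem gHomotopic_iff (hα : Continuous α) (hβ : Continuous β) : GHomotopic l V α β ↔
    ContinuousMap.HomotopicWith ⟨α, hα⟩ ⟨β, hβ⟩ fun f => IsPointedGMap l V f := by
  constructor
  · rintro ⟨k, hk, hk', h0, h1⟩
    exact ⟨⟨⟨⟨k, hk⟩, h0, h1⟩, hk'⟩⟩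
  · rintro ⟨K⟩
    exact ⟨K, K.continuous, fun t => K.prop t, K.apply_zero, K.apply_one⟩

theorem GHomotopic.symm (h : GHomotopic l V α β) : GHomotopic l V β α :=
  (gHomotopic_iff h.right.continuous h.left.continuous).2
    ((gHomotopic_iff h.left.continuous h.right.continuous).1 h).symm

theorem GHomotopic.trans (h : GHomotopic l V α β) (h' : GHomotopic l V β γ) :
    GHomotopic l V α γ :=
  (gHomotopic_iff h.left.continuous h'.right.continuous).2
    (((gHomotopic_iff h.left.continuous h.right.continuous).1 h).trans
      ((gHomotopic_iff h.right.continuous h'.right.continuous).1 h'))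

/-- Pointed `G`-maps which are nowhere antipodal are homotopic. -/
theorem GHomotopic.of_not_antipodal [SMulCommClass G ℝ H]
    (hG : ∀ (g : G) (h : H), ‖g • h‖ = ‖h‖) (hα : IsPointedGMap l V α) (hβ : IsPointedGMap l V β)
    (h : ∀ x : F₀ l V, ∃ p q : ℝ × V.space, p ≠ 0 ∧ q ≠ 0 ∧ α x = dirPoint p ∧ β x = dirPoint q ∧
      ∀ a b : ℝ, 0 < a → 0 < b → a • p + b • q ≠ 0) : GHomotopic l V α β := by
  -- The chord between normalized directions, which depend continuously on the points. The given p
  -- and q are positive multiples of these unit vectors, so the hypothesis keeps the chord away from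
  -- zero.
  let K : unitInterval × OnePoint (F₀ l V) → ℝ × V.space := fun p =>
    (1 - (p.1 : ℝ)) • unitDir (α p.2) + (p.1 : ℝ) • unitDir (β p.2)
  have hu : ∀ z : OnePoint V.space, unitDir z ≠ 0 := fun z =>
    smul_ne_zero (inv_ne_zero (dirNorm_pos (dirVec_ne_zero z)).ne') (dirVec_ne_zero z)
  have hself : ∀ (t : unitInterval) (z : ℝ × V.space), (1 - (t : ℝ)) • z + (t : ℝ) • z = z :=
    fun t z => by rw [← add_smul, sub_add_cancel, one_smul]
  have hK0 : ∀ p, K p ≠ 0 := by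
    rintro ⟨t, x⟩
    induction x using OnePoint.rec with
    | infty =>
      change (1 - (t : ℝ)) • unitDir (α _) + (t : ℝ) • unitDir (β _) ≠ 0
      rw [hα.map_infty, hβ.map_infty, hself]
      exact hu _
    | coe x =>
      obtain ⟨p, q, hp, hq, hαx, hβx, hpq⟩ := h x
      change (1 - (t : ℝ)) • unitDir (α x) + (t : ℝ) • unitDir (β x) ≠ 0
      rcases t.2.1.eq_or_lt with h0 | h0
      · rw [← h0, sub_zero, one_smul, zero_smul, add_zero]
        exact hu _
      rcases t.2.2.eq_or_lt with h1 | h1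
      · rw [h1, sub_self, one_smul, zero_smul, zero_add]
        exact hu _
      rw [hαx, hβx]
      obtain ⟨a, ha, ha'⟩ := unitDir_dirPoint hp
      obtain ⟨b, hb, hb'⟩ := unitDir_dirPoint hq
      rw [ha', hb', smul_smul, smul_smul]
      exact hpq _ _ (mul_pos (sub_pos.2 h1) ha) (mul_pos h0 hb)
  have hKc : Continuous K := by
    have h1 := (continuous_unitDir.comp hα.continuous).comp
      (continuous_snd (X := unitInterval) (Y := OnePoint (F₀ l V)))
    have h2 := (continuous_unitDir.comp hβ.continuous).comp
      (continuous_snd (X := unitInterval) (Y := OnePoint (F₀ l V)))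
    have h3 : Continuous fun p : unitInterval × OnePoint (F₀ l V) => (p.1 : ℝ) :=
      continuous_subtype_val.comp continuous_fst
    exact ((continuous_const.sub h3).smul h1).add (h3.smul h2)
  have hc : Continuous fun p => dirPoint (K p) :=
    continuous_iff_continuousAt.2 fun p =>
      ContinuousAt.comp (f := K) (continuousAt_dirPoint (hK0 p)) hKc.continuousAt
  refine ⟨fun p => dirPoint (K p), hc, fun t => ⟨?_, ?_, ?_⟩, ?_, ?_⟩
  · exact hc.comp (continuous_const.prodMk continuous_id)
  · change dirPoint ((1 - (t : ℝ)) • unitDir (α _) + (t : ℝ) • unitDir (β _)) = _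
    rw [hα.map_infty, hβ.map_infty, hself, dirPoint_unitDir]
  · intro g x
    change dirPoint ((1 - (t : ℝ)) • unitDir (α _) + (t : ℝ) • unitDir (β _)) = _
    rw [hα.equivariant, hβ.equivariant, unitDir_map hG, unitDir_map hG, ← dirPoint_act hG]
    congr 1
    refine Prod.ext rfl (Subtype.ext ?_)
    change (1 - (t : ℝ)) • g • ((unitDir (α x)).2 : H) + (t : ℝ) • g • ((unitDir (β x)).2 : H) =
      g • ((1 - (t : ℝ)) • ((unitDir (α x)).2 : H) + (t : ℝ) • ((unitDir (β x)).2 : H))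
    rw [smul_add, smul_comm g, smul_comm g]
  · intro x
    change dirPoint ((1 - ((0 : unitInterval) : ℝ)) • unitDir (α x) +
      ((0 : unitInterval) : ℝ) • unitDir (β x)) = _
    rw [Set.Icc.coe_zero, sub_zero, one_smul, zero_smul, add_zero, dirPoint_unitDir]
  · intro x
    change dirPoint ((1 - ((1 : unitInterval) : ℝ)) • unitDir (α x) +
      ((1 : unitInterval) : ℝ) • unitDir (β x)) = _
    rw [Set.Icc.coe_one, sub_self, one_smul, zero_smul, zero_add, dirPoint_unitDir]

/-- The pointed map `TF₀(V) → V⁺` given by a map to `ℝ ⊕ V` without zeros. -/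
def thomMap (s : F₀ l V → ℝ) (w : F₀ l V → V.space) (z : OnePoint (F₀ l V)) : OnePoint V.space :=
  z.elim OnePoint.infty fun x => dirPoint (s x, w x)

variable [TopologicalSpace B] [NormedAddCommGroup F] [InnerProductSpace ℝ F] [FiberBundle F E]
  [VectorBundle ℝ F E]

/-- A homotopy between maps given by a family of maps to `ℝ ⊕ V` without zeros. -/
theorem gHomotopic_thomMap [SMulCommClass G ℝ H] (hG : ∀ (g : G) (h : H), ‖g • h‖ = ‖h‖)
    (hn : Continuous fun x : F₀ l V => ‖x.1.2‖)
    (hd : ∀ R : ℝ, IsCompact {x : F₀ l V | ‖x.1.2‖ ≤ R})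
    {s : unitInterval × F₀ l V → ℝ} {w : unitInterval × F₀ l V → V.space} (hs : Continuous s)
    (hw : Continuous w) (hsG : ∀ g t x, s (t, F₀.act l V g x) = s (t, x))
    (hwG : ∀ g t x, w (t, F₀.act l V g x) = V.act g (w (t, x))) (h0 : ∀ p, s p = 0 → w p ≠ 0)
    (hdom : ∀ M : ℝ, ∃ r : ℝ, ∀ t x, r < ‖x.1.2‖ → M * ‖w (t, x)‖ ≤ s (t, x) ∧ 0 ≤ s (t, x)) :
    GHomotopic l V (thomMap (fun x => s (0, x)) fun x => w (0, x))
      (thomMap (fun x => s (1, x)) fun x => w (1, x)) := by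
  have hne : ∀ p, (s p, w p) ≠ 0 := fun p hp =>
    h0 p (congrArg Prod.fst hp) (congrArg Prod.snd hp)
  let k : unitInterval × OnePoint (F₀ l V) → OnePoint V.space := fun p =>
    thomMap (fun x => s (p.1, x)) (fun x => w (p.1, x)) p.2
  have hk : Continuous k := by
    refine continuous_family hn hd (fun _ => rfl) ?_ ?_
    · change Continuous fun p : unitInterval × F₀ l V => dirPoint (s p, w p)
      exact continuous_iff_continuousAt.2 fun p => ContinuousAt.comp (f := fun p => (s p, w p))
        (continuousAt_dirPoint (hne p)) (hs.prodMk hw).continuousAt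
    · intro t₀ R
      obtain ⟨r, hr⟩ := hdom (|R| + 1)
      refine ⟨r, Eventually.of_forall fun t x hx v hv => ?_⟩
      obtain ⟨h1, h2⟩ := hr t x hx
      have := le_norm_of_dirPoint_eq h2 h1 hv
      linarith [le_abs_self R]
  refine ⟨k, hk, fun t => ⟨hk.comp (continuous_const.prodMk continuous_id), rfl, ?_⟩,
    fun _ => rfl, fun _ => rfl⟩
  intro g x
  induction x using OnePoint.rec with
  | infty => rfl
  | coe x =>
    change dirPoint (s (t, F₀.act l V g x), w (t, F₀.act l V g x)) =
      OnePoint.map (V.act g) (dirPoint (s (t, x), w (t, x)))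
    rw [hsG, hwG, ← dirPoint_act hG]

variable [∀ b, CompleteSpace (E b)] {W : FinGSubspace G H}

/-- The suspension of a map `α : TF₀(V) → V⁺` by a map `u` on `F₀(W)`. -/
def suspendWith (h : V.space ≤ W.space) (u : F₀ l W → W.space)
    (α : OnePoint (F₀ l V) → OnePoint V.space) (z : OnePoint (F₀ l W)) : OnePoint W.space :=
  z.elim OnePoint.infty fun x => addPoint h (u x) (α (F₀.proj l V x.1 : F₀ l V))

/-- The component of `l` in the complement of `V` in `W`. -/
def suspensionVec (l : Morphism H A) (h : V.space ≤ W.space) (x : F₀ l W) : W.space :=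
  ⟨l.tot x.1 - V.space.starProjection (l.tot x.1),
    W.space.sub_mem x.2 (h (V.space.starProjection_apply_mem _))⟩

theorem suspend_eq (h : V.space ≤ W.space) (α : OnePoint (F₀ l V) → OnePoint V.space) :
    suspend l h α = suspendWith h (suspensionVec l h) α := rfl

theorem addPoint_act (h : V.space ≤ W.space) (g : G) (u : W.space) (z : OnePoint V.space) :
    addPoint h (W.act g u) (OnePoint.map (V.act g) z) = OnePoint.map (W.act g) (addPoint h u z) := by
  induction z using OnePoint.rec with
  | infty => rfl
  | coe v => exact congrArg _ (Subtype.ext (smul_add g (u : H) (v : H)).symm)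

/-- The suspension coordinate and the map may be deformed at the same time, as long as `hprop`
holds: bounded u and bounded projection to F₀(V) force bounded x. Since u is orthogonal to V, a
bounded sum u + v bounds both summands, which gives continuity at infinity. -/
theorem gHomotopic_suspendWith (h : V.space ≤ W.space)
    (hn : Continuous fun x : F₀ l W => ‖x.1.2‖)
    (hd : ∀ R : ℝ, IsCompact {x : F₀ l W | ‖x.1.2‖ ≤ R})
    (hnV : Continuous fun x : F₀ l V => ‖x.1.2‖)
    (hq : Continuous (F₀.proj l V : TotalSpace F E → F₀ l V))
    {u : unitInterval × F₀ l W → W.space} (hu : Continuous u)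
    (huG : ∀ g t x, u (t, F₀.act l W g x) = W.act g (u (t, x)))
    (hperp : ∀ p, (u p : H) ∈ V.spaceᗮ)
    (hprop : ∀ R : ℝ, ∃ r : ℝ, ∀ t x, ‖u (t, x)‖ ≤ R → ‖projVec l V x.1‖ ≤ R → ‖x.1.2‖ ≤ r)
    {k : unitInterval × OnePoint (F₀ l V) → OnePoint V.space} (hk : Continuous k)
    (hk' : ∀ t, IsPointedGMap l V fun x => k (t, x)) :
    GHomotopic l W (suspendWith h (fun x => u (0, x)) fun x => k (0, x))
      (suspendWith h (fun x => u (1, x)) fun x => k (1, x)) := by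
  let K : unitInterval × OnePoint (F₀ l W) → OnePoint W.space := fun p =>
    suspendWith h (fun x => u (p.1, x)) (fun x => k (p.1, x)) p.2
  have hK : Continuous K := by
    refine continuous_family hn hd (fun _ => rfl) ?_ ?_
    · change Continuous fun p : unitInterval × F₀ l W =>
        addPoint h (u p) (k (p.1, (F₀.proj l V p.2.1 : F₀ l V)))
      refine (continuous_addPoint h).comp (hu.prodMk (hk.comp (continuous_fst.prodMk ?_)))
      exact OnePoint.continuous_coe.comp (hq.comp (continuous_subtype_val.comp continuous_snd))
    · intro t₀ R
      obtain ⟨r₁, hr₁⟩ := exists_radius hnV hk (fun t => (hk' t).map_infty) R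
      obtain ⟨r, hr⟩ := hprop (max R r₁)
      refine ⟨r, Eventually.of_forall fun t x hx v hv => ?_⟩
      by_contra! hvR
      refine absurd hx (not_lt.2 (hr t x ?_ ?_))
      all_goals
        change addPoint h (u (t, x)) (k (t, (F₀.proj l V x.1 : F₀ l V))) = v at hv
        rcases hz : k (t, (F₀.proj l V x.1 : F₀ l V)) with _ | z
        · rw [hz] at hv
          exact absurd hv (OnePoint.infty_ne_coe v)
        · rw [hz] at hv
          have hv' : u (t, x) + Submodule.inclusion h z = v := OnePoint.coe_injective hv
          have h1 := norm_le_norm_add_of_inner_eq_zero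
            ((Submodule.mem_orthogonal' _ _).1 (hperp (t, x)) z z.2)
          have h2 : ‖(u (t, x) : H) + z‖ ≤ R := by
            rw [← hv'] at hvR
            exact hvR
          -- The first alternative bounds u. In the second, a projection longer than r₁ would make
          -- the value of k longer than R.
          first
          | exact (h1.1.trans h2).trans (le_max_left _ _)
          | refine le_trans ?_ (le_max_right _ _)
            by_contra! hlt
            exact absurd (hr₁ t (F₀.proj l V x.1) hlt z hz) (not_lt.2 (h1.2.trans h2))
  refine ⟨K, hK, fun t => ⟨hK.comp (continuous_const.prodMk continuous_id), rfl, ?_⟩,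
    fun _ => rfl, fun _ => rfl⟩
  intro g x
  induction x using OnePoint.rec with
  | infty => rfl
  | coe x =>
    change addPoint h (u (t, F₀.act l W g x)) (k (t, (F₀.proj l V (A.tot g x.1) : F₀ l V))) =
      OnePoint.map (W.act g) (addPoint h (u (t, x)) (k (t, (F₀.proj l V x.1 : F₀ l V))))
    have := (hk' t).equivariant g (F₀.proj l V x.1 : F₀ l V)
    rw [huG, proj_tot, ← addPoint_act, ← this]
    rfl

end Homotopies

section CompactBase

variable {G : Type*} [Group G] [TopologicalSpace G] {B : Type*} [TopologicalSpace B]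
  [CompactSpace B] [MulAction G B]
  {F : Type*} [NormedAddCommGroup F] [InnerProductSpace ℝ F] [CompleteSpace F]
  {E : B → Type*} [∀ b, NormedAddCommGroup (E b)] [∀ b, InnerProductSpace ℝ (E b)]
  [∀ b, CompleteSpace (E b)]
  [TopologicalSpace (TotalSpace F E)] [FiberBundle F E] [VectorBundle ℝ F E]
  {H : Type*} [NormedAddCommGroup H] [InnerProductSpace ℝ H] [CompleteSpace H]
  [DistribMulAction G H] [SMulCommClass G ℝ H]
  {A : GAction G F E} {l : Morphism H A} {V W U : FinGSubspace G H}

/-! ### Suspensions -/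

theorem exists_norm_tot_le (hE : IsHilbertBundle F E) (hl : l.IsFredholm) :
    ∃ C, 0 ≤ C ∧ ∀ x, ‖l.tot x‖ ≤ C * ‖x.2‖ := by
  have h1 : ∃ C, 0 ≤ C ∧ ∀ x : TotalSpace F E, x.proj ∈ (univ : Set B) →
      ‖l.tot x‖ ≤ C * ‖x.2‖ := by
    refine isCompact_univ.induction_on (p := fun s => ∃ C, 0 ≤ C ∧ ∀ x : TotalSpace F E,
      x.proj ∈ s → ‖l.tot x‖ ≤ C * ‖x.2‖) ?_ ?_ ?_ ?_
    · exact ⟨0, le_rfl, by simp⟩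
    · rintro s t hst ⟨C, hC, h⟩
      exact ⟨C, hC, fun x hx => h x (hst hx)⟩
    · rintro s t ⟨C, hC, h⟩ ⟨D, hD, h'⟩
      refine ⟨max C D, hC.trans (le_max_left _ _), fun x hx => ?_⟩
      rcases hx with hx | hx
      · exact (h x hx).trans (mul_le_mul_of_nonneg_right (le_max_left _ _) (norm_nonneg _))
      · exact (h' x hx).trans (mul_le_mul_of_nonneg_right (le_max_right _ _) (norm_nonneg _))
    · intro b _
      let e := trivializationAt F E b
      have hb : b ∈ e.baseSet := FiberBundle.mem_baseSet_trivializationAt' b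
      have h1 : ∀ᶠ b' in 𝓝 b, ‖l.inTriv e b'‖ < ‖l.inTriv e b‖ + 1 :=
        (hl.continuousAt_inTriv e hb).norm.eventually (gt_mem_nhds (lt_add_one _))
      refine ⟨_, mem_nhdsWithin_of_mem_nhds (h1.and (e.open_baseSet.mem_nhds hb)),
        ‖l.inTriv e b‖ + 1, by positivity, fun x hx => ?_⟩
      rw [← l.inTriv_apply e hx.2, ← hE.eventually_norm_eq e x hx.2]
      exact ((l.inTriv e x.proj).le_opNorm _).trans
        (mul_le_mul_of_nonneg_right hx.1.le (norm_nonneg _))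
  obtain ⟨C, hC, h⟩ := h1
  exact ⟨C, hC, fun x => h x (mem_univ _)⟩

theorem continuous_norm_val (hE : IsHilbertBundle F E) : Continuous fun x : F₀ l V => ‖x.1.2‖ :=
  hE.continuous_norm.comp continuous_subtype_val

theorem continuous_suspensionVec (hl : l.IsFredholm) (h : V.space ≤ W.space) :
    Continuous (suspensionVec l h) := by
  refine Continuous.subtype_mk ?_ _
  have h1 : Continuous fun x : F₀ l W => l.tot x.1 := hl.continuous_tot.comp continuous_subtype_val
  exact h1.sub (V.space.starProjection.continuous.comp h1)

theorem suspensionVec_mem_orthogonal (h : V.space ≤ W.space) (x : F₀ l W) :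
    (suspensionVec l h x : H) ∈ V.spaceᗮ := V.space.sub_starProjection_mem_orthogonal _

theorem suspensionVec_act (hG : ∀ (g : G) (h : H), ‖g • h‖ = ‖h‖) (h : V.space ≤ W.space) (g : G)
    (x : F₀ l W) : suspensionVec l h (F₀.act l W g x) = W.act g (suspensionVec l h x) := by
  refine Subtype.ext ?_
  change l.tot (A.tot g x.1) - V.space.starProjection (l.tot (A.tot g x.1)) =
    g • (l.tot x.1 - V.space.starProjection (l.tot x.1))
  rw [l.tot_tot, starProjection_smul hG, smul_sub]

theorem norm_le_of_norm_suspensionVec_le {δ : ℝ} (hV : SpansWith l V.space δ)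
    (h : V.space ≤ W.space) {x : F₀ l W} {R : ℝ} (hx : ‖suspensionVec l h x‖ ≤ R) :
    ‖x.1.2 - projVec l V x.1‖ ≤ R / δ := by
  rw [le_div_iff₀ hV.1, mul_comm]
  exact (hV.norm_sub_projVec_le x.1).trans hx

theorem GHomotopic.suspend (hE : IsHilbertBundle F E) (hl : l.IsFredholm)
    (hG : ∀ (g : G) (h : H), ‖g • h‖ = ‖h‖) {δ : ℝ} (hV : SpansWith l V.space δ)
    (h : V.space ≤ W.space) {α β : OnePoint (F₀ l V) → OnePoint V.space}
    (hαβ : GHomotopic l V α β) : GHomotopic l W (suspend l h α) (suspend l h β) := by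
  obtain ⟨k, hk, hk', h0, h1⟩ := hαβ
  obtain rfl := funext h0
  obtain rfl := funext h1
  rw [suspend_eq, suspend_eq]
  refine gHomotopic_suspendWith h (continuous_norm_val hE) (isCompact_disk hE hl (hV.mono h))
    (continuous_norm_val hE) (continuous_proj hE hl hV) (u := fun p => suspensionVec l h p.2)
    ((continuous_suspensionVec hl h).comp continuous_snd)
    (fun g _ x => suspensionVec_act hG h g x)
    (fun p => suspensionVec_mem_orthogonal h p.2) (fun R => ⟨R / δ + R, fun t x h1 h2 => ?_⟩) hk hk'
  have h3 := norm_le_of_norm_suspensionVec_le hV h h1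
  have h4 : ‖x.1.2‖ ≤ ‖x.1.2 - projVec l V x.1‖ + ‖projVec l V x.1‖ := by
    simpa using norm_add_le (x.1.2 - projVec l V x.1) (projVec l V x.1)
  linarith

theorem IsPointedGMap.suspend (hE : IsHilbertBundle F E) (hl : l.IsFredholm)
    (hG : ∀ (g : G) (h : H), ‖g • h‖ = ‖h‖) {δ : ℝ} (hV : SpansWith l V.space δ)
    (h : V.space ≤ W.space) {α : OnePoint (F₀ l V) → OnePoint V.space}
    (hα : IsPointedGMap l V α) : IsPointedGMap l W (suspend l h α) :=
  (GHomotopic.suspend hE hl hG hV h (GHomotopic.refl hα)).left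

/-- The two sides differ because `l` does not intertwine the projections: z = l(proj_W x) need not
equal Q(l x). The homotopy moves z to y = l x on a line d_t and uses the coordinate (y - Qy) + (Q -
P)d_t, with P and Q the projections to V and W. -/
theorem gHomotopic_suspend_suspend (hE : IsHilbertBundle F E) (hl : l.IsFredholm)
    (hG : ∀ (g : G) (h : H), ‖g • h‖ = ‖h‖) {δ : ℝ} (hV : SpansWith l V.space δ)
    (h : V.space ≤ W.space) (h' : W.space ≤ U.space) {α : OnePoint (F₀ l V) → OnePoint V.space}
    (hα : IsPointedGMap l V α) :
    GHomotopic l U (suspend l h' (suspend l h α)) (suspend l (h.trans h') α) := by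
  obtain ⟨C, hC, hlC⟩ := exists_norm_tot_le hE hl
  let P := V.space.starProjection
  let Q := W.space.starProjection
  let y : F₀ l U → H := fun x => l.tot x.1
  let z : F₀ l U → H := fun x => l.tot (F₀.proj l W x.1).1
  let d : unitInterval × F₀ l U → H := fun p => z p.2 + (p.1 : ℝ) • (y p.2 - z p.2)
  have hQU : ∀ k, Q k ∈ U.space := fun k => h' (W.space.starProjection_apply_mem k)
  have hPU : ∀ k, P k ∈ U.space := fun k => h' (h (V.space.starProjection_apply_mem k))
  have hPQ : ∀ k, P (Q k) = P k := fun k =>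
    congrArg (fun T => T k) (Submodule.starProjection_comp_starProjection_of_le h)
  let u : unitInterval × F₀ l U → U.space := fun p =>
    ⟨(y p.2 - Q (y p.2)) + (Q (d p) - P (d p)),
      U.space.add_mem (U.space.sub_mem p.2.2 (hQU _)) (U.space.sub_mem (hQU _) (hPU _))⟩
  have hyc : Continuous y := hl.continuous_tot.comp continuous_subtype_val
  have hzc : Continuous z := hl.continuous_tot.comp (continuous_subtype_val.comp
    ((continuous_proj hE hl (hV.mono h)).comp continuous_subtype_val))
  have hdc : Continuous d := by
    have h3 : Continuous fun p : unitInterval × F₀ l U => (p.1 : ℝ) :=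
      continuous_subtype_val.comp continuous_fst
    exact (hzc.comp continuous_snd).add
      (h3.smul ((hyc.comp continuous_snd).sub (hzc.comp continuous_snd)))
  have huc : Continuous u := by
    refine Continuous.subtype_mk ?_ _
    have h1 : Continuous fun p : unitInterval × F₀ l U => y p.2 := hyc.comp continuous_snd
    exact (h1.sub (Q.continuous.comp h1)).add ((Q.continuous.comp hdc).sub (P.continuous.comp hdc))
  have hz : ∀ x, Q (z x) = z x := fun x =>
    Submodule.starProjection_eq_self_iff.2 (F₀.proj l W x.1).2
  have hQy : ∀ k, Q (k - Q k) = 0 := fun k => by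
    rw [map_sub, Submodule.starProjection_eq_self_iff.2 (W.space.starProjection_apply_mem k),
      sub_self]
  have h0 : suspend l h' (suspend l h α) =
      suspendWith (h.trans h') (fun x => u (0, x)) fun x => α x := by
    funext x
    induction x using OnePoint.rec with
    | infty => rfl
    | coe x =>
      change addPoint h' (suspensionVec l h' x) (addPoint h (suspensionVec l h (F₀.proj l W x.1))
        (α (F₀.proj l V (F₀.proj l W x.1).1 : F₀ l V))) =
        addPoint (h.trans h') (u (0, x)) (α (F₀.proj l V x.1 : F₀ l V))
      rw [proj_proj h, addPoint_add]
      congr 1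
      refine Subtype.ext ?_
      change (y x - Q (y x)) + (z x - P (z x)) = (y x - Q (y x)) + (Q (d (0, x)) - P (d (0, x)))
      have : d (0, x) = z x := by simp [d]
      rw [this, hz]
  have h1 : suspend l (h.trans h') α =
      suspendWith (h.trans h') (fun x => u (1, x)) fun x => α x := by
    rw [suspend_eq]
    congr 1
    funext x
    refine Subtype.ext ?_
    change y x - P (y x) = (y x - Q (y x)) + (Q (d (1, x)) - P (d (1, x)))
    have : d (1, x) = y x := by simp [d]
    rw [this]
    abel
  rw [h0, h1]
  refine gHomotopic_suspendWith (h.trans h') (continuous_norm_val hE)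
    (isCompact_disk hE hl (hV.mono (h.trans h')))
    (continuous_norm_val hE) (continuous_proj hE hl hV) huc ?_ ?_ ?_
    (k := fun p => α p.2) (hα.continuous.comp continuous_snd) (fun _ => hα)
  · intro g t x
    have hy : y (F₀.act l U g x) = g • y x := l.tot_tot g x.1
    have hz : z (F₀.act l U g x) = g • z x := by
      change l.tot (F₀.proj l W (A.tot g x.1)).1 = _
      rw [proj_tot]
      exact l.tot_tot g _
    have hd : d (t, F₀.act l U g x) = g • d (t, x) := by
      change z _ + (t : ℝ) • (y _ - z _) = g • (z x + (t : ℝ) • (y x - z x))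
      rw [hy, hz, smul_add, ← smul_sub, smul_comm g]
    refine Subtype.ext ?_
    change (y _ - Q (y _)) + (Q (d _) - P (d _)) =
      g • ((y x - Q (y x)) + (Q (d (t, x)) - P (d (t, x))))
    have hQg : ∀ k, Q (g • k) = g • Q k := starProjection_smul hG W g
    have hPg : ∀ k, P (g • k) = g • P k := starProjection_smul hG V g
    rw [hy, hd, hQg, hQg, hPg, smul_add, smul_sub, smul_sub]
  · intro p
    refine Submodule.add_mem _ ?_ ?_
    · exact Submodule.orthogonal_le h (W.space.sub_starProjection_mem_orthogonal _)
    · rw [← hPQ]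
      exact V.space.sub_starProjection_mem_orthogonal _
  · intro R
    -- The three summands bound the part of x orthogonal to F₀(W), the part in F₀(W) orthogonal to
    -- F₀(V), and the part in F₀(V). The first bound also gives |y - z| ≤ C R/δ, the error in the
    -- second one.
    refine ⟨R / δ + (R + C * (R / δ)) / δ + R, fun t x hu hx => ?_⟩
    have hQu : Q (u (t, x)) = Q (d (t, x)) - P (d (t, x)) := by
      change Q ((y x - Q (y x)) + (Q (d (t, x)) - P (d (t, x)))) = _
      rw [map_add, hQy, zero_add]
      exact Submodule.starProjection_eq_self_iff.2
        (W.space.sub_mem (W.space.starProjection_apply_mem _)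
          (h (V.space.starProjection_apply_mem _)))
    have h2 : ‖y x - Q (y x)‖ ≤ R := by
      have : y x - Q (y x) = (u (t, x) : H) - Q (u (t, x)) := by
        rw [hQu]
        change _ = (y x - Q (y x)) + (Q (d (t, x)) - P (d (t, x))) - _
        abel
      rw [this]
      exact (norm_sub_starProjection_le_self _).trans hu
    have h3 : ‖x.1.2 - projVec l W x.1‖ ≤ R / δ :=
      norm_le_of_norm_suspensionVec_le (hV.mono h) h' h2
    have h4 : ‖Q (d (t, x)) - P (d (t, x))‖ ≤ R := by
      rw [← hQu]
      exact (W.space.norm_starProjection_apply_le _).trans hu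
    have h5 : ‖y x - z x‖ ≤ C * (R / δ) := by
      have h6 : y x - z x = l.tot (TotalSpace.mk' F x.1.proj (x.1.2 - projVec l W x.1)) :=
        ((l.toFun x.1.proj).map_sub _ _).symm
      rw [h6]
      exact (hlC _).trans (mul_le_mul_of_nonneg_left h3 hC)
    have h6 : ‖z x - P (z x)‖ ≤ R + C * (R / δ) := by
      have h7 : z x - P (z x) = (Q (d (t, x)) - P (d (t, x))) -
          (t : ℝ) • (Q (y x - z x) - P (Q (y x - z x))) := by
        change _ = Q (z x + (t : ℝ) • (y x - z x)) - P (z x + (t : ℝ) • (y x - z x)) - _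
        rw [hPQ]
        generalize y x - z x = k
        rw [Q.map_add, P.map_add, Q.map_smul, P.map_smul, hz, smul_sub]
        abel
      rw [h7]
      refine (norm_sub_le _ _).trans (add_le_add h4 ?_)
      rw [norm_smul, Real.norm_eq_abs, abs_of_nonneg t.2.1]
      refine (mul_le_of_le_one_left (norm_nonneg _) t.2.2).trans ?_
      exact (norm_sub_starProjection_le_self _).trans
        ((W.space.norm_starProjection_apply_le _).trans h5)
    have h7 : ‖projVec l W x.1 - projVec l V x.1‖ ≤ (R + C * (R / δ)) / δ := by
      rw [le_div_iff₀ hV.1, mul_comm]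
      have h8 := hV.norm_sub_projVec_le (F₀.proj l W x.1).1
      have h9 : projVec l V (F₀.proj l W x.1).1 = projVec l V x.1 :=
        congrArg (fun T => T x.1.2) (Submodule.starProjection_comp_starProjection_of_le
          (Submodule.comap_mono (f := (l.toFun x.1.proj).toLinearMap) h))
      rw [h9] at h8
      exact h8.trans h6
    have h8 : x.1.2 = (x.1.2 - projVec l W x.1) + (projVec l W x.1 - projVec l V x.1) +
        projVec l V x.1 := by abel
    rw [h8]
    refine (norm_add_le _ _).trans (add_le_add ((norm_add_le _ _).trans ?_) hx)
    exact add_le_add h3 h7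

end CompactBase

/-! ### Finite dimensional approximations -/

/-- The real component grows quadratically in m, the vector component at most linearly; so the real
component wins by any factor M once m is large. -/
theorem mul_le_of_dominated {s w m M : ℝ} (hs : m ^ 2 / 2 - 1 ≤ s) (hw0 : 0 ≤ w) (hw : w ≤ 2 * m)
    (hm : 4 * |M| + 2 ≤ m) : M * w ≤ s ∧ 0 ≤ s := by
  have h0 := abs_nonneg M
  have h1 : M * w ≤ |M| * (2 * m) :=
    (mul_le_mul_of_nonneg_right (le_abs_self M) hw0).trans (mul_le_mul_of_nonneg_left hw h0)
  have h2 : 0 ≤ m * (m - (4 * |M| + 2)) := mul_nonneg (by linarith) (by linarith)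
  have h3 : 0 ≤ |M| * m := mul_nonneg h0 (by linarith)
  constructor <;> nlinarith

section Approximation

variable {G : Type*} [Group G] [TopologicalSpace G] {B : Type*} [TopologicalSpace B]
  [CompactSpace B] [MulAction G B]
  {F : Type*} [NormedAddCommGroup F] [InnerProductSpace ℝ F] [CompleteSpace F]
  {E : B → Type*} [∀ b, NormedAddCommGroup (E b)] [∀ b, InnerProductSpace ℝ (E b)]
  [∀ b, CompleteSpace (E b)]
  [TopologicalSpace (TotalSpace F E)] [FiberBundle F E] [VectorBundle ℝ F E]
  {H : Type*} [NormedAddCommGroup H] [InnerProductSpace ℝ H] [CompleteSpace H]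
  [DistribMulAction G H] [SMulCommClass G ℝ H]
  {A : GAction G F E} {l : Morphism H A} {V W : FinGSubspace G H}
  {f c : TotalSpace F E → H}

/-- The fiberwise translate `qx + t (x - qx)` of a point `x`, where `qx` is its orthogonal projection
to `F₀(V)`. -/
def projLine (l : Morphism H A) (V : FinGSubspace G H) (t : ℝ) (x : TotalSpace F E) :
    TotalSpace F E :=
  TotalSpace.mk' F x.proj (projVec l V x + t • (x.2 - projVec l V x))

theorem projLine_zero (V : FinGSubspace G H) (x : TotalSpace F E) :
    projLine l V 0 x = (F₀.proj l V x).1 := by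
  rw [projLine, zero_smul, add_zero, proj_val]

theorem projLine_one (V : FinGSubspace G H) (x : TotalSpace F E) : projLine l V 1 x = x := by
  rw [projLine, one_smul, add_sub_cancel]

theorem projLine_of_mem {t : ℝ} {x : TotalSpace F E} (hx : l.tot x ∈ V.space) :
    projLine l V t x = x := by
  rw [projLine, projVec_of_mem hx, sub_self, smul_zero, add_zero]

theorem projLine_tot (V : FinGSubspace G H) (t : ℝ) (g : G) (x : TotalSpace F E) :
    projLine l V t (A.tot g x) = A.tot g (projLine l V t x) := by
  refine congrArg (TotalSpace.mk' F (g • x.proj)) ?_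
  let T := A.act g x.proj
  have h : ∀ v w : E x.proj, T (v + t • (w - v)) = T v + t • (T w - T v) := fun v w => by
    rw [map_add, map_smul, map_sub]
  rw [projVec_tot]
  exact (h _ _).symm

theorem continuous_projLine (hE : IsHilbertBundle F E) (hl : l.IsFredholm) {δ : ℝ}
    (hV : SpansWith l V.space δ) :
    Continuous fun p : ℝ × TotalSpace F E => projLine l V p.1 p.2 := by
  have h1 : Continuous fun p : ℝ × TotalSpace F E =>
      TotalSpace.mk' F p.2.proj (projVec l V p.2) :=
    (continuous_subtype_val.comp (continuous_proj hE hl hV)).comp continuous_snd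
  have h2 : Continuous fun p : ℝ × TotalSpace F E => TotalSpace.mk' F p.2.proj p.2.2 :=
    continuous_snd
  refine (continuous_mk_add_smul (continuous_mk_add_smul h1 h2 continuous_fst) h1
    continuous_fst.neg).congr fun p => congrArg (TotalSpace.mk' F p.2.proj) ?_
  rw [Pi.neg_apply, smul_sub, neg_smul, add_assoc, sub_eq_add_neg]

theorem finiteApprox_eq (f : TotalSpace F E → H) (l : Morphism H A) (V : FinGSubspace G H) :
    finiteApprox f l V = thomMap (fun x => ‖f x.1‖ ^ 2 - 1)
      fun x => (2 : ℝ) • V.space.orthogonalProjectionOnto (f x.1) := by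
  funext x
  induction x using OnePoint.rec with
  | infty => rfl
  | coe x => exact retraction_eq V.space (f x.1)

theorem finiteApprox_coe (f : TotalSpace F E → H) (l : Morphism H A) (V : FinGSubspace G H)
    (x : F₀ l V) : finiteApprox f l V x =
      dirPoint (‖f x.1‖ ^ 2 - 1, (2 : ℝ) • V.space.orthogonalProjectionOnto (f x.1)) :=
  retraction_eq V.space (f x.1)

theorem direction_ne_zero {V : Submodule ℝ H} [FiniteDimensional ℝ V] {h : H}
    (hh : ¬ (h ∈ Vᗮ ∧ ‖h‖ = 1)) :
    ((‖h‖ ^ 2 - 1, (2 : ℝ) • V.orthogonalProjectionOnto h) : ℝ × V) ≠ 0 := by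
  intro h0
  have h1 : ‖h‖ ^ 2 - 1 = 0 := congrArg Prod.fst h0
  have h2 : (2 : ℝ) • V.orthogonalProjectionOnto h = 0 := congrArg Prod.snd h0
  rw [smul_eq_zero_iff_right two_ne_zero] at h2
  refine hh ⟨Submodule.orthogonalProjectionOnto_eq_zero_iff.1 h2, ?_⟩
  exact (pow_eq_one_iff_of_nonneg (norm_nonneg h) two_ne_zero).1 (sub_eq_zero.1 h1)

/-! ### Comparison of a suspended approximation with a larger approximation -/

/-- The real component of the homotopy between the suspension of a finite dimensional
approximation and a larger finite dimensional approximation. -/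
def approxReal (f : TotalSpace F E → H) (l : Morphism H A) (h : V.space ≤ W.space)
    (p : unitInterval × F₀ l W) : ℝ :=
  ‖f (projLine l V p.1 p.2.1)‖ ^ 2 - 1 + ‖suspensionVec l h p.2‖ ^ 2

/-- The vector component of the homotopy between the suspension of a finite dimensional
approximation and a larger finite dimensional approximation. -/
def approxVec (f : TotalSpace F E → H) (l : Morphism H A) (h : V.space ≤ W.space)
    (p : unitInterval × F₀ l W) : W.space :=
  (2 : ℝ) • (suspensionVec l h p.2 + Submodule.inclusion h
    (V.space.orthogonalProjectionOnto (f (projLine l V p.1 p.2.1))))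

theorem coe_approxVec (h : V.space ≤ W.space) (p : unitInterval × F₀ l W) :
    (approxVec f l h p : H) = (2 : ℝ) • ((suspensionVec l h p.2 : H) +
      V.space.starProjection (f (projLine l V p.1 p.2.1))) := rfl

/-- The summands u and P_V f are orthogonal, so both vanish at a zero. But u = 0 means x ∈ F₀(V),
where the path from qx to x is constant; so the condition that f misses S(Vᗮ) on F₀(V) suffices for
all times. -/
theorem approx_ne_zero (h : V.space ≤ W.space)
    (hm : ∀ x : TotalSpace F E, l.tot x ∈ V.space → ¬ (f x ∈ V.spaceᗮ ∧ ‖f x‖ = 1))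
    (p : unitInterval × F₀ l W) (hs : approxReal f l h p = 0) : approxVec f l h p ≠ 0 := by
  intro hw
  have hw' := congrArg (Subtype.val) hw
  rw [coe_approxVec, Submodule.coe_zero, smul_eq_zero_iff_right two_ne_zero] at hw'
  have hperp := (Submodule.mem_orthogonal' _ _).1 (suspensionVec_mem_orthogonal h p.2) _
    (V.space.starProjection_apply_mem (f (projLine l V p.1 p.2.1)))
  obtain ⟨h1, h2⟩ := norm_le_norm_add_of_inner_eq_zero hperp
  rw [hw', norm_zero] at h1 h2
  have hu : (suspensionVec l h p.2 : H) = 0 := norm_le_zero_iff.1 h1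
  have hP := norm_le_zero_iff.1 h2
  have hx : l.tot p.2.1 ∈ V.space :=
    Submodule.starProjection_eq_self_iff.1 (sub_eq_zero.1 hu).symm
  rw [approxReal, Submodule.coe_eq_zero.1 hu, norm_zero] at hs
  rw [projLine_of_mem hx] at hs hP
  refine hm p.2.1 hx ⟨(Submodule.starProjection_apply_eq_zero_iff _).1 hP, ?_⟩
  refine (pow_eq_one_iff_of_nonneg (norm_nonneg _) two_ne_zero).1 ?_
  linarith

theorem gHomotopic_approx (hE : IsHilbertBundle F E) (hl : l.IsFredholm)
    (hG : ∀ (g : G) (h : H), ‖g • h‖ = ‖h‖) {δ : ℝ} (hV : SpansWith l V.space δ)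
    (h : V.space ≤ W.space) (hf : Continuous f) (hfG : ∀ g x, f (A.tot g x) = g • f x)
    (hfp : ∀ R : ℝ, ∃ r : ℝ, ∀ x, r < ‖x.2‖ → R < ‖f x‖)
    (hm : ∀ x : TotalSpace F E, l.tot x ∈ V.space → ¬ (f x ∈ V.spaceᗮ ∧ ‖f x‖ = 1)) :
    GHomotopic l W (thomMap (fun x => approxReal f l h (0, x)) fun x => approxVec f l h (0, x))
      (thomMap (fun x => approxReal f l h (1, x)) fun x => approxVec f l h (1, x)) := by
  have hN : Continuous fun p : unitInterval × F₀ l W => f (projLine l V p.1 p.2.1) :=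
    hf.comp ((continuous_projLine hE hl hV).comp
      ((continuous_subtype_val.comp continuous_fst).prodMk
        (continuous_subtype_val.comp continuous_snd)))
  have hu : Continuous fun p : unitInterval × F₀ l W => suspensionVec l h p.2 :=
    (continuous_suspensionVec hl h).comp continuous_snd
  have hNG : ∀ g (t : unitInterval) (x : F₀ l W),
      f (projLine l V t (F₀.act l W g x).1) = g • f (projLine l V t x.1) := by
    intro g t x
    rw [← hfG, ← projLine_tot]
    rfl
  refine gHomotopic_thomMap hG (continuous_norm_val hE) (isCompact_disk hE hl (hV.mono h))
    ?_ ?_ ?_ ?_ (approx_ne_zero h hm) ?_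
  · exact ((hN.norm.pow 2).sub continuous_const).add (hu.norm.pow 2)
  · refine Continuous.const_smul (M := ℝ) (hu.add (Continuous.subtype_mk ?_ _)) 2
    exact V.space.starProjection.continuous.comp hN
  · intro g t x
    rw [approxReal, approxReal, hNG, hG, suspensionVec_act hG]
    have : ‖W.act g (suspensionVec l h x)‖ = ‖suspensionVec l h x‖ := hG g _
    rw [this]
  · intro g t x
    refine Subtype.ext ?_
    change _ = g • (approxVec f l h (t, x) : H)
    rw [coe_approxVec, coe_approxVec, hNG, starProjection_smul hG, suspensionVec_act hG]
    change (2 : ℝ) • (g • (suspensionVec l h x : H) + _) = _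
    rw [← smul_add, smul_comm g]
  · intro M
    obtain ⟨r, hr⟩ := hfp (4 * |M| + 2)
    refine ⟨r + (4 * |M| + 2) / δ, fun t x hx => ?_⟩
    set N := f (projLine l V t x.1) with hN
    set u := suspensionVec l h x with hu
    -- This m is large for large x: bounded u bounds x - qx, bounded N bounds the point y on the
    -- path, and x = y + (1 - t)(x - qx).
    refine mul_le_of_dominated (m := ‖N‖ + ‖u‖) ?_ (norm_nonneg _) ?_ ?_
    · change _ ≤ ‖N‖ ^ 2 - 1 + ‖u‖ ^ 2
      nlinarith [sq_nonneg (‖N‖ - ‖u‖)]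
    · change ‖(2 : ℝ) • ((u : H) + V.space.starProjection N)‖ ≤ _
      rw [norm_smul, Real.norm_ofNat]
      have h1 := norm_add_le (u : H) (V.space.starProjection N)
      have h2 := V.space.norm_starProjection_apply_le N
      have h3 : ‖(u : H)‖ = ‖u‖ := rfl
      linarith
    · by_contra! hlt
      have h1 : ‖x.1.2 - projVec l V x.1‖ ≤ (4 * |M| + 2) / δ :=
        norm_le_of_norm_suspensionVec_le hV h (by linarith [norm_nonneg N])
      let y : E x.1.proj := (projLine l V t x.1).2
      have h2 : ‖y‖ ≤ r := by
        by_contra! h2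
        linarith [hr _ h2, norm_nonneg u]
      have h3 : x.1.2 = y + (1 - (t : ℝ)) • (x.1.2 - projVec l V x.1) := by
        change _ = (projVec l V x.1 + (t : ℝ) • (x.1.2 - projVec l V x.1)) + _
        rw [sub_smul, one_smul]
        abel
      have h4 : ‖(1 - (t : ℝ)) • (x.1.2 - projVec l V x.1)‖ ≤ ‖x.1.2 - projVec l V x.1‖ := by
        rw [norm_smul, Real.norm_eq_abs, abs_of_nonneg (sub_nonneg.2 t.2.2)]
        exact mul_le_of_le_one_left (norm_nonneg _) (by linarith [t.2.1])
      have h5 := norm_add_le y ((1 - (t : ℝ)) • (x.1.2 - projVec l V x.1))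
      rw [← h3] at h5
      linarith

/-- This is an end of `gHomotopic_approx` for W = V, where u vanishes and the path from qx to x is
constant. -/
theorem isPointedGMap_finiteApprox (hE : IsHilbertBundle F E) (hl : l.IsFredholm)
    (hG : ∀ (g : G) (h : H), ‖g • h‖ = ‖h‖) {δ : ℝ} (hV : SpansWith l V.space δ)
    (hf : Continuous f) (hfG : ∀ g x, f (A.tot g x) = g • f x)
    (hfp : ∀ R : ℝ, ∃ r : ℝ, ∀ x, r < ‖x.2‖ → R < ‖f x‖)
    (hm : ∀ x : TotalSpace F E, l.tot x ∈ V.space → ¬ (f x ∈ V.spaceᗮ ∧ ‖f x‖ = 1)) :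
    IsPointedGMap l V (finiteApprox f l V) := by
  have h := (gHomotopic_approx hE hl hG hV le_rfl hf hfG hfp hm).left
  have hu : ∀ x : F₀ l V, suspensionVec l le_rfl x = 0 := fun x =>
    Subtype.ext (sub_eq_zero.2 (Submodule.starProjection_eq_self_iff.2 x.2).symm)
  have heq : finiteApprox f l V = thomMap (fun x => approxReal f l (le_refl V.space) (0, x))
      fun x => approxVec f l (le_refl V.space) (0, x) := by
    rw [finiteApprox_eq]
    congr 1
    · funext x
      rw [approxReal, projLine_of_mem x.2, hu, norm_zero]
      ring
    · funext x
      rw [approxVec, projLine_of_mem x.2, hu, zero_add]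
      rfl
  rwa [heq]

/-- If l(x) ∈ W and f(x) ⟂ W, then f(x) is the component of c(x) orthogonal to W. On the disk bundle
of radius r this has norm at most 1/4, and outside of it |f| > 1; so |f(x)| = 1 is impossible. -/
theorem not_mem_of_approximation (hlc : ∀ x, f x = l.tot x + c x) {r : ℝ}
    (hr : ∀ x, r < ‖x.2‖ → 1 < ‖f x‖)
    (hc : ∀ x, ‖x.2‖ ≤ r → ‖c x - V.space.starProjection (c x)‖ ≤ 1 / 4) (h : V.space ≤ W.space)
    (x : TotalSpace F E) (hx : l.tot x ∈ W.space) : ¬ (f x ∈ W.spaceᗮ ∧ ‖f x‖ = 1) := by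
  rintro ⟨h1, h2⟩
  have h3 : ‖x.2‖ ≤ r := by
    by_contra! h3
    exact absurd (hr x h3) (not_lt.2 h2.le)
  have h4 : f x = c x - W.space.starProjection (c x) := by
    have h5 := (Submodule.starProjection_apply_eq_zero_iff _).2 h1
    rw [hlc, map_add, Submodule.starProjection_eq_self_iff.2 hx] at h5
    rw [hlc, eq_sub_iff_add_eq, add_right_comm, h5, zero_add]
  have h5 := (norm_sub_starProjection_mono h (c x)).trans (hc x h3)
  rw [← h4, h2] at h5
  norm_num at h5

/-- With v = P_V f(qx), the suspension has vector part u + k, where k is a positive multiple of v or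
infinite. Antipodality would force u = 0 and v = 0 by orthogonality, and then |f(qx)| = 1 from the
real components, which is excluded because f misses S(Vᗮ). -/
theorem gHomotopic_suspend_finiteApprox_left (hE : IsHilbertBundle F E) (hl : l.IsFredholm)
    (hG : ∀ (g : G) (h : H), ‖g • h‖ = ‖h‖) {δ : ℝ} (hV : SpansWith l V.space δ)
    (h : V.space ≤ W.space) (hf : Continuous f) (hfG : ∀ g x, f (A.tot g x) = g • f x)
    (hfp : ∀ R : ℝ, ∃ r : ℝ, ∀ x, r < ‖x.2‖ → R < ‖f x‖)
    (hm : ∀ x : TotalSpace F E, l.tot x ∈ V.space → ¬ (f x ∈ V.spaceᗮ ∧ ‖f x‖ = 1)) :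
    GHomotopic l W (suspend l h (finiteApprox f l V))
      (thomMap (fun x => approxReal f l h (0, x)) fun x => approxVec f l h (0, x)) := by
  refine GHomotopic.of_not_antipodal hG
    ((isPointedGMap_finiteApprox hE hl hG hV hf hfG hfp hm).suspend hE hl hG hV h)
    (gHomotopic_approx hE hl hG hV h hf hfG hfp hm).left fun x => ?_
  let N := f (F₀.proj l V x.1).1
  let u := suspensionVec l h x
  let v := V.space.orthogonalProjectionOnto N
  let p : ℝ × V.space := (‖N‖ ^ 2 - 1, (2 : ℝ) • v)
  have hN : f (projLine l V ((0 : unitInterval) : ℝ) x.1) = N := by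
    rw [Set.Icc.coe_zero, projLine_zero]
  have hp : p ≠ 0 := direction_ne_zero (hm _ (F₀.proj l V x.1).2)
  have hq : (approxReal f l h (0, x), approxVec f l h (0, x)) =
      (‖N‖ ^ 2 - 1 + ‖u‖ ^ 2, (2 : ℝ) • (u + Submodule.inclusion h v)) := by
    rw [approxReal, approxVec]
    simp only [hN]
    rfl
  have hα : suspend l h (finiteApprox f l V) x = addPoint h u (dirPoint p) :=
    congrArg (addPoint h u) (finiteApprox_coe f l V (F₀.proj l V x.1))
  have hq0 : (approxReal f l h (0, x), approxVec f l h (0, x)) ≠ 0 := fun h0 =>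
    approx_ne_zero h hm (0, x) (congrArg Prod.fst h0) (congrArg Prod.snd h0)
  obtain ⟨a, ha, hap⟩ := dirVec_dirPoint hp
  rw [hα]
  rcases hz : dirPoint p with _ | k
  -- If the approximation at qx is infinite, then |N| > 1, and both real components are positive.
  · rw [hz] at hap
    refine ⟨(1, 0), _, fun h0 => one_ne_zero (congrArg Prod.fst h0), hq0,
      (dirPoint_of_infty ⟨rfl, zero_le_one⟩).symm, rfl, fun b d hb hd h0 => ?_⟩
    have h1 : (1 : ℝ) = a * (‖N‖ ^ 2 - 1) := congrArg Prod.fst hap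
    have h2 : 0 < ‖N‖ ^ 2 - 1 := by
      by_contra! h2
      nlinarith
    rw [hq] at h0
    have h3 : b * 1 + d * (‖N‖ ^ 2 - 1 + ‖u‖ ^ 2) = 0 := congrArg Prod.fst h0
    have : 0 < d * (‖N‖ ^ 2 - 1 + ‖u‖ ^ 2) := mul_pos hd (by positivity)
    linarith
  · rw [hz] at hap
    refine ⟨_, _, dirVec_ne_zero _, hq0, (dirPoint_dirVec _).symm, rfl, fun b d hb hd h0 => ?_⟩
    rw [hq] at h0
    change b • dirVec (((u + Submodule.inclusion h k : W.space)) : OnePoint W.space) + _ = 0 at h0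
    have hk : (2 : ℝ) • k = a • (2 : ℝ) • v := congrArg Prod.snd hap
    have hk' : ‖k‖ ^ 2 - 1 = a * (‖N‖ ^ 2 - 1) := congrArg Prod.fst hap
    have h1 : b * (‖u + Submodule.inclusion h k‖ ^ 2 - 1) + d * (‖N‖ ^ 2 - 1 + ‖u‖ ^ 2) = 0 :=
      congrArg Prod.fst h0
    have h2 : b • (2 : ℝ) • ((u : H) + k) + d • (2 : ℝ) • ((u : H) + v) = 0 :=
      congrArg Subtype.val (congrArg Prod.snd h0)
    have hk2 : k = a • v := by
      rw [smul_comm a] at hk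
      exact smul_right_injective _ (two_ne_zero' ℝ) hk
    have h3 : ((2 * (b + d)) • (u : H)) + ((2 * (b * a + d)) • (v : H)) = 0 := by
      rw [← h2, hk2, Submodule.coe_smul]
      module
    have hperp := (Submodule.mem_orthogonal' _ _).1 (suspensionVec_mem_orthogonal h x) _ v.2
    have h4 : inner ℝ ((2 * (b + d)) • (u : H)) ((2 * (b * a + d)) • (v : H)) = (0 : ℝ) := by
      rw [inner_smul_left, inner_smul_right]
      change _ * (_ * inner ℝ (suspensionVec l h x : H) (v : H)) = 0
      rw [hperp, mul_zero, mul_zero]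
    obtain ⟨h5, h6⟩ := norm_le_norm_add_of_inner_eq_zero h4
    rw [h3, norm_zero] at h5 h6
    have hu : u = 0 := by
      have := norm_le_zero_iff.1 h5
      rw [smul_eq_zero_iff_right (by positivity)] at this
      exact Submodule.coe_eq_zero.1 this
    have hv : v = 0 := by
      have := norm_le_zero_iff.1 h6
      rw [smul_eq_zero_iff_right (by positivity)] at this
      exact Submodule.coe_eq_zero.1 this
    rw [hu, zero_add, norm_zero] at h1
    have h7 : ‖Submodule.inclusion h k‖ = ‖k‖ := rfl
    rw [h7, hk'] at h1
    have h8 : (b * a + d) * (‖N‖ ^ 2 - 1) = 0 := by linear_combination h1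
    rcases mul_eq_zero.1 h8 with h9 | h9
    · have : 0 < b * a + d := by positivity
      exact this.ne' h9
    · exact hp (Prod.ext h9 (by
        change (2 : ℝ) • v = 0
        rw [hv, smul_zero]))

/-- Antipodality here says that the rays of (|f|² - 1 + |u|², u + P_V f) and (|f|² - 1, P_W f), up
to the factor 2 in the vector parts, are opposite. This makes f small: the bound 1/4 for c modulo V
yields |f| ≤ 1/2 and |u| ≤ 1/4, and then both real components are negative. -/
theorem gHomotopic_suspend_finiteApprox_right (hE : IsHilbertBundle F E) (hl : l.IsFredholm)
    (hG : ∀ (g : G) (h : H), ‖g • h‖ = ‖h‖) {δ : ℝ} (hV : SpansWith l V.space δ)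
    (h : V.space ≤ W.space) (hf : Continuous f) (hfG : ∀ g x, f (A.tot g x) = g • f x)
    (hfp : ∀ R : ℝ, ∃ r : ℝ, ∀ x, r < ‖x.2‖ → R < ‖f x‖)
    (hlc : ∀ x, f x = l.tot x + c x) {r : ℝ} (hr : ∀ x, r < ‖x.2‖ → 1 < ‖f x‖)
    (hc : ∀ x, ‖x.2‖ ≤ r → ‖c x - V.space.starProjection (c x)‖ ≤ 1 / 4) :
    GHomotopic l W
      (thomMap (fun x => approxReal f l h (1, x)) fun x => approxVec f l h (1, x))
      (finiteApprox f l W) := by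
  have hmV := not_mem_of_approximation (W := V) hlc hr hc le_rfl
  have hmW := not_mem_of_approximation (W := W) hlc hr hc h
  refine GHomotopic.of_not_antipodal hG
    (gHomotopic_approx hE hl hG hV h hf hfG hfp hmV).right
    (isPointedGMap_finiteApprox hE hl hG (hV.mono h) hf hfG hfp hmW) fun x => ?_
  refine ⟨_, _, fun h0 => approx_ne_zero h hmV (1, x) (congrArg Prod.fst h0)
    (congrArg Prod.snd h0), direction_ne_zero (hmW x.1 x.2), rfl, finiteApprox_coe f l W x,
    fun a b ha hb h0 => ?_⟩
  let P := V.space.starProjection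
  let Q := W.space.starProjection
  let k := c x.1
  have hN : f (projLine l V ((1 : unitInterval) : ℝ) x.1) = f x.1 := by
    rw [Set.Icc.coe_one, projLine_one]
  have h1 : a * (‖f (projLine l V ((1 : unitInterval) : ℝ) x.1)‖ ^ 2 - 1 +
    ‖suspensionVec l h x‖ ^ 2) + b * (‖f x.1‖ ^ 2 - 1) = 0 := congrArg Prod.fst h0
  have h2 : a • (2 : ℝ) • ((l.tot x.1 - P (l.tot x.1)) +
      P (f (projLine l V ((1 : unitInterval) : ℝ) x.1))) + b • (2 : ℝ) • Q (f x.1) = 0 :=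
    congrArg Subtype.val (congrArg Prod.snd h0)
  rw [hN] at h1 h2
  have hn : ‖suspensionVec l h x‖ = ‖l.tot x.1 - P (l.tot x.1)‖ := rfl
  rw [hn] at h1
  have hPP : ∀ k, P (P k) = P k := fun k =>
    Submodule.starProjection_eq_self_iff.2 (V.space.starProjection_apply_mem k)
  have hPQ : ∀ k, P (Q k) = P k := fun k =>
    congrArg (fun T => T k) (Submodule.starProjection_comp_starProjection_of_le h)
  have hQl : Q (l.tot x.1) = l.tot x.1 := Submodule.starProjection_eq_self_iff.2 x.2
  -- Projecting the relation to V removes u and leaves a positive multiple of P_V f.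
  have hPf : P (f x.1) = 0 := by
    have h3 := congrArg P h2
    rw [P.map_add, P.map_smul, P.map_smul, P.map_add, P.map_sub, hPP, sub_self, hPP, P.map_smul,
      P.map_smul, hPQ, P.map_zero, zero_add, ← add_smul, smul_smul] at h3
    exact (smul_eq_zero_iff_right (by positivity)).1 h3
  rw [hPf, add_zero] at h2
  set u := l.tot x.1 - P (l.tot x.1)
  have hQf : Q (f x.1) = u + Q (k - P k) := by
    have h3 : Q (P k) = P k :=
      Submodule.starProjection_eq_self_iff.2 (h (V.space.starProjection_apply_mem k))
    have h4 : P (l.tot x.1) + P k = 0 := by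
      rw [← P.map_add, ← hlc]
      exact hPf
    have h5 : Q (f x.1) = l.tot x.1 + Q k := by
      rw [hlc, Q.map_add, hQl]
    rw [h5, Q.map_sub, h3, sub_add_sub_comm, h4, sub_zero]
  -- Otherwise both real components are positive. This places x in the disk bundle where c is
  -- approximated.
  have hfx : ‖f x.1‖ ≤ 1 := by
    by_contra! hlt
    have h3 : 0 < ‖f x.1‖ ^ 2 - 1 := by nlinarith
    have := mul_pos ha h3
    have := mul_pos hb h3
    nlinarith [mul_nonneg ha.le (sq_nonneg ‖u‖)]
  have hxr : ‖x.1.2‖ ≤ r := by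
    by_contra! hlt
    exact absurd (hr x.1 hlt) (not_lt.2 hfx)
  have hd : ‖Q (k - P k)‖ ≤ 1 / 4 := (W.space.norm_starProjection_apply_le _).trans (hc x.1 hxr)
  set d := Q (k - P k)
  have h3 : (a + b) • u = -(b • d) := by
    rw [hQf] at h2
    have h4 : (2 : ℝ) • ((a + b) • u + b • d) = 0 := by
      rw [← h2]
      module
    exact eq_neg_of_add_eq_zero_left ((smul_eq_zero_iff_right two_ne_zero).1 h4)
  have h4 : (a + b) • Q (f x.1) = a • d := by
    rw [hQf, smul_add, h3]
    module
  have hab : 0 < a + b := by positivity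
  have hu4 : ‖u‖ ≤ 1 / 4 := by
    have h5 := congrArg norm h3
    rw [norm_neg, norm_smul, norm_smul, Real.norm_eq_abs, Real.norm_eq_abs, abs_of_pos hab,
      abs_of_pos hb] at h5
    refine le_of_mul_le_mul_left ?_ hab
    nlinarith [norm_nonneg d]
  have hf4 : ‖Q (f x.1)‖ ≤ 1 / 4 := by
    have h5 := congrArg norm h4
    rw [norm_smul, norm_smul, Real.norm_eq_abs, Real.norm_eq_abs, abs_of_pos hab,
      abs_of_pos ha] at h5
    refine le_of_mul_le_mul_left ?_ hab
    nlinarith [norm_nonneg d]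
  have hf5 : ‖f x.1 - Q (f x.1)‖ ≤ 1 / 4 := by
    have h5 : f x.1 - Q (f x.1) = k - Q k := by
      rw [hlc, Q.map_add, hQl]
      abel
    rw [h5]
    exact (norm_sub_starProjection_mono h k).trans (hc x.1 hxr)
  have hf6 : ‖f x.1‖ ≤ 1 / 2 := by
    have h5 := norm_add_le (f x.1 - Q (f x.1)) (Q (f x.1))
    rw [sub_add_cancel] at h5
    linarith
  have h5 : ‖f x.1‖ ^ 2 ≤ 1 / 4 := by nlinarith [norm_nonneg (f x.1)]
  have h6 : ‖u‖ ^ 2 ≤ 1 / 4 := by nlinarith [norm_nonneg u]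
  nlinarith [mul_nonneg ha.le (sub_nonneg.2 h5), mul_nonneg ha.le (sub_nonneg.2 h6),
    mul_nonneg hb.le (sub_nonneg.2 h5)]

/-! ### Cofinality of admissible subspaces and existence of the Euler class -/

theorem isAdmissible_of_approximation (hE : IsHilbertBundle F E) (hl : l.IsFredholm)
    (hG : ∀ (g : G) (h : H), ‖g • h‖ = ‖h‖) {δ : ℝ} (hV : SpansWith l V.space δ)
    (hf : Continuous f) (hfG : ∀ g x, f (A.tot g x) = g • f x)
    (hfp : ∀ R : ℝ, ∃ r : ℝ, ∀ x, r < ‖x.2‖ → R < ‖f x‖)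
    (hlc : ∀ x, f x = l.tot x + c x) {r : ℝ} (hr : ∀ x, r < ‖x.2‖ → 1 < ‖f x‖)
    (hc : ∀ x, ‖x.2‖ ≤ r → ‖c x - V.space.starProjection (c x)‖ ≤ 1 / 4) :
    IsAdmissible f l V where
  spans := hV.spans
  misses W h x hx := not_mem_of_approximation hlc hr hc h x hx
  homotopic W h := by
    have hm := not_mem_of_approximation (W := V) hlc hr hc le_rfl
    exact (((gHomotopic_suspend_finiteApprox_left hE hl hG hV h hf hfG hfp hm).trans
      (gHomotopic_approx hE hl hG hV h hf hfG hfp hm)).trans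
      (gHomotopic_suspend_finiteApprox_right hE hl hG hV h hf hfG hfp hlc hr hc)).symm

theorem exists_isAdmissible (hE : IsHilbertBundle F E) (hH : HasApproximation G H)
    (hG : ∀ (g : G) (h : H), ‖g • h‖ = ‖h‖) (hp : IsPresentation f l c)
    (hfG : ∀ g x, f (A.tot g x) = g • f x)
    (hfp : ∀ R : ℝ, ∃ r : ℝ, ∀ x, r < ‖x.2‖ → R < ‖f x‖) (V₀ : FinGSubspace G H) :
    ∃ V : FinGSubspace G H, V₀.space ≤ V.space ∧ IsAdmissible f l V := by
  have hl := hp.isFredholm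
  have hf : Continuous f := by
    rw [funext hp.eq_add]
    exact hl.continuous_tot.add hp.continuous
  obtain ⟨V₁, δ, hV₁, hδ⟩ := exists_spansWith hE hl hH V₀
  obtain ⟨r, hr⟩ := hfp 1
  obtain ⟨V, hV, hVc⟩ := hH _ (hp.compact r) (1 / 4) (by norm_num) V₁
  exact ⟨V, hV₁.trans hV, isAdmissible_of_approximation hE hl hG (hδ.mono hV) hf hfG hfp hp.eq_add
    hr fun x hx => hVc _ (subset_closure ⟨x, hx, rfl⟩)⟩

/-- For W = V, admissibility provides a homotopy through pointed G-maps which starts at this map. -/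
theorem IsAdmissible.isPointedGMap {V : FinGSubspace G H} (hV : IsAdmissible f l V) :
    IsPointedGMap l V (finiteApprox f l V) :=
  (hV.homotopic V le_rfl).left

theorem IsAdmissible.mk_eq {V : FinGSubspace G H} (hV : IsAdmissible f l V)
    (hW : Spans l W) (h : V.space ≤ W.space) (hW' : IsPointedGMap l W (finiteApprox f l W)) :
    StableCohomotopy.mk ⟨V, hV.spans, finiteApprox f l V, hV.isPointedGMap⟩ =
      StableCohomotopy.mk ⟨W, hW, finiteApprox f l W, hW'⟩ :=
  Quot.sound ⟨h, hV.homotopic W h⟩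

theorem IsEulerClass.unique {e e' : StableCohomotopy l} (h : IsEulerClass f l e)
    (h' : IsEulerClass f l e') : e = e' := by
  obtain ⟨V, -, hV⟩ := h.cofinal (Classical.arbitrary _)
  obtain ⟨_, rfl⟩ := h.eq V hV
  obtain ⟨_, rfl⟩ := h'.eq V hV
  rfl

/-- Two admissible subspaces V and V' are compared on V + V', which need not be shown admissible:
the conditions on V and V' already identify the approximation there with both suspensions. -/
theorem exists_isEulerClass (hE : IsHilbertBundle F E) (hH : HasApproximation G H)
    (hG : ∀ (g : G) (h : H), ‖g • h‖ = ‖h‖) (hp : IsPresentation f l c)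
    (hfG : ∀ g x, f (A.tot g x) = g • f x)
    (hfp : ∀ R : ℝ, ∃ r : ℝ, ∀ x, r < ‖x.2‖ → R < ‖f x‖) :
    ∃ e : StableCohomotopy l, IsEulerClass f l e := by
  have hcof := exists_isAdmissible hE hH hG hp hfG hfp
  obtain ⟨V, -, hV⟩ := hcof (Classical.arbitrary _)
  refine ⟨StableCohomotopy.mk ⟨V, hV.spans, finiteApprox f l V, hV.isPointedGMap⟩, hcof,
    fun V' hV' => ⟨hV'.isPointedGMap, ?_⟩⟩
  have hW : Spans l (V.sup V') := hV.spans.mono (V.le_sup_left V')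
  have hW' := (hV.homotopic _ (V.le_sup_left V')).left
  exact (hV'.mk_eq hW (V.le_sup_right V') hW').trans (hV.mk_eq hW (V.le_sup_left V') hW').symm

end Approximation

/-! ### Bundles over the cylinder -/

/-- Orthogonal projection embeds T'⁻¹(V) into the finite dimensional T⁻¹(V): a vector v of the first
orthogonal to the second would satisfy δ|v| ≤ η|v|. Surjectivity modulo V is inherited with the
bound δ - η. -/
theorem AdjointBoundedBelow.isFredholm_of_modulo_sub_le {X H : Type*} [NormedAddCommGroup X]
    [InnerProductSpace ℝ X] [CompleteSpace X] [NormedAddCommGroup H] [InnerProductSpace ℝ H]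
    [CompleteSpace H] {T T' : X →L[ℝ] H} {V : Submodule ℝ H} [FiniteDimensional ℝ V] {δ η : ℝ}
    (h : AdjointBoundedBelow T V δ) (hT : T.IsFredholm) (hη0 : 0 ≤ η) (hηδ : η < δ)
    (hη : ∀ x, ‖modulo (T' - T) V x‖ ≤ η * ‖x‖) : T'.IsFredholm := by
  refine (h.of_modulo_sub_le hη0 hη).isFredholm (sub_pos.2 hηδ) ?_
  have := finiteDimensional_comap hT V
  let K := V.comap T.toLinearMap
  let f : V.comap T'.toLinearMap →ₗ[ℝ] K :=
    K.orthogonalProjectionOnto.toLinearMap ∘ₗ (V.comap T'.toLinearMap).subtype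
  refine Module.Finite.of_injective f ((injective_iff_map_eq_zero f).2 fun v hv => ?_)
  have h1 : (v : X) ∈ Kᗮ := Submodule.orthogonalProjectionOnto_eq_zero_iff.1 hv
  have h2 : modulo T V (v : X) = -modulo (T' - T) V (v : X) := by
    have h3 : modulo T' V (v : X) = 0 := modulo_eq_zero_iff.2 v.2
    rw [← sub_zero (modulo T V (v : X)), ← h3]
    simp only [modulo_apply, _root_.sub_apply, map_sub]
    abel
  have h3 := h.le_norm_modulo (hη0.trans_lt hηδ) h1
  rw [h2, norm_neg] at h3
  have h4 : ‖(v : X)‖ ≤ 0 := by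
    by_contra! h4
    nlinarith [hη v]
  exact Subtype.ext (norm_le_zero_iff.1 h4)

instance {Y : Type*} [TopologicalSpace Y] [CompactSpace Y] : CompactSpace (Cyl Y) := by
  refine ⟨Cyl.isInducing.isCompact_iff.2 ?_⟩
  convert isCompact_univ (X := Y × unitInterval)
  exact image_univ_of_surjective fun p => ⟨⟨p.1, p.2⟩, rfl⟩

section Cylinder

variable {G : Type*} [Group G] [TopologicalSpace G]
  {Y : Type*} [TopologicalSpace Y] [MulAction G Y]
  {F : Type*} [NormedAddCommGroup F] [InnerProductSpace ℝ F]
  {E : Y → Type*} [∀ y, NormedAddCommGroup (E y)] [∀ y, InnerProductSpace ℝ (E y)]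
  [TopologicalSpace (TotalSpace F E)] [FiberBundle F E] [VectorBundle ℝ F E]
  {H : Type*} [NormedAddCommGroup H] [InnerProductSpace ℝ H]
  [DistribMulAction G H] [SMulCommClass G ℝ H]
  {A : GAction G F E} {l l' : Morphism H A} {L : Morphism H A.cyl}
  {f c c' : TotalSpace F E → H}

/-- The map to `E` of the pullback of `E` to the cylinder. -/
def cylPr (x : TotalSpace F (CylBundle E)) : TotalSpace F E :=
  TotalSpace.mk' F x.proj.base x.2

theorem continuous_cylPr :
    Continuous (cylPr : TotalSpace F (CylBundle E) → TotalSpace F E) :=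
  Pullback.continuous_lift F E (Cyl.toBase Y)

theorem continuous_time : Continuous fun x : TotalSpace F (CylBundle E) => x.proj.time :=
  continuous_snd.comp (Cyl.isInducing.continuous.comp
    ((Pullback.continuous_proj F E (Cyl.toBase Y))))

theorem continuous_cylMk :
    Continuous fun p : unitInterval × TotalSpace F E => cylMk p.1 p.2 := by
  rw [isInducing_cyl.continuous_iff]
  refine Continuous.prodMk ?_ continuous_snd
  rw [Cyl.isInducing.continuous_iff]
  exact ((FiberBundle.continuous_proj F E).comp continuous_snd).prodMk continuous_fst

theorem IsHilbertBundle.cyl (hE : IsHilbertBundle F E) : IsHilbertBundle F (CylBundle E) := by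
  rintro e ⟨e', he', rfl⟩ p hp v
  exact hE e' p.base hp v

theorem line_tot (x : TotalSpace F (CylBundle E)) : (l.line l').tot x =
    (1 - (x.proj.time : ℝ)) • l.tot (cylPr x) + (x.proj.time : ℝ) • l'.tot (cylPr x) := rfl

theorem continuousOn_line (hl : l.IsFredholm) (hl' : l'.IsFredholm)
    (e : Trivialization F (π F (CylBundle E))) [he : MemTrivializationAtlas e] :
    ContinuousOn (fun p => ((l.line l').toFun p).comp (e.symmL ℝ p)) e.baseSet := by
  obtain ⟨e', he', rfl⟩ := he
  have ht : Continuous fun p : Cyl Y => (p.time : ℝ) :=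
    continuous_subtype_val.comp (continuous_snd.comp Cyl.isInducing.continuous)
  have h1 : ∀ {k : Morphism H A}, k.IsFredholm → ContinuousOn
      (fun p : Cyl Y => (k.toFun p.base).comp (e'.symmL ℝ p.base)) ((Cyl.toBase Y) ⁻¹' e'.baseSet) :=
    fun hk => (hk.continuousOn e').comp (Cyl.toBase Y).continuous.continuousOn fun p hp => hp
  refine ((((continuous_const (y := (1 : ℝ))).sub ht).continuousOn.smul (h1 hl)).add
    (ht.continuousOn.smul (h1 hl'))).congr fun p hp => ContinuousLinearMap.ext fun v => ?_
  -- Both sides have the same coordinate v in the trivialization `e'`, which is injective on the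
  -- fibre.
  have h2 : (e'.pullback (Cyl.toBase Y)).symmL ℝ p v = e'.symmL ℝ p.base v := by
    have h3 := congrArg Prod.snd (e'.apply_mk_symm hp v)
    have h4 := congrArg Prod.snd ((e'.pullback (Cyl.toBase Y)).apply_mk_symm (b := p) hp v)
    have h5 : Function.Injective fun w => (e' (TotalSpace.mk' F p.base w)).2 := by
      have h6 := (e'.continuousLinearEquivAt ℝ p.base hp).injective
      exact h6
    have h6 := (e'.pullback (Cyl.toBase Y)).symmL_apply (R := ℝ) (b := p) hp v
    have h7 := e'.symmL_apply (R := ℝ) hp v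
    exact h6.trans ((h5 (h4.trans h3.symm)).trans h7.symm)
  exact congrArg ((l.line l').toFun p) h2

theorem line_cylMk_sub (s t : unitInterval) (x : TotalSpace F E) :
    (l.line l').tot (cylMk s x) - (l.line l').tot (cylMk t x) =
      ((s : ℝ) - t) • (l'.tot x - l.tot x) := by
  rw [line_tot, line_tot]
  change (1 - (s : ℝ)) • l.tot x + (s : ℝ) • l'.tot x -
    ((1 - (t : ℝ)) • l.tot x + (t : ℝ) • l'.tot x) = _
  module

/-- Over the cylinder, `V` spans, and modulo `V`, the dependence on time is small. -/
structure SpansUniformly (L : Morphism H A.cyl) (V : Submodule ℝ H) [FiniteDimensional ℝ V]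
    [∀ y, CompleteSpace (E y)] [CompleteSpace H] (δ : ℝ) : Prop where
  spansWith : SpansWith L V δ
  variation : ∀ (s t : unitInterval) (x : TotalSpace F E),
    ‖(L.tot (cylMk s x) - L.tot (cylMk t x)) -
      V.starProjection (L.tot (cylMk s x) - L.tot (cylMk t x))‖ ≤ δ / 2 * ‖x.2‖

variable [CompleteSpace F] [∀ y, CompleteSpace (E y)] [CompleteSpace H]

/-- Two presentations of the same f give l' - l = c - c', so on unit vectors the difference takes
values in a compact set. A subspace V which approximates this set makes l' - l small modulo V,
although it may be large in norm. -/
theorem exists_norm_modulo_sub_le [CompactSpace Y] (hE : IsHilbertBundle F E)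
    (hH : HasApproximation G H) (hp : IsPresentation f l c) (hp' : IsPresentation f l' c')
    (V₀ : FinGSubspace G H) : ∃ (V : FinGSubspace G H) (δ : ℝ), V₀.space ≤ V.space ∧
      SpansWith l V.space δ ∧
      ∀ y v, ‖modulo (l'.toFun y - l.toFun y) V.space v‖ ≤ δ / 4 * ‖v‖ := by
  obtain ⟨V₁, δ, hV₁, hδ⟩ := exists_spansWith hE hp.isFredholm hH V₀
  have hδ0 := hδ.1
  have hK := ((hp.compact 1).prod (hp'.compact 1)).image continuous_sub
  obtain ⟨V, hV, hVK⟩ := hH _ hK (δ / 4) (by positivity) V₁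
  refine ⟨V, δ, hV₁.trans hV, hδ.mono hV, fun y => ?_⟩
  have h1 : ‖modulo (l'.toFun y - l.toFun y) V.space‖ ≤ δ / 4 := by
    refine ContinuousLinearMap.opNorm_le_of_unit_norm (by positivity) fun v hv => ?_
    let x : TotalSpace F E := TotalSpace.mk' F y v
    have hx : (l'.toFun y - l.toFun y) v = c x - c' x := by
      change l'.tot x - l.tot x = _
      rw [sub_eq_sub_iff_add_eq_add, ← hp'.eq_add, add_comm, ← hp.eq_add]
    rw [modulo_apply, hx]
    exact hVK _ ⟨(c x, c' x), ⟨subset_closure ⟨x, hv.le, rfl⟩, subset_closure ⟨x, hv.le, rfl⟩⟩, rfl⟩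
  exact fun v => (ContinuousLinearMap.le_opNorm _ v).trans
    (mul_le_mul_of_nonneg_right h1 (norm_nonneg v))

theorem norm_modulo_line_sub_le {V : FinGSubspace G H} {η : ℝ}
    (h : ∀ y v, ‖modulo (l'.toFun y - l.toFun y) V.space v‖ ≤ η * ‖v‖) (t : unitInterval) (y : Y)
    (v : E y) : ‖modulo ((1 - (t : ℝ)) • l.toFun y + (t : ℝ) • l'.toFun y - l.toFun y)
      V.space v‖ ≤ η * ‖v‖ := by
  refine le_trans ?_ (h y v)
  have h1 : (1 - (t : ℝ)) • l.toFun y + (t : ℝ) • l'.toFun y - l.toFun y =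
      (t : ℝ) • (l'.toFun y - l.toFun y) := by
    module
  rw [h1, modulo_apply, modulo_apply, _root_.smul_apply, ContinuousLinearMap.map_smul, ← smul_sub,
    norm_smul, Real.norm_eq_abs, abs_of_nonneg t.2.1]
  exact mul_le_of_le_one_left (norm_nonneg _) t.2.2

theorem isFredholm_line [CompactSpace Y] (hE : IsHilbertBundle F E) (hH : HasApproximation G H)
    (hp : IsPresentation f l c) (hp' : IsPresentation f l' c') : (l.line l').IsFredholm where
  fredholm p := by
    obtain ⟨V, δ, -, hδ, hV⟩ := exists_norm_modulo_sub_le hE hH hp hp' (Classical.arbitrary _)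
    have hδ0 := hδ.1
    exact (hδ.2 p.base).isFredholm_of_modulo_sub_le (hp.isFredholm.fredholm p.base)
      (η := δ / 4) (by positivity) (by linarith) (norm_modulo_line_sub_le hV p.time p.base)
  continuousOn e _ := continuousOn_line hp.isFredholm hp'.isFredholm e

theorem exists_spansUniformly [CompactSpace Y] (hE : IsHilbertBundle F E)
    (hH : HasApproximation G H) (hp : IsPresentation f l c) (hp' : IsPresentation f l' c')
    (V₀ : FinGSubspace G H) : ∃ (V : FinGSubspace G H) (δ : ℝ), V₀.space ≤ V.space ∧
      SpansUniformly (l.line l') V.space δ := by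
  obtain ⟨V, δ, hV₀, hδ, hV⟩ := exists_norm_modulo_sub_le hE hH hp hp' V₀
  have hδ0 := hδ.1
  -- Moving from l to l_t costs δ/4 of the lower bound. The variation in time is also at most δ/4,
  -- which is less than half of the remaining 3δ/4.
  refine ⟨V, δ - δ / 4, hV₀, ⟨by linarith, fun p => ?_⟩, fun s t x => ?_⟩
  · exact (hδ.2 p.base).of_modulo_sub_le (by positivity) (norm_modulo_line_sub_le hV p.time p.base)
  · rw [line_cylMk_sub, ContinuousLinearMap.map_smul, ← smul_sub, norm_smul, Real.norm_eq_abs]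
    have h1 : |(s : ℝ) - t| ≤ 1 := by
      rw [abs_le]
      constructor <;> linarith [s.2.1, s.2.2, t.2.1, t.2.2]
    refine (mul_le_of_le_one_left (norm_nonneg _) h1).trans ((hV x.proj x.2).trans ?_)
    exact mul_le_mul_of_nonneg_right (by linarith) (norm_nonneg _)

/-! #### Restriction of Euler classes -/

/-- f is the convex combination of its two presentations at every time. The compact parts take
values in the image of a product of [0,1] with two compact sets. -/
theorem IsPresentation.line (hL : (l.line l').IsFredholm) (hp : IsPresentation f l c)
    (hp' : IsPresentation f l' c') : IsPresentation (fun x => f (cylPr x)) (l.line l')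
      fun x => (1 - (x.proj.time : ℝ)) • c (cylPr x) + (x.proj.time : ℝ) • c' (cylPr x) where
  isFredholm := hL
  continuous := by
    have ht : Continuous fun x : TotalSpace F (CylBundle E) => (x.proj.time : ℝ) :=
      continuous_subtype_val.comp continuous_time
    exact ((continuous_const.sub ht).smul (hp.continuous.comp continuous_cylPr)).add
      (ht.smul (hp'.continuous.comp continuous_cylPr))
  compact R := by
    let φ : unitInterval × H × H → H := fun q => (1 - (q.1 : ℝ)) • q.2.1 + (q.1 : ℝ) • q.2.2
    have hφ : Continuous φ := by
      fun_prop
    have hK := (isCompact_univ.prod ((hp.compact R).prod (hp'.compact R))).image hφ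
    refine hK.of_isClosed_subset isClosed_closure (closure_minimal ?_ hK.isClosed)
    rintro _ ⟨x, hx, rfl⟩
    exact ⟨(x.proj.time, c (cylPr x), c' (cylPr x)), ⟨mem_univ _, subset_closure ⟨cylPr x, hx, rfl⟩,
      subset_closure ⟨cylPr x, hx, rfl⟩⟩, rfl⟩
  eq_add x := by
    rw [line_tot]
    have h1 := hp.eq_add (cylPr x)
    have h2 := hp'.eq_add (cylPr x)
    have h3 : f (cylPr x) = (1 - (x.proj.time : ℝ)) • f (cylPr x) +
        (x.proj.time : ℝ) • f (cylPr x) := by module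
    rw [h3]
    nth_rw 1 [h1]
    rw [h2]
    module

variable {t : unitInterval}

theorem GHomotopic.restrict (h : ∀ x, L.tot (cylMk t x) = l.tot x) {V : FinGSubspace G H}
    {α β : OnePoint (F₀ L V) → OnePoint V.space} (hαβ : GHomotopic L V α β) :
    GHomotopic l V (fun x => α (OnePoint.map (F₀.incl h V) x))
      fun x => β (OnePoint.map (F₀.incl h V) x) := by
  obtain ⟨k, hk, hk', h0, h1⟩ := hαβ
  exact ⟨fun p => k (p.1, OnePoint.map (F₀.incl h V) p.2),
    hk.comp (continuous_fst.prodMk ((F₀.continuous_map_incl h V).comp continuous_snd)),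
    fun s => (hk' s).restrict h, fun x => h0 _, fun x => h1 _⟩

theorem StableCohomotopy.mk_congr {V : FinGSubspace G H} {hs : Spans l V}
    {α β : OnePoint (F₀ l V) → OnePoint V.space} {hα : IsPointedGMap l V α}
    {hβ : IsPointedGMap l V β} (h : α = β) :
    StableCohomotopy.mk ⟨V, hs, α, hα⟩ = StableCohomotopy.mk ⟨V, hs, β, hβ⟩ := by
  subst h
  rfl

theorem finiteApprox_restrict (h : ∀ x, L.tot (cylMk t x) = l.tot x) (V : FinGSubspace G H) :
    (fun x => finiteApprox (fun x => f (cylPr x)) L V (OnePoint.map (F₀.incl h V) x)) =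
      finiteApprox f l V := by
  funext x
  induction x using OnePoint.rec with
  | infty => rfl
  | coe x => rfl

theorem IsAdmissible.restrict (h : ∀ x, L.tot (cylMk t x) = l.tot x) {V : FinGSubspace G H}
    (hV : IsAdmissible (fun x => f (cylPr x)) L V) : IsAdmissible f l V where
  spans := hV.spans.restrict h
  misses W hVW x hx := hV.misses W hVW (cylMk t x) (by rwa [h])
  homotopic W hVW := by
    have h1 := (hV.homotopic W hVW).restrict h
    rw [finiteApprox_restrict] at h1
    rwa [funext fun x => suspend_restrict h hVW _ x, finiteApprox_restrict] at h1

/-- A subspace which is admissible over the cylinder is admissible over the time slice, and the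
finite dimensional approximation restricts to that of f. So one V represents both classes. -/
theorem IsEulerClass.restrict_eq (h : ∀ x, L.tot (cylMk t x) = l.tot x) {ε : StableCohomotopy L}
    {e : StableCohomotopy l} (hε : IsEulerClass (fun x => f (cylPr x)) L ε)
    (he : IsEulerClass f l e) : restrict h ε = e := by
  obtain ⟨V, -, hV⟩ := hε.cofinal (Classical.arbitrary _)
  obtain ⟨_, rfl⟩ := hε.eq V hV
  obtain ⟨_, rfl⟩ := he.eq V (hV.restrict h)
  exact StableCohomotopy.mk_congr (finiteApprox_restrict h V)

end Cylinder

/-! ### Bijectivity of the restriction maps -/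

section StablyHomotopic

variable {G : Type*} [Group G] [TopologicalSpace G] {B : Type*} [TopologicalSpace B]
  [CompactSpace B] [MulAction G B]
  {F : Type*} [NormedAddCommGroup F] [InnerProductSpace ℝ F] [CompleteSpace F]
  {E : B → Type*} [∀ b, NormedAddCommGroup (E b)] [∀ b, InnerProductSpace ℝ (E b)]
  [∀ b, CompleteSpace (E b)]
  [TopologicalSpace (TotalSpace F E)] [FiberBundle F E] [VectorBundle ℝ F E]
  {H : Type*} [NormedAddCommGroup H] [InnerProductSpace ℝ H] [CompleteSpace H]
  [DistribMulAction G H] [SMulCommClass G ℝ H]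
  {A : GAction G F E} {l : Morphism H A}

/-- All sufficiently large suspensions of `a` and `b` are homotopic. -/
def Rep.StablyHomotopic (l : Morphism H A) (a b : Rep l) : Prop :=
  ∃ W₀ : FinGSubspace G H, a.V.space ≤ W₀.space ∧ b.V.space ≤ W₀.space ∧
    ∀ (W : FinGSubspace G H) (ha : a.V.space ≤ W.space) (hb : b.V.space ≤ W.space),
      W₀.space ≤ W.space → GHomotopic l W (suspend l ha a.map) (suspend l hb b.map)

/-- Asking for homotopies on all W beyond some W₀ makes transitivity immediate: both homotopies are
available on any W containing the sum of the two bounds. -/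
theorem Rep.stablyHomotopic_equivalence (hE : IsHilbertBundle F E) (hl : l.IsFredholm)
    (hG : ∀ (g : G) (h : H), ‖g • h‖ = ‖h‖) : Equivalence (Rep.StablyHomotopic l) where
  refl a := by
    obtain ⟨δ, hδ⟩ := a.spans.spansWith hE hl
    exact ⟨a.V, le_rfl, le_rfl, fun W ha _ _ =>
      GHomotopic.refl (a.isPointedGMap.suspend hE hl hG hδ ha)⟩
  symm := by
    rintro a b ⟨W₀, ha, hb, h⟩
    exact ⟨W₀, hb, ha, fun W hb ha hW => (h W ha hb hW).symm⟩
  trans := by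
    rintro a b c ⟨W₀, ha, hb, h⟩ ⟨W₁, hb', hc, h'⟩
    refine ⟨W₀.sup W₁, ha.trans (W₀.le_sup_left W₁), hc.trans (W₀.le_sup_right W₁),
      fun W ha hc hW => ?_⟩
    have h0 := (W₀.le_sup_left W₁).trans hW
    exact (h W ha (hb.trans h0) h0).trans (h' W _ hc ((W₀.le_sup_right W₁).trans hW))

theorem Rep.Rel.stablyHomotopic (hE : IsHilbertBundle F E) (hl : l.IsFredholm)
    (hG : ∀ (g : G) (h : H), ‖g • h‖ = ‖h‖) {a b : Rep l} (h : Rep.Rel l a b) :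
    Rep.StablyHomotopic l a b := by
  obtain ⟨hab, h⟩ := h
  refine ⟨b.V, hab, le_rfl, fun W ha hb _ => ?_⟩
  obtain ⟨δ, hδ⟩ := a.spans.spansWith hE hl
  exact ((h.suspend hE hl hG (hδ.mono hab) hb).trans
    (gHomotopic_suspend_suspend hE hl hG hδ hab hb a.isPointedGMap)).symm

/-- Equality in the quotient is the equivalence relation generated by `Rep.Rel`. Since stable
homotopy is an equivalence relation containing it, equal classes become homotopic on one large
subspace. -/
theorem Rep.stablyHomotopic_of_mk_eq (hE : IsHilbertBundle F E) (hl : l.IsFredholm)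
    (hG : ∀ (g : G) (h : H), ‖g • h‖ = ‖h‖) {a b : Rep l}
    (h : StableCohomotopy.mk a = StableCohomotopy.mk b) : Rep.StablyHomotopic l a b :=
  (Rep.stablyHomotopic_equivalence hE hl hG).eqvGen_iff.1
    ((Quot.eqvGen_exact h).mono fun _ _ => Rep.Rel.stablyHomotopic hE hl hG)

theorem StableCohomotopy.mk_eq_of_gHomotopic {a : Rep l} {W : FinGSubspace G H}
    {β : OnePoint (F₀ l W) → OnePoint W.space} (h : a.V.space ≤ W.space)
    (hβ : GHomotopic l W β (suspend l h a.map)) :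
    StableCohomotopy.mk a = StableCohomotopy.mk ⟨W, a.spans.mono h, β, hβ.left⟩ :=
  Quot.sound ⟨h, hβ⟩

end StablyHomotopic

/-- Homotopies can be composed with equivariant families of proper maps. -/
theorem gHomotopic_comp {G : Type*} [Group G] [TopologicalSpace G]
    {H : Type*} [NormedAddCommGroup H] [InnerProductSpace ℝ H] [DistribMulAction G H]
    {B : Type*} [MulAction G B] {F : Type*}
    {E : B → Type*} [∀ b, NormedAddCommGroup (E b)] [∀ b, InnerProductSpace ℝ (E b)]
    [TopologicalSpace (TotalSpace F E)] {A : GAction G F E} {l : Morphism H A}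
    {B' : Type*} [MulAction G B'] {F' : Type*}
    {E' : B' → Type*} [∀ b, NormedAddCommGroup (E' b)] [∀ b, InnerProductSpace ℝ (E' b)]
    [TopologicalSpace (TotalSpace F' E')] {A' : GAction G F' E'} {l' : Morphism H A'}
    {V : FinGSubspace G H}
    (hn : Continuous fun x : F₀ l V => ‖x.1.2‖)
    (hd : ∀ R : ℝ, IsCompact {x : F₀ l V | ‖x.1.2‖ ≤ R})
    (hn' : Continuous fun x : F₀ l' V => ‖x.1.2‖)
    {k : unitInterval × OnePoint (F₀ l' V) → OnePoint V.space} (hk : Continuous k)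
    (hk' : ∀ t, IsPointedGMap l' V fun x => k (t, x))
    {φ : unitInterval × F₀ l V → F₀ l' V} (hφ : Continuous φ)
    (hφG : ∀ g t x, φ (t, F₀.act l V g x) = F₀.act l' V g (φ (t, x)))
    {C : ℝ} (hC : 0 ≤ C) (hφC : ∀ t x, ‖x.1.2‖ ≤ C * ‖(φ (t, x)).1.2‖) :
    GHomotopic l V (fun x => k (0, OnePoint.map (fun y => φ (0, y)) x))
      fun x => k (1, OnePoint.map (fun y => φ (1, y)) x) := by
  let K : unitInterval × OnePoint (F₀ l V) → OnePoint V.space := fun p =>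
    k (p.1, OnePoint.map (fun y => φ (p.1, y)) p.2)
  have hK : Continuous K := by
    refine continuous_family hn hd (fun t => (hk' t).map_infty) ?_ fun t₀ R => ?_
    · exact hk.comp (continuous_fst.prodMk (OnePoint.continuous_coe.comp hφ))
    · obtain ⟨r, hr⟩ := exists_radius hn' hk (fun t => (hk' t).map_infty) R
      refine ⟨C * |r|, Eventually.of_forall fun t x hx v hv => hr t (φ (t, x)) ?_ v hv⟩
      by_contra! hle
      exact absurd ((hφC t x).trans (mul_le_mul_of_nonneg_left (hle.trans (le_abs_self r)) hC))
        (not_le.2 hx)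
  refine ⟨K, hK, fun t => ⟨hK.comp (continuous_const.prodMk continuous_id), (hk' t).map_infty, ?_⟩,
    fun _ => rfl, fun _ => rfl⟩
  intro g x
  induction x using OnePoint.rec with
  | infty => exact (hk' t).equivariant g OnePoint.infty
  | coe x =>
    refine Eq.trans ?_ ((hk' t).equivariant g (φ (t, x) : F₀ l' V))
    exact congrArg (fun z : F₀ l' V => k (t, (z : OnePoint (F₀ l' V)))) (hφG g t x)

section Restriction

variable {G : Type*} [Group G] [TopologicalSpace G]
  {Y : Type*} [TopologicalSpace Y] [CompactSpace Y] [MulAction G Y]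
  {F : Type*} [NormedAddCommGroup F] [InnerProductSpace ℝ F] [CompleteSpace F]
  {E : Y → Type*} [∀ y, NormedAddCommGroup (E y)] [∀ y, InnerProductSpace ℝ (E y)]
  [∀ y, CompleteSpace (E y)]
  [TopologicalSpace (TotalSpace F E)] [FiberBundle F E] [VectorBundle ℝ F E]
  {H : Type*} [NormedAddCommGroup H] [InnerProductSpace ℝ H] [CompleteSpace H]
  [DistribMulAction G H] [SMulCommClass G ℝ H]
  {A : GAction G F E} {l : Morphism H A} {L : Morphism H A.cyl} {t : unitInterval}
  {W : FinGSubspace G H} {δ : ℝ}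

/-- The point `(1 - s) a + s b` of the unit interval. -/
def unitIntervalMix (s a b : unitInterval) : unitInterval :=
  ⟨(1 - (s : ℝ)) * a + s * b, convex_Icc (0 : ℝ) 1 a.2 b.2 (sub_nonneg.2 s.2.2) s.2.1
    (sub_add_cancel _ _)⟩

theorem SpansWith.restrict (h : ∀ x, L.tot (cylMk t x) = l.tot x) (hL : SpansWith L W.space δ) :
    SpansWith l W.space δ := by
  refine ⟨hL.1, fun y => ?_⟩
  have h1 : (show E y →L[ℝ] H from L.toFun (⟨y, t⟩ : Cyl Y)) = l.toFun y :=
    ContinuousLinearMap.ext fun v => h (TotalSpace.mk' F y v)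
  rw [← h1]
  exact hL.2 (⟨y, t⟩ : Cyl Y)

/-- The projections of the fibers of `F₀(V)` to those at other times are injective, with
bounded inverse. -/
theorem SpansUniformly.norm_le_two_mul (hL : SpansUniformly L W.space δ) (s : unitInterval)
    (x : F₀ L W) : ‖x.1.2‖ ≤ 2 * ‖(F₀.proj L W (cylMk s (cylPr x.1))).1.2‖ := by
  let z := cylMk s (cylPr x.1)
  have h1 := hL.spansWith.norm_sub_projVec_le z
  have h2 := hL.variation s x.1.proj.time (cylPr x.1)
  have hx : L.tot (cylMk x.1.proj.time (cylPr x.1)) ∈ W.space := x.2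
  -- At its own time the point is mapped into W, so the variation is exactly the component of its
  -- image at time s orthogonal to W. Hence the projection moves the point by at most half its norm.
  rw [map_sub, Submodule.starProjection_eq_self_iff.2 hx, sub_sub_sub_cancel_right] at h2
  have h3 : ‖z.2 - projVec L W z‖ ≤ 1 / 2 * ‖z.2‖ := by
    refine le_of_mul_le_mul_left ?_ hL.spansWith.1
    refine (h1.trans h2).trans (le_of_eq ?_)
    change δ / 2 * ‖z.2‖ = _
    ring
  have h4 := norm_add_le (z.2 - projVec L W z) (projVec L W z)
  rw [sub_add_cancel] at h4
  change ‖z.2‖ ≤ 2 * ‖projVec L W z‖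
  linarith

/-! ### Retraction of F₀(V) over the cylinder to a time slice -/

variable (L W) in
/-- The path which starts at a point of `F₀(V)` over the cylinder and ends in its projection to
the fiber over the time `t`. -/
def trackTo (t : unitInterval) (p : unitInterval × F₀ L W) : F₀ L W :=
  F₀.proj L W (cylMk (unitIntervalMix p.1 p.2.1.proj.time t) (cylPr p.2.1))

theorem trackTo_zero (x : F₀ L W) : trackTo L W t (0, x) = x := by
  have : unitIntervalMix 0 x.1.proj.time t = x.1.proj.time := Subtype.ext (by simp [unitIntervalMix])
  rw [trackTo, this]
  exact proj_of_mem x.2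

theorem trackTo_one (h : ∀ x, L.tot (cylMk t x) = l.tot x) (x : F₀ L W) :
    trackTo L W t (1, x) = F₀.incl h W (F₀.proj l W (cylPr x.1)) := by
  have : unitIntervalMix 1 x.1.proj.time t = t := Subtype.ext (by simp [unitIntervalMix])
  rw [trackTo, this, F₀.proj_incl h]

theorem continuous_trackTo (hE : IsHilbertBundle F E) (hL : L.IsFredholm)
    (hW : SpansWith L W.space δ) : Continuous (trackTo L W t) := by
  refine (continuous_proj hE.cyl hL hW).comp (continuous_cylMk.comp (Continuous.prodMk ?_ ?_))
  · have h1 : Continuous fun p : unitInterval × F₀ L W => (p.1 : ℝ) :=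
      continuous_subtype_val.comp continuous_fst
    have h2 : Continuous fun p : unitInterval × F₀ L W => (p.2.1.proj.time : ℝ) :=
      continuous_subtype_val.comp (continuous_time.comp (continuous_subtype_val.comp continuous_snd))
    exact Continuous.subtype_mk (((continuous_const.sub h1).mul h2).add
      (h1.mul continuous_const)) _
  · exact continuous_cylPr.comp (continuous_subtype_val.comp continuous_snd)

theorem trackTo_act (g : G) (s : unitInterval) (x : F₀ L W) :
    trackTo L W t (s, F₀.act L W g x) = F₀.act L W g (trackTo L W t (s, x)) :=
  proj_tot W g (cylMk (unitIntervalMix s x.1.proj.time t) (cylPr x.1))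

/-- The projection of `F₀(V)` over the cylinder to its restriction to the time `t`. -/
def retract (l : Morphism H A) (W : FinGSubspace G H) (x : F₀ L W) : F₀ l W :=
  F₀.proj l W (cylPr x.1)

/-- Precomposing α with the sliding paths connects it to its composite with retraction and
inclusion. The factor 2 in `norm_le_two_mul` ensures that the slides do not bring points in from
infinity. -/
theorem gHomotopic_comp_trackTo (hE : IsHilbertBundle F E) (hL : L.IsFredholm)
    (hW : SpansUniformly L W.space δ) (h : ∀ x, L.tot (cylMk t x) = l.tot x)
    {α : OnePoint (F₀ L W) → OnePoint W.space} (hα : IsPointedGMap L W α) :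
    GHomotopic L W α
      fun x => α (OnePoint.map (F₀.incl h W) (OnePoint.map (retract l W) x)) := by
  have h1 := gHomotopic_comp (continuous_norm_val hE.cyl) (isCompact_disk hE.cyl hL hW.spansWith)
    (continuous_norm_val hE.cyl) (k := fun p => α p.2) (hα.continuous.comp continuous_snd)
    (fun _ => hα) (continuous_trackTo (t := t) hE hL hW.spansWith) trackTo_act zero_le_two
    fun s x => hW.norm_le_two_mul _ x
  convert h1 using 1
  · funext x
    induction x using OnePoint.rec with
    | infty => rfl
    | coe x => exact congrArg (fun z : F₀ L W => α z) (trackTo_zero x).symm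
  · funext x
    induction x using OnePoint.rec with
    | infty => rfl
    | coe x => exact congrArg (fun z : F₀ L W => α z) (trackTo_one h x).symm

theorem GHomotopic.comp_retract (hE : IsHilbertBundle F E) (hL : L.IsFredholm)
    (hl : l.IsFredholm) (hW : SpansUniformly L W.space δ) (h : ∀ x, L.tot (cylMk t x) = l.tot x)
    {α β : OnePoint (F₀ l W) → OnePoint W.space} (hαβ : GHomotopic l W α β) :
    GHomotopic L W (fun x => α (OnePoint.map (retract l W) x))
      fun x => β (OnePoint.map (retract l W) x) := by
  obtain ⟨k, hk, hk', h0, h1⟩ := hαβ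
  obtain rfl := funext h0
  obtain rfl := funext h1
  refine gHomotopic_comp (continuous_norm_val hE.cyl) (isCompact_disk hE.cyl hL hW.spansWith)
    (continuous_norm_val hE) hk hk' (φ := fun p => retract l W p.2) ?_ ?_ zero_le_two ?_
  · exact (continuous_proj hE hl (hW.spansWith.restrict h)).comp
      (continuous_cylPr.comp (continuous_subtype_val.comp continuous_snd))
  · exact fun g _ x => proj_tot W g (cylPr x.1)
  · intro s x
    have h2 := hW.norm_le_two_mul t x
    rwa [F₀.proj_incl h] at h2

theorem retract_incl (h : ∀ x, L.tot (cylMk t x) = l.tot x) (x : OnePoint (F₀ l W)) :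
    OnePoint.map (retract l W) (OnePoint.map (F₀.incl h W) x) = x := by
  induction x using OnePoint.rec with
  | infty => rfl
  | coe x => exact congrArg _ (proj_of_mem x.2)

/-- On a subspace which spans uniformly, the retraction to the slice is a homotopy inverse of the
inclusion, as far as pointed G-maps are concerned. Uniform subspaces are cofinal, so every class and
every homotopy can be suspended to such a subspace and then pulled back along the retraction. -/
theorem restrict_bijective (hE : IsHilbertBundle F E) (hG : ∀ (g : G) (h : H), ‖g • h‖ = ‖h‖)
    (hL : L.IsFredholm) (hl : l.IsFredholm)
    (hLS : ∀ V₀ : FinGSubspace G H, ∃ (V : FinGSubspace G H) (δ : ℝ), V₀.space ≤ V.space ∧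
      SpansUniformly L V.space δ)
    (h : ∀ x, L.tot (cylMk t x) = l.tot x) : Function.Bijective (restrict h) := by
  constructor
  · rintro ⟨a⟩ ⟨b⟩ hab
    obtain ⟨W₀, ha, hb, hW₀⟩ := Rep.stablyHomotopic_of_mk_eq hE hl hG hab
    obtain ⟨W, δ, hW, hδ⟩ := hLS W₀
    have ha' : a.V.space ≤ W.space := ha.trans hW
    have hb' : b.V.space ≤ W.space := hb.trans hW
    have h1 := hW₀ W ha' hb' hW
    rw [← funext fun x => suspend_restrict h ha' a.map x,
      ← funext fun x => suspend_restrict h hb' b.map x] at h1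
    obtain ⟨δa, hδa⟩ := a.spans.spansWith hE.cyl hL
    obtain ⟨δb, hδb⟩ := b.spans.spansWith hE.cyl hL
    have hpa := a.isPointedGMap.suspend hE.cyl hL hG hδa ha'
    have hpb := b.isPointedGMap.suspend hE.cyl hL hG hδb hb'
    -- Replace each suspension by the pullback of its restriction to the slice; the restrictions are
    -- homotopic.
    have h2 := ((gHomotopic_comp_trackTo hE hL hδ h hpa).trans
      (h1.comp_retract hE hL hl hδ h)).trans (gHomotopic_comp_trackTo hE hL hδ h hpb).symm
    exact (StableCohomotopy.mk_eq_of_gHomotopic ha' (GHomotopic.refl hpa)).trans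
      (StableCohomotopy.mk_eq_of_gHomotopic hb' h2).symm
  · rintro ⟨a⟩
    obtain ⟨W, δ, ha, hδ⟩ := hLS a.V
    have h1 := GHomotopic.refl (a.isPointedGMap.suspend hE hl hG
      (a.spans.spansWith hE hl).choose_spec ha)
    have h2 := (h1.comp_retract hE hL hl hδ h).left
    refine ⟨StableCohomotopy.mk ⟨W, hδ.spansWith.spans, _, h2⟩, ?_⟩
    refine Eq.trans ?_ (StableCohomotopy.mk_eq_of_gHomotopic ha h1).symm
    refine StableCohomotopy.mk_congr (funext fun x => ?_)
    -- The retraction is the identity on the slice, so restricting the pullback returns the original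
    -- map exactly, not only up to homotopy.
    exact congrArg (suspend l ha a.map) (retract_incl h x)

end Restriction

/-! ### Finite `G`-CW complexes and proper maps -/

theorem FiniteGCWComplex.compactSpace {G Y : Type*} [Group G] [TopologicalSpace G]
    [CompactSpace G] [TopologicalSpace Y] [MulAction G Y] (cw : FiniteGCWComplex G Y) :
    CompactSpace Y := by
  refine ⟨?_⟩
  have h1 : IsCompact (⋃ i, (fun p : G × EuclideanSpace ℝ (Fin (cw.dim i)) => cw.char i p.1 p.2) ''
      (univ ×ˢ Metric.closedBall 0 1)) :=
    isCompact_iUnion fun i => (isCompact_univ.prod (isCompact_closedBall 0 1)).image_of_continuousOn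
      (cw.continuousOn_char i)
  convert h1
  refine (eq_univ_of_forall fun z => ?_).symm
  obtain ⟨i, g, x, hx, rfl⟩ := cw.covers z
  exact mem_iUnion.2 ⟨i, (g, x), ⟨mem_univ _, mem_closedBall_zero_iff.2 hx.le⟩, rfl⟩

/-- The points at infinity together with the vectors longer than R form an open set. Its preimage is
a neighbourhood of the points at infinity of E, and finitely many of the local radii suffice over a
compact base. -/
theorem exists_lt_norm_of_continuous_fiberwiseExtension {B : Type*} [TopologicalSpace B]
    [CompactSpace B] {F : Type*} {E : B → Type*} [∀ b, NormedAddCommGroup (E b)]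
    [TopologicalSpace (TotalSpace F E)] {H : Type*} [NormedAddCommGroup H]
    {f : TotalSpace F E → H} (hf : Continuous (fiberwiseExtension f)) (R : ℝ) :
    ∃ r : ℝ, ∀ x, r < ‖x.2‖ → R < ‖f x‖ := by
  let U : Set (FiberwiseCompletion H (Bundle.Trivial B H)) := fun z =>
    Sum.elim (fun x => R < ‖x.2‖) (fun _ => True) z
  have hU : IsOpen U := by
    refine ⟨?_, fun b _ => ⟨univ, univ_mem, R, fun _ _ => trivial, fun x _ hx => hx⟩⟩
    have h1 : Continuous fun x : TotalSpace H (Bundle.Trivial B H) => ‖(x.2 : H)‖ :=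
      (continuous_snd.comp (Bundle.Trivial.homeomorphProd B H).continuous).norm
    exact isOpen_lt continuous_const h1
  have h1 := (hU.preimage hf).2
  have h2 : ∃ r : ℝ, ∀ x : TotalSpace F E, x.proj ∈ (univ : Set B) → r < ‖x.2‖ → R < ‖f x‖ := by
    refine isCompact_univ.induction_on (p := fun s => ∃ r : ℝ, ∀ x : TotalSpace F E,
      x.proj ∈ s → r < ‖x.2‖ → R < ‖f x‖) ⟨0, by simp⟩ ?_ ?_ ?_
    · rintro s t hst ⟨r, hr⟩
      exact ⟨r, fun x hx => hr x (hst hx)⟩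
    · rintro s t ⟨r, hr⟩ ⟨r', hr'⟩
      refine ⟨max r r', fun x hx hlt => ?_⟩
      rcases hx with hx | hx
      · exact hr x hx ((le_max_left _ _).trans_lt hlt)
      · exact hr' x hx ((le_max_right _ _).trans_lt hlt)
    · intro b _
      obtain ⟨N, hN, r, -, hr⟩ := h1 b trivial
      exact ⟨N, mem_nhdsWithin_of_mem_nhds hN, r, fun x hx hlt => hr x hx hlt⟩
  exact h2.imp fun r hr x => hr x (mem_univ _)

end CohomotopyEuler

end

/-! ### The Euler class and its independence of the presentation -/

theorem mainTheorem3
    {G : Type*} [Group G] [TopologicalSpace G] [CompactSpace G] [T2Space G] {d : ℕ}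
    [ChartedSpace (EuclideanSpace ℝ (Fin d)) G] [LieGroup (𝓡 d) ∞ G]
    {H : Type*} [NormedAddCommGroup H] [InnerProductSpace ℝ H] [CompleteSpace H]
    [TopologicalSpace.SeparableSpace H] [DistribMulAction G H] [SMulCommClass G ℝ H]
    [ContinuousSMul G H] (hH : CohomotopyEuler.IsUniverse G H)
    {Y : Type*} [TopologicalSpace Y] [T2Space Y] [MulAction G Y] [ContinuousSMul G Y]
    (cw : CohomotopyEuler.FiniteGCWComplex G Y)
    {F : Type*} [NormedAddCommGroup F] [InnerProductSpace ℝ F] [CompleteSpace F]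
    [TopologicalSpace.SeparableSpace F]
    {E : Y → Type*} [∀ y, NormedAddCommGroup (E y)] [∀ y, InnerProductSpace ℝ (E y)]
    [∀ y, CompleteSpace (E y)] [TopologicalSpace (TotalSpace F E)]
    [FiberBundle F E] [VectorBundle ℝ F E] (hE : CohomotopyEuler.IsHilbertBundle F E)
    (A : CohomotopyEuler.GAction G F E)
    (f : TotalSpace F E → H) (hf : ∀ g x, f (A.tot g x) = g • f x)
    (hext : Continuous (CohomotopyEuler.fiberwiseExtension f))
    (l : CohomotopyEuler.Morphism H A) (c : TotalSpace F E → H)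
    (hlc : CohomotopyEuler.IsPresentation f l c) :
    (∃! e : CohomotopyEuler.StableCohomotopy l, CohomotopyEuler.IsEulerClass f l e) ∧
    ∀ (l' : CohomotopyEuler.Morphism H A) (c' : TotalSpace F E → H),
      CohomotopyEuler.IsPresentation f l' c' →
        (l.line l').IsFredholm ∧
        Function.Bijective (CohomotopyEuler.restrict (l.line_zero l')) ∧
        Function.Bijective (CohomotopyEuler.restrict (l.line_one l')) ∧
        ∀ (e : CohomotopyEuler.StableCohomotopy l) (e' : CohomotopyEuler.StableCohomotopy l'),
          CohomotopyEuler.IsEulerClass f l e → CohomotopyEuler.IsEulerClass f l' e' →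
            ∃ ε : CohomotopyEuler.StableCohomotopy (l.line l'),
              CohomotopyEuler.restrict (l.line_zero l') ε = e ∧
              CohomotopyEuler.restrict (l.line_one l') ε = e' := by
  have := cw.compactSpace
  have := topologicalGroup_of_lieGroup (𝓡 d) ∞ (G := G)
  have hG := hH.norm_smul
  have hA : CohomotopyEuler.HasApproximation G H := fun K hK ε hε V₀ =>
    CohomotopyEuler.exists_finGSubspace_approx hG hK hε V₀
  have hfp := CohomotopyEuler.exists_lt_norm_of_continuous_fiberwiseExtension hext
  constructor
  · obtain ⟨e, he⟩ := CohomotopyEuler.exists_isEulerClass hE hA hG hlc hf hfp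
    exact ⟨e, he, fun e' he' => he'.unique he⟩
  · intro l' c' hlc'
    have hL := CohomotopyEuler.isFredholm_line hE hA hlc hlc'
    have hLS := CohomotopyEuler.exists_spansUniformly hE hA hlc hlc'
    refine ⟨hL, CohomotopyEuler.restrict_bijective hE hG hL hlc.isFredholm hLS _,
      CohomotopyEuler.restrict_bijective hE hG hL hlc'.isFredholm hLS _, fun e e' he he' => ?_⟩
    -- The Euler class of the pullback of f to the cylinder; properness is inherited because norms
    -- and values do not depend on time.
    obtain ⟨ε, hε⟩ := CohomotopyEuler.exists_isEulerClass hE.cyl hA hG (hlc.line hL hlc')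
      (fun g x => hf g (CohomotopyEuler.cylPr x))
      (fun R => (hfp R).imp fun r hr x hx => hr (CohomotopyEuler.cylPr x) hx)
    exact ⟨ε, hε.restrict_eq _ he, hε.restrict_eq _ he'⟩
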